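/- Let $R$ be a commutative ring and $d\ge 0$ an integer (the ambient dimension; only its parity matters). **Diagrams.** A *generalized $T_*^*$-diagram* consists of $n\ge 0$ active points $t_1<\dots<t_n$ on a line; a finite set of oriented chords, each joining two distinct active points, at most one chord per pair, such that the graph formed by the points and chords is a forest; over each active point $t_p$ some number $k_p\ge 0$ of *top asterisks*; and at each active point at most one *bottom asterisk*. It is a *$T_*^*$-diagram* if moreover every active point is an end of a chord or carries an asterisk (top or bottom), and a *generalized $T_*$-diagram* if it has no top asterisks. A diagram is oriented by a monomial containing each of the following once: the points $t_p$ and the places $a_p^j$ of the top asterisks, $1\le j\le k_p$, counted from top to bottom (degree $-1$), the chords $\alpha_{pq}$ (from $t_p$ to $t_q$), the bottom asterisks $\alpha_p^*$ and the top asterisks $\alpha^*{}_p^j$ (degree $d-1$). Let $\mathcal G$ be the $R$-module spanned by oriented generalized $T_*^*$-diagrams modulo graded commutativity of the orienting monomials, $\alpha_{pq}=(-1)^d\alpha_{qp}$, and the Arnol'd relations $\alpha_{ij}\alpha_{jk}+\alpha_{jk}\alpha_{ki}+\alpha_{ki}\alpha_{ij}=0$ ($i,j,k$ distinct). Let $T_*^*D\subset\mathcal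 G$ be the span of the $T_*^*$-diagrams. **Operations.** For diagrams $A,B$ with at least one active point, $A\vDash B$ is the sum of all diagrams obtained by gluing the left-most active point of $A$ to the left-most active point of $B$, the other active points, and the top asterisks over the two left-most points, being shuffled; if $A$, $B$ are oriented by $tA'$, $tB'$ with $t$ the left-most point, the result is oriented by $tA'B'$. For diagrams $A_1,\dots,A_\ell$ with at least one active point each and a generalized $T_*$-diagram $D$ with exactly $\ell$ active points, oriented by $t_1\cdots t_\ell\,w$, let $\langle A_1,\dots,A_\ell\,|\,D\rangle$ be the sum, over all shuffles of the active points of $A_1,\dots,A_\ell$ for which the left-most point of $A_i$ lies to the left of that of $A_{i+1}$ for all $i$, of the diagrams obtained by gluing $t_i$ to the left-most point of $A_i$ for every $i$, oriented by the concatenation of the monomials of $A_1,\dots,A_\ell$ followed by $w$. In both operations a term in which two bottom asterisks are put on one point is zero. The second operation is extended multilinearly in $A_1,\dots,A_\ell$. **The map $I$.** For $k\ge 0$ let $Z_k$ be the diagram with one active point and $k$ top asterisks, oriented by $t_1(\alpha^*{}_1^1a_1^1)\cdots(\alpha^*{}_1^ka_1^k)$, and let $\hat Z_k$ be the diagram with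 active points $t_0<\dots<t_k$ and chords from $t_0$ to each of $t_1,\dots,t_k$, oriented by $t_0(\alpha_{01}t_1)\cdots(\alpha_{0k}t_k)$; thus $Z_0=\hat Z_0$ is a single point. Every diagram $D$ with $\ell$ active points can be written as $D=\langle Z_{k_1},\dots,Z_{k_\ell}\,|\,D_{bottom}\rangle$, where $k_i$ is the number of top asterisks over the $i$-th active point and $D_{bottom}$ is $D$ with all top asterisks removed, suitably oriented. Put $I(Z_k)=\sum_{i=0}^k Z_{k-i}\vDash\hat Z_i$ and $$I(D)=\langle I(Z_{k_1}),\dots,I(Z_{k_\ell})\,|\,D_{bottom}\rangle .$$ **Proposition.** The map $I$ is a linear isomorphism of $\mathcal G$ onto itself, it restricts to an isomorphism of $T_*^*D$ onto itself, and its inverse is given as follows. 1. $\displaystyle I^{-1}(Z_k)=\sum_{i=0}^{k}(-1)^{\,i+d\frac{i(i-1)}2}\,Z_{k-i}\vDash\hat Z_i$ for $k=0,1,2,\dots$ 2. For every diagram $D$, with $k_i$ and $D_{bottom}$ as above, $$I^{-1}(D)=I^{-1}\langle Z_{k_1},\dots,Z_{k_\ell}\,|\,D_{bottom}\rangle=\langle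 I^{-1}(Z_{k_1}),\dots,I^{-1}(Z_{k_\ell})\,|\,D_{bottom}\rangle .$$ Here the right-hand side does not depend on the choice of linear combinations of oriented diagrams representing the elements $I^{-1}(Z_{k_i})$. -/

import Mathlib

noncomputable section

namespace TDiagram

/-! ### Diagrams and their orienting monomials -/

/-- The elements of the orienting set of a diagram whose set of active points is `P`.
The top asterisks on a half-line are counted from top to bottom, starting with `j = 0`. -/
inductive Letter (P : Type) : Type
  /-- the active point `t_p` -/
  | pt (p : P)
  /-- the place `a_p^j` of the `j`-th top asterisk on the half-line over `p` -/
  | place (p : P) (j : ℕ)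
  /-- the chord `α_{pq}`, oriented from `p` to `q` -/
  | chord (p q : P)
  /-- the bottom asterisk `α_p^*` -/
  | bot (p : P)
  /-- the top asterisk `α^*_p^j` -/
  | top (p : P) (j : ℕ)

namespace Letter

/-- Degree of a letter: `-1` for active points and places of top asterisks, `d - 1` for chords and
asterisks. -/
def deg (d : ℕ) {P : Type} : Letter P → ℤ
  | pt _ => -1
  | place _ _ => -1
  | chord _ _ => (d : ℤ) - 1
  | bot _ => (d : ℤ) - 1
  | top _ _ => (d : ℤ) - 1

/-- Chords and bottom asterisks. -/
def isBottom {P : Type} : Letter P → Bool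
  | chord _ _ => true
  | bot _ => true
  | _ => false

/-- Renaming: active points by `f`, the top asterisks over `p` by `g p`. -/
def relabel {P Q : Type} (f : P → Q) (g : P → ℕ → ℕ) : Letter P → Letter Q
  | pt p => pt (f p)
  | place p j => place (f p) (g p j)
  | chord p q => chord (f p) (f q)
  | bot p => bot (f p)
  | top p j => top (f p) (g p j)

/-- Renaming of the active points. -/
def map {P Q : Type} (f : P → Q) : Letter P → Letter Q :=
  relabel f fun _ j => j

/-- The position of a letter in the normal form
`t_1 (α^*_1^1 a_1^1) (α^*_1^2 a_1^2) … t_2 (α^*_2^1 a_2^1) … (chords and bottom asterisks)`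
of an orienting monomial. All chords and bottom asterisks share the last position. -/
def rank {n : ℕ} : Letter (Fin n) → ℕ ×ₗ ℕ
  | pt p => toLex (p.val, 0)
  | top p j => toLex (p.val, 2 * j + 1)
  | place p j => toLex (p.val, 2 * j + 2)
  | chord _ _ => toLex (n, 0)
  | bot _ => toLex (n, 0)

/-- `0` for the left-most active point, `1` for all other letters. -/
def rootRank {n : ℕ} : Letter (Fin n) → ℕ
  | pt p => if p.val = 0 then 0 else 1
  | _ => 1

end Letter

/-- Monomials in the letters over `n` active points `t_0 < … < t_{n-1}`. -/
abbrev Word (n : ℕ) : Type := List (Letter (Fin n))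

/-- The graph whose edges are the chords occurring in a word. -/
def chordGraph {n : ℕ} (w : Word n) : SimpleGraph (Fin n) :=
  SimpleGraph.fromRel fun p q => Letter.chord p q ∈ w

/-- `w` is an orienting monomial of a generalized `T_*^*`-diagram with `n` active points and `k p`
top asterisks over the `p`-th of them. -/
structure IsOrienting {n : ℕ} (k : Fin n → ℕ) (w : Word n) : Prop where
  nodup : w.Nodup
  pt_mem : ∀ p, Letter.pt p ∈ w
  place_mem : ∀ p j, Letter.place p j ∈ w ↔ j < k p
  top_mem : ∀ p j, Letter.top p j ∈ w ↔ j < k p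
  chord_ne : ∀ p q, Letter.chord p q ∈ w → p ≠ q
  chord_single : ∀ p q, Letter.chord p q ∈ w → Letter.chord q p ∉ w
  forest : (chordGraph w).IsAcyclic

/-- A generalized `T_*^*`-diagram with `n` active points, together with an orienting monomial. -/
structure Diagram (n : ℕ) : Type where
  stars : Fin n → ℕ
  word : Word n
  isOrienting : IsOrienting stars word

/-- The condition that distinguishes `T_*^*`-diagrams among the generalized ones: each active point
is adjacent to a chord, or its half-line contains an asterisk. -/
def Diagram.IsProper {n : ℕ} (D : Diagram n) : Prop :=
  ∀ p, 0 < D.stars p ∨ Letter.bot p ∈ D.word ∨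
    ∃ q, Letter.chord p q ∈ D.word ∨ Letter.chord q p ∈ D.word

/-- The free module on the generalized `T_*^*`-diagrams with orienting monomials. -/
abbrev FreeSpace (R : Type*) [CommRing R] : Type _ := (Σ n, Diagram n) →₀ R

open Classical in
/-- The diagram with orienting monomial `w`; zero if `w` is not an orienting monomial of a diagram
(for instance if two bottom asterisks have been put on one active point). -/
def ofWord (R : Type*) [CommRing R] {n : ℕ} (k : Fin n → ℕ) (w : Word n) : FreeSpace R :=
  if h : IsOrienting k w then Finsupp.single ⟨n, ⟨k, w, h⟩⟩ 1 else 0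

/-- The relations between oriented diagrams: graded commutativity of the orienting monomial, change
of the orientation of a chord, and the Arnol'd relation. -/
inductive Relation (R : Type*) [CommRing R] (d : ℕ) : FreeSpace R → Prop
  | swap {n : ℕ} (k : Fin n → ℕ) (u v : Word n) (x y : Letter (Fin n)) :
      Relation R d (ofWord R k (u ++ x :: y :: v) -
        (x.deg d * y.deg d).negOnePow • ofWord R k (u ++ y :: x :: v))
  | reverse {n : ℕ} (k : Fin n → ℕ) (u v : Word n) (p q : Fin n) :
      Relation R d (ofWord R k (u ++ Letter.chord p q :: v) -
        (-1 : R) ^ d • ofWord R k (u ++ Letter.chord q p :: v))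
  | arnold {n : ℕ} (k : Fin n → ℕ) (u v : Word n) (a b c : Fin n)
      (hab : a ≠ b) (hbc : b ≠ c) (hca : c ≠ a) :
      Relation R d (ofWord R k (u ++ Letter.chord a b :: Letter.chord b c :: v) +
        ofWord R k (u ++ Letter.chord b c :: Letter.chord c a :: v) +
        ofWord R k (u ++ Letter.chord c a :: Letter.chord a b :: v))

/-- The submodule spanned by the relations. -/
def relations (R : Type*) [CommRing R] (d : ℕ) : Submodule R (FreeSpace R) :=
  Submodule.span R {x | Relation R d x}

/-- The space of generalized `T_*^*`-diagrams. -/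
abbrev GenSpace (R : Type*) [CommRing R] (d : ℕ) : Type _ := FreeSpace R ⧸ relations R d

/-- The class of a linear combination of oriented diagrams. -/
abbrev cls (R : Type*) [CommRing R] (d : ℕ) : FreeSpace R →ₗ[R] GenSpace R d :=
  (relations R d).mkQ

/-- The class of an oriented diagram. -/
def Diagram.cls (R : Type*) [CommRing R] (d : ℕ) {n : ℕ} (D : Diagram n) : GenSpace R d :=
  TDiagram.cls R d (Finsupp.single ⟨n, D⟩ 1)

/-- The space of `T_*^*`-diagrams. All relations preserve the number of active points and the set of
those that carry neither an asterisk nor an end of a chord; so this span is a direct summand of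
`GenSpace R d`, and no relation is added by passing to generalized diagrams. -/
def Space (R : Type*) [CommRing R] (d : ℕ) : Submodule R (GenSpace R d) :=
  Submodule.span R {x | ∃ (n : ℕ) (D : Diagram n), D.IsProper ∧ x = D.cls R d}

/-! ### Signs -/

/-- The sign produced, according to graded commutativity, by sorting a list of elements of given
ranks and degrees into increasing order of ranks (elements of equal rank keep their order). -/
def sortSign {α : Type*} [LinearOrder α] : List (α × ℤ) → ℤˣ
  | [] => 1
  | x :: l => ((l.filter fun y => y.1 < x.1).map fun y => (x.2 * y.2).negOnePow).prod * sortSign l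

/-- The sign of the reordering of a word into normal form. -/
def normalSign (d : ℕ) {n : ℕ} (w : Word n) : ℤˣ :=
  sortSign (w.map fun x => (x.rank, x.deg d))

/-- The sign of moving the left-most active point of a word to the first place. -/
def rootSign (d : ℕ) {n : ℕ} (w : Word n) : ℤˣ :=
  sortSign (w.map fun x => (x.rootRank, x.deg d))

/-! ### The operation `⊨` -/

/-- Pairs of strictly increasing maps onto `Fin N` that agree on the left-most points only: the
ways of gluing the left-most points of two diagrams and of shuffling the other ones. -/
def gluings (m n : ℕ) : Set ((Fin (m + 1) → Fin (m + n + 1)) × (Fin (n + 1) → Fin (m + n + 1))) :=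
  {s | StrictMono s.1 ∧ StrictMono s.2 ∧ s.1 0 = s.2 0 ∧ Set.range s.1 ∪ Set.range s.2 = Set.univ}

/-- Shuffles of `k` and `l` asterisks. -/
def shuffles (k l : ℕ) : Set ((Fin k → Fin (k + l)) × (Fin l → Fin (k + l))) :=
  {s | StrictMono s.1 ∧ StrictMono s.2 ∧ Set.range s.1 ∪ Set.range s.2 = Set.univ}

/-- The renaming of the asterisks over the left-most point given by `r`, the other asterisks being
left unchanged. -/
def rootStars {m k l : ℕ} (r : Fin k → Fin l) (p : Fin (m + 1)) (j : ℕ) : ℕ :=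
  if h : p = 0 ∧ j < k then (r ⟨j, h.2⟩).val else j

open Classical in
/-- `A ⊨ B`: the sum of all the diagrams obtained by gluing the left-most active point of `A` with
the left-most active point of `B`; the other active points, and the top asterisks over the two
left-most points, are shuffled. If `A` and `B` are oriented by `t A'` and `t B'`, where `t` stands
for the left-most point, then the result is oriented by `t A' B'`. -/
def glue (R : Type*) [CommRing R] (d : ℕ) {m n : ℕ} (A : Diagram (m + 1)) (B : Diagram (n + 1)) :
    FreeSpace R :=
  ∑ s ∈ (gluings m n).toFinset, ∑ r ∈ (shuffles (A.stars 0) (B.stars 0)).toFinset,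
    (rootSign d A.word * rootSign d B.word) •
      ofWord R
        (fun x => (∑ p, if s.1 p = x then A.stars p else 0) +
          ∑ q, if s.2 q = x then B.stars q else 0)
        (Letter.pt 0 ::
          (((A.word.filter fun x => x.rootRank ≠ 0).map (Letter.relabel s.1 (rootStars r.1))) ++
            ((B.word.filter fun x => x.rootRank ≠ 0).map (Letter.relabel s.2 (rootStars r.2)))))

/-! ### The operation `⟨A_1, …, A_ℓ | D⟩` -/

/-- The shuffles of the active points of several diagrams with `N i` active points which keep the
left-most points of these diagrams in the given order. -/
def rootedShuffles {l : ℕ} (N : Fin l → ℕ) : Set ((Σ i, Fin (N i)) ≃ Fin (∑ i, N i)) :=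
  {s | (∀ i, StrictMono fun p => s ⟨i, p⟩) ∧
    ∀ i j, i < j → ∀ (p : Fin (N i)) (q : Fin (N j)), p.val = 0 → q.val = 0 → s ⟨i, p⟩ < s ⟨j, q⟩}

open Classical in
/-- The sum over all shuffles of the active points of the diagrams `A i` that keep the left-most
points in order (a term of the divided product `⟨A_1, …, A_ℓ⟩`), where the active points
`t_1 < … < t_ℓ` of a diagram oriented by `t_1 … t_ℓ w` are glued to the left-most points. The result
is oriented by the concatenation of the words of the `A i` followed by `w`. It is not used for
diagrams `A i` without active points, and set to zero then. -/
def bracketWord (R : Type*) [CommRing R] {l : ℕ} (A : Fin l → Σ n, Diagram n) (w : Word l) :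
    FreeSpace R :=
  if h : ∀ i, 0 < (A i).1 then
    ∑ s ∈ (rootedShuffles fun i => (A i).1).toFinset,
      ofWord R (fun x => (A (s.symm x).1).2.stars (s.symm x).2)
        ((List.ofFn fun i => (A i).2.word.map (Letter.map fun p => s ⟨i, p⟩)).flatten ++
          w.map (Letter.map fun i => s ⟨i, ⟨0, h i⟩⟩))
  else 0

/-- `⟨A_1, …, A_ℓ | D⟩` for diagrams `A i` and a generalized `T_*`-diagram `D` (one without top
asterisks) with `ℓ` active points. Before gluing, the monomial of `D` is reordered so that it begins
with `t_1 … t_ℓ`, and this part is removed. -/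
def bracketDiagram (R : Type*) [CommRing R] (d : ℕ) {l : ℕ} (A : Fin l → Σ n, Diagram n)
    (D : Diagram l) : FreeSpace R :=
  normalSign d D.word • bracketWord R A (D.word.filter Letter.isBottom)

/-- `⟨A_1, …, A_ℓ | D⟩`, extended multilinearly in the `A i`. -/
def bracket (R : Type*) [CommRing R] (d : ℕ) {l : ℕ} (A : Fin l → FreeSpace R) (D : Diagram l) :
    FreeSpace R :=
  ∑ f ∈ Fintype.piFinset fun i => (A i).support, (∏ i, A i (f i)) • bracketDiagram R d f D

/-! ### The diagrams `Z_k` and `Ẑ_k` -/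

/-- The monomial `t_1 (α^*_1^1 a_1^1) … (α^*_1^k a_1^k)`. -/
def zWord (k : ℕ) : Word 1 :=
  Letter.pt 0 :: (List.range k).flatMap fun j => [Letter.top 0 j, Letter.place 0 j]

/-- The monomial `t_0 (α_{01} t_1) … (α_{0k} t_k)`. -/
def zHatWord (k : ℕ) : Word (k + 1) :=
  Letter.pt 0 :: (List.finRange k).flatMap fun j => [Letter.chord 0 j.succ, Letter.pt j.succ]

theorem isOrienting_zWord (k : ℕ) : IsOrienting (fun _ => k) (zWord k) where
  nodup := by
    rw [zWord, List.nodup_cons]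
    refine ⟨by simp, ?_⟩
    rw [List.nodup_flatMap]
    refine ⟨by simp, ?_⟩
    refine List.Pairwise.imp ?_ List.nodup_range
    intro a b hab
    simp [Function.onFun, hab.symm]
  pt_mem p := by simp [zWord, Subsingleton.elim p 0]
  place_mem p j := by simp [zWord, Subsingleton.elim p 0]
  top_mem p j := by simp [zWord, Subsingleton.elim p 0]
  chord_ne p q h := by simp [zWord] at h
  chord_single p q h := by simp [zWord] at h
  forest := SimpleGraph.IsAcyclic.of_subsingleton

theorem isOrienting_zHatWord (k : ℕ) : IsOrienting (fun _ => 0) (zHatWord k) where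
  nodup := by
    rw [zHatWord, List.nodup_cons]
    refine ⟨by simp [Fin.ext_iff], ?_⟩
    rw [List.nodup_flatMap]
    refine ⟨by simp, ?_⟩
    refine List.Pairwise.imp ?_ (List.nodup_finRange k)
    intro a b hab
    simp [Function.onFun, hab.symm]
  pt_mem p := by
    rcases Fin.eq_zero_or_eq_succ p with rfl | ⟨j, rfl⟩ <;> simp [zHatWord]
  place_mem p j := by simp [zHatWord]
  top_mem p j := by simp [zHatWord]
  chord_ne p q h := by
    simp only [zHatWord, List.mem_cons, List.mem_flatMap] at h
    obtain h | ⟨j, -, h⟩ := h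
    · simp at h
    · simp at h
      rw [h.1, h.2]
      exact (Fin.succ_ne_zero j).symm
  chord_single p q h h' := by
    simp only [zHatWord, List.mem_cons, List.mem_flatMap] at h h'
    obtain h | ⟨j, -, h⟩ := h
    · simp at h
    obtain h' | ⟨i, -, h'⟩ := h'
    · simp at h'
    simp at h h'
    exact Fin.succ_ne_zero j (h.2.symm.trans h'.1)
  forest := by
    refine SimpleGraph.IsAcyclic.anti ?_ (SimpleGraph.isAcyclic_starGraph (0 : Fin (k + 1)))
    intro p q h
    simp only [chordGraph, SimpleGraph.fromRel_adj, zHatWord] at h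
    rw [SimpleGraph.starGraph_adj]
    refine ⟨h.1, ?_⟩
    rcases h.2 with h | h <;> simp at h
    · exact Or.inl h.1
    · exact Or.inr h.1

/-- `Z_k`: one active point with `k` top asterisks. -/
def Z (k : ℕ) : Diagram 1 := ⟨_, _, isOrienting_zWord k⟩

/-- `Ẑ_k`: active points `t_0 < … < t_k`, with chords from `t_0` to each of the others. -/
def Zhat (k : ℕ) : Diagram (k + 1) := ⟨_, _, isOrienting_zHatWord k⟩

/-- `Z_k` as an element of the free space. -/
def zElt (R : Type*) [CommRing R] (k : ℕ) : FreeSpace R := Finsupp.single ⟨1, Z k⟩ 1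

/-- `I(Z_k) = ∑_{i=0}^k Z_{k-i} ⊨ Ẑ_i`. -/
def mapIZ (R : Type*) [CommRing R] (d k : ℕ) : FreeSpace R :=
  ∑ i ∈ Finset.range (k + 1), glue R d (Z (k - i)) (Zhat i)

/-! ### The map `I` -/

theorem chordGraph_mono {n : ℕ} {w w' : Word n} (h : ∀ p q, Letter.chord p q ∈ w → Letter.chord p q ∈ w') :
    chordGraph w ≤ chordGraph w' := by
  intro p q
  simp only [chordGraph, SimpleGraph.fromRel_adj]
  rintro ⟨h1, h2⟩
  exact ⟨h1, h2.imp (h _ _) (h _ _)⟩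

/-- The monomial `t_1 … t_ℓ` followed by the chords and the bottom asterisks of `w`. -/
def bottomWord {n : ℕ} (w : Word n) : Word n :=
  List.ofFn Letter.pt ++ w.filter Letter.isBottom

theorem isOrienting_bottomWord {n : ℕ} {k : Fin n → ℕ} {w : Word n} (h : IsOrienting k w) :
    IsOrienting (fun _ => 0) (bottomWord w) where
  nodup := by
    rw [bottomWord, List.nodup_append]
    refine ⟨?_, h.nodup.filter _, ?_⟩
    · rw [List.nodup_ofFn]
      intro p q hpq
      simpa using hpq
    · intro a ha b hb hab
      subst hab
      obtain ⟨p, rfl⟩ := (List.mem_ofFn' _ _).1 ha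
      simp [Letter.isBottom] at hb
  pt_mem p := by simp [bottomWord]
  place_mem p j := by simp [bottomWord, Letter.isBottom]
  top_mem p j := by simp [bottomWord, Letter.isBottom]
  chord_ne p q hm := h.chord_ne p q (by simpa [bottomWord, Letter.isBottom] using hm)
  chord_single p q hm hm' := h.chord_single p q (by simpa [bottomWord, Letter.isBottom] using hm)
    (by simpa [bottomWord, Letter.isBottom] using hm')
  forest := h.forest.anti (chordGraph_mono fun p q hm => by
    simpa [bottomWord, Letter.isBottom] using hm)

/-- `D_bottom`: the generalized `T_*`-diagram obtained from `D` by removing all top asterisks. It is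
oriented by `t_1 … t_ℓ` followed by the chords and the bottom asterisks in their order in the
monomial of `D`, so that `D = normalSign · ⟨Z_{k_1}, …, Z_{k_ℓ} | D_bottom⟩`. -/
def Diagram.bottom {n : ℕ} (D : Diagram n) : Diagram n :=
  ⟨_, _, isOrienting_bottomWord D.isOrienting⟩

/-- `I(D) = ⟨I Z_{k_1}, …, I Z_{k_ℓ} | D_bottom⟩` on oriented diagrams. -/
def mapIDiagram (R : Type*) [CommRing R] (d : ℕ) {n : ℕ} (D : Diagram n) : FreeSpace R :=
  normalSign d D.word • bracket R d (fun i => mapIZ R d (D.stars i)) D.bottom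

/-- `I` on the free space. -/
def mapIFree (R : Type*) [CommRing R] (d : ℕ) : FreeSpace R →ₗ[R] FreeSpace R :=
  Finsupp.lsum R fun D => (LinearMap.id : R →ₗ[R] R).smulRight (mapIDiagram R d D.2)

theorem IsOrienting.perm {n : ℕ} {k : Fin n → ℕ} {w w' : Word n} (h : IsOrienting k w)
    (hp : w.Perm w') : IsOrienting k w' where
  nodup := hp.nodup_iff.1 h.nodup
  pt_mem p := hp.mem_iff.1 (h.pt_mem p)
  place_mem p j := hp.mem_iff.symm.trans (h.place_mem p j)
  top_mem p j := hp.mem_iff.symm.trans (h.top_mem p j)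
  chord_ne p q hm := h.chord_ne p q (hp.mem_iff.2 hm)
  chord_single p q hm hm' := h.chord_single p q (hp.mem_iff.2 hm) (hp.mem_iff.2 hm')
  forest := h.forest.anti (chordGraph_mono fun _ _ hm => hp.mem_iff.2 hm)

theorem IsOrienting.reverse {n : ℕ} {k : Fin n → ℕ} {u : Word n} {p q : Fin n}
    (h : IsOrienting k (Letter.chord p q :: u)) : IsOrienting k (Letter.chord q p :: u) := by
  have h1 := h.chord_ne p q (by simp)
  have h2 := h.chord_single p q (by simp)
  have h0 := List.nodup_cons.1 h.nodup
  refine ⟨?_, ?_, ?_, ?_, ?_, ?_, ?_⟩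
  · rw [List.nodup_cons]
    exact ⟨fun hm => h2 (by simp [hm]), h0.2⟩
  · intro p; simpa using h.pt_mem p
  · intro p j; simpa using h.place_mem p j
  · intro p j; simpa using h.top_mem p j
  · intro a b hm
    rcases List.mem_cons.1 hm with hm | hm
    · simp only [Letter.chord.injEq] at hm
      rw [hm.1, hm.2]; exact h1.symm
    · exact h.chord_ne a b (by simp [hm])
  · intro a b hm hm'
    rcases List.mem_cons.1 hm with hm | hm <;> rcases List.mem_cons.1 hm' with hm' | hm'
    · simp only [Letter.chord.injEq] at hm hm'
      exact h1 (hm.2.symm.trans hm'.1)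
    · simp only [Letter.chord.injEq] at hm
      rw [hm.1, hm.2] at hm'
      exact h0.1 hm'
    · simp only [Letter.chord.injEq] at hm'
      rw [hm'.1, hm'.2] at hm
      exact h0.1 hm
    · exact h.chord_single a b (by simp [hm]) (by simp [hm'])
  · refine h.forest.anti ?_
    intro a b hab
    simp only [chordGraph, SimpleGraph.fromRel_adj, List.mem_cons, Letter.chord.injEq] at hab ⊢
    tauto

theorem chordGraph_cons {n : ℕ} (u : Word n) {p q : Fin n} :
    chordGraph (Letter.chord p q :: u) = chordGraph u ⊔ SimpleGraph.edge p q := by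
  ext a b
  simp only [chordGraph, SimpleGraph.fromRel_adj, List.mem_cons, Letter.chord.injEq,
    SimpleGraph.sup_adj, SimpleGraph.edge_adj]
  tauto

theorem IsOrienting.arnold {n : ℕ} {k : Fin n → ℕ} {u : Word n} {a b c : Fin n}
    (hab : a ≠ b) (hbc : b ≠ c) (hca : c ≠ a)
    (h : IsOrienting k (Letter.chord a b :: Letter.chord b c :: u)) :
    IsOrienting k (Letter.chord b c :: Letter.chord c a :: u) := by
  have hnd := h.nodup
  simp only [List.nodup_cons, List.mem_cons, Letter.chord.injEq, not_or] at hnd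
  obtain ⟨⟨-, hab_u⟩, hbc_u, hu⟩ := hnd
  have hba_u : Letter.chord b a ∉ u := fun hm => h.chord_single a b (by simp) (by simp [hm])
  set H := chordGraph (Letter.chord b c :: u) with hH
  have hf : (H ⊔ SimpleGraph.edge a b).IsAcyclic := by
    rw [hH, ← chordGraph_cons]; exact h.forest
  rw [SimpleGraph.isAcyclic_sup_fromEdgeSet_iff] at hf
  have hnr : ¬ H.Reachable a b := by
    intro hr
    rcases hf.2 hr with h1 | h1
    · exact hab h1
    · simp only [hH, chordGraph, SimpleGraph.fromRel_adj, List.mem_cons, Letter.chord.injEq] at h1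
      grind
  have hbcH : H.Adj b c := by simp [hH, chordGraph, hbc]
  have hnr' : ¬ H.Reachable c a := fun hr => hnr (hbcH.reachable.trans hr).symm
  have hca_u : Letter.chord c a ∉ u := fun hm =>
    hnr' (SimpleGraph.Adj.reachable (by simp [hH, chordGraph, hca, hm]))
  have hac_u : Letter.chord a c ∉ u := fun hm =>
    hnr' (SimpleGraph.Adj.reachable (by simp [hH, chordGraph, hca, hm]))
  refine ⟨?_, ?_, ?_, ?_, ?_, ?_, ?_⟩
  · simp only [List.nodup_cons, List.mem_cons, Letter.chord.injEq, not_or]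
    exact ⟨⟨fun hh => hbc hh.1, hbc_u⟩, hca_u, hu⟩
  · intro p; simpa using h.pt_mem p
  · intro p j; simpa using h.place_mem p j
  · intro p j; simpa using h.top_mem p j
  · intro p q hm
    have := h.chord_ne p q
    simp only [List.mem_cons, Letter.chord.injEq] at hm this
    grind
  · intro p q hm hm'
    have h1 := h.chord_single p q
    have h2 := h.chord_single b c (by simp)
    simp only [List.mem_cons, Letter.chord.injEq, not_or] at hm hm' h1 h2
    grind
  · have hp : (Letter.chord b c :: Letter.chord c a :: u).Perm
        (Letter.chord c a :: Letter.chord b c :: u) := List.Perm.swap _ _ _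
    refine SimpleGraph.IsAcyclic.anti (chordGraph_mono fun _ _ hm => hp.mem_iff.1 hm) ?_
    rw [chordGraph_cons]
    exact hf.1.sup_edge_of_not_reachable hnr'

theorem sortSign_swap {α : Type*} [LinearOrder α] (u v : List (α × ℤ)) (x y : α × ℤ)
    (h : x.1 ≠ y.1) :
    sortSign (u ++ x :: y :: v) = (x.2 * y.2).negOnePow * sortSign (u ++ y :: x :: v) := by
  induction u with
  | nil =>
    simp only [List.nil_append, sortSign, List.filter_cons]
    rcases lt_or_gt_of_ne h with h | h
    · simp only [h, not_lt_of_gt h, decide_true, decide_false, if_true, Bool.false_eq_true, if_false,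
        List.map_cons, List.prod_cons, mul_comm y.2 x.2]
      rw [← mul_assoc, ← mul_assoc, ← mul_assoc, ← mul_assoc, ← Int.negOnePow_add, ← two_mul,
        Int.negOnePow_two_mul, one_mul,
        mul_comm (List.prod _) (List.prod _)]
    · simp only [h, not_lt_of_gt h, decide_true, decide_false, if_true, Bool.false_eq_true, if_false,
        List.map_cons, List.prod_cons]
      ac_rfl
  | cons z u ih =>
    simp only [List.cons_append, sortSign]
    rw [ih]
    have hp : ((u ++ x :: y :: v).filter fun t => t.1 < z.1).Perm
        ((u ++ y :: x :: v).filter fun t => t.1 < z.1) :=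
      ((List.Perm.swap _ _ _).append_left u).filter _
    rw [(hp.map _).prod_eq]
    ac_rfl

theorem sortSign_swap_of_eq {α : Type*} [LinearOrder α] (u v : List (α × ℤ)) (x y : α × ℤ)
    (h : x.1 = y.1) :
    sortSign (u ++ x :: y :: v) = sortSign (u ++ y :: x :: v) := by
  induction u with
  | nil =>
    simp only [List.nil_append, sortSign, List.filter_cons, h, lt_irrefl, decide_false,
      Bool.false_eq_true, if_false]
    ac_rfl
  | cons z u ih =>
    simp only [List.cons_append, sortSign]
    rw [ih]
    have hp : ((u ++ x :: y :: v).filter fun t => t.1 < z.1).Perm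
        ((u ++ y :: x :: v).filter fun t => t.1 < z.1) :=
      ((List.Perm.swap _ _ _).append_left u).filter _
    rw [(hp.map _).prod_eq]

theorem sortSign_eq_one {α : Type*} [LinearOrder α] (l : List (α × ℤ))
    (h : l.Pairwise fun x y => x.1 ≤ y.1) : sortSign l = 1 := by
  induction l with
  | nil => rfl
  | cons x l ih =>
    rw [List.pairwise_cons] at h
    rw [sortSign, ih h.2, List.filter_eq_nil_iff.2]
    · simp
    · intro y hy
      simpa using h.1 y hy

theorem rank_eq_rank {n : ℕ} {x y : Letter (Fin n)} (h : x.rank = y.rank) :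
    x = y ∨ (x.isBottom = true ∧ y.isBottom = true) := by
  have hlt : ∀ p : Fin n, p.val ≠ n := fun p => p.2.ne
  cases x <;> cases y <;> simp only [Letter.rank, toLex_inj, Prod.mk.injEq, Letter.isBottom,
    Letter.pt.injEq, Letter.top.injEq, Letter.place.injEq, Fin.ext_iff] at h ⊢ <;>
    grind

theorem rank_isBottom {n : ℕ} {x : Letter (Fin n)} (h : x.isBottom = true) :
    x.rank = toLex (n, 0) := by
  cases x <;> simp_all [Letter.isBottom, Letter.rank]

theorem normalSign_bottomWord (d : ℕ) {n : ℕ} (w : Word n) : normalSign d (bottomWord w) = 1 := by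
  apply sortSign_eq_one
  rw [List.pairwise_map, bottomWord, List.pairwise_append]
  refine ⟨?_, ?_, ?_⟩
  · rw [List.pairwise_ofFn]
    intro i j hij
    exact Prod.Lex.toLex_le_toLex.2 (Or.inl hij)
  · refine List.pairwise_of_forall_mem_list ?_
    intro x hx y hy
    rw [rank_isBottom (List.mem_filter.1 hx).2, rank_isBottom (List.mem_filter.1 hy).2]
  · intro x hx y hy
    obtain ⟨p, rfl⟩ := (List.mem_ofFn' _ _).1 hx
    rw [rank_isBottom (List.mem_filter.1 hy).2]
    exact Prod.Lex.toLex_le_toLex.2 (Or.inl p.2)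

theorem filter_bottomWord {n : ℕ} (w : Word n) :
    (bottomWord w).filter Letter.isBottom = w.filter Letter.isBottom := by
  rw [bottomWord, List.filter_append, List.filter_filter]
  have : (List.ofFn Letter.pt : Word n).filter Letter.isBottom = [] := by
    rw [List.filter_eq_nil_iff]
    intro x hx
    obtain ⟨p, rfl⟩ := (List.mem_ofFn' _ _).1 hx
    simp [Letter.isBottom]
  simp [this]

theorem deg_map (d : ℕ) {P Q : Type} (f : P → Q) (x : Letter P) : (x.map f).deg d = x.deg d := by
  cases x <;> rfl

theorem cls_eq_zero {R : Type*} [CommRing R] {d : ℕ} {x : FreeSpace R} (h : Relation R d x) :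
    cls R d x = 0 :=
  (Submodule.Quotient.mk_eq_zero _).2 (Submodule.subset_span h)

theorem cls_units_smul {R : Type*} [CommRing R] {d : ℕ} (e : ℤˣ) (x : FreeSpace R) :
    cls R d (e • x) = e • cls R d x := by
  rcases Int.units_eq_one_or e with rfl | rfl <;> simp

theorem cls_swap {R : Type*} [CommRing R] {d : ℕ} {n : ℕ} (k : Fin n → ℕ) (u v : Word n)
    (x y : Letter (Fin n)) :
    cls R d (ofWord R k (u ++ x :: y :: v)) =
      (x.deg d * y.deg d).negOnePow • cls R d (ofWord R k (u ++ y :: x :: v)) := by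
  rw [← cls_units_smul, ← sub_eq_zero, ← map_sub]
  exact cls_eq_zero (Relation.swap k u v x y)

theorem cls_reverse {R : Type*} [CommRing R] {d : ℕ} {n : ℕ} (k : Fin n → ℕ) (u v : Word n)
    (p q : Fin n) :
    cls R d (ofWord R k (u ++ Letter.chord p q :: v)) =
      (-1 : R) ^ d • cls R d (ofWord R k (u ++ Letter.chord q p :: v)) := by
  rw [← map_smul, ← sub_eq_zero, ← map_sub]
  exact cls_eq_zero (Relation.reverse k u v p q)

theorem cls_arnold {R : Type*} [CommRing R] {d : ℕ} {n : ℕ} (k : Fin n → ℕ) (u v : Word n)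
    {a b c : Fin n} (hab : a ≠ b) (hbc : b ≠ c) (hca : c ≠ a) :
    cls R d (ofWord R k (u ++ Letter.chord a b :: Letter.chord b c :: v)) +
      cls R d (ofWord R k (u ++ Letter.chord b c :: Letter.chord c a :: v)) +
      cls R d (ofWord R k (u ++ Letter.chord c a :: Letter.chord a b :: v)) = 0 := by
  rw [← map_add, ← map_add]
  exact cls_eq_zero (Relation.arnold k u v a b c hab hbc hca)

theorem cls_bracketWord_swap {R : Type*} [CommRing R] {d : ℕ} {l : ℕ} (A : Fin l → Σ n, Diagram n)
    (u v : Word l) (x y : Letter (Fin l)) :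
    cls R d (bracketWord R A (u ++ x :: y :: v)) =
      (x.deg d * y.deg d).negOnePow • cls R d (bracketWord R A (u ++ y :: x :: v)) := by
  unfold bracketWord
  split_ifs with h
  · rw [map_sum, map_sum, Finset.smul_sum]
    refine Finset.sum_congr rfl fun s _ => ?_
    simp only [List.map_append, List.map_cons, ← List.append_assoc]
    rw [cls_swap, deg_map, deg_map]
  · simp

theorem cls_bracketWord_reverse {R : Type*} [CommRing R] {d : ℕ} {l : ℕ}
    (A : Fin l → Σ n, Diagram n) (u v : Word l) (p q : Fin l) :
    cls R d (bracketWord R A (u ++ Letter.chord p q :: v)) =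
      (-1 : R) ^ d • cls R d (bracketWord R A (u ++ Letter.chord q p :: v)) := by
  unfold bracketWord
  split_ifs with h
  · rw [map_sum, map_sum, Finset.smul_sum]
    refine Finset.sum_congr rfl fun s _ => ?_
    simp only [List.map_append, List.map_cons, ← List.append_assoc, Letter.map, Letter.relabel]
    exact cls_reverse _ _ _ _ _
  · simp

theorem cls_bracketWord_arnold {R : Type*} [CommRing R] {d : ℕ} {l : ℕ}
    (A : Fin l → Σ n, Diagram n) (u v : Word l) {a b c : Fin l}
    (hab : a ≠ b) (hbc : b ≠ c) (hca : c ≠ a) :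
    cls R d (bracketWord R A (u ++ Letter.chord a b :: Letter.chord b c :: v)) +
      cls R d (bracketWord R A (u ++ Letter.chord b c :: Letter.chord c a :: v)) +
      cls R d (bracketWord R A (u ++ Letter.chord c a :: Letter.chord a b :: v)) = 0 := by
  unfold bracketWord
  split_ifs with h
  · rw [map_sum, map_sum, map_sum, ← Finset.sum_add_distrib, ← Finset.sum_add_distrib]
    refine Finset.sum_eq_zero fun s _ => ?_
    simp only [List.map_append, List.map_cons, ← List.append_assoc, Letter.map, Letter.relabel]
    have key : ∀ {i j : Fin l}, i ≠ j → s ⟨i, ⟨0, h i⟩⟩ ≠ s ⟨j, ⟨0, h j⟩⟩ := by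
      intro i j hij he
      exact hij (congrArg Sigma.fst (s.injective he))
    exact cls_arnold _ _ _ (key hab) (key hbc) (key hca)
  · simp

/-- The class of `I` of the diagram with word `w`, disregarding whether `w` is orienting. -/
def mapIWord (R : Type*) [CommRing R] (d : ℕ) {n : ℕ} (k : Fin n → ℕ) (w : Word n) :
    GenSpace R d :=
  normalSign d w •
    ∑ f ∈ Fintype.piFinset fun i => (mapIZ R d (k i)).support, (∏ i, mapIZ R d (k i) (f i)) •
      cls R d (bracketWord R f (w.filter Letter.isBottom))

open Classical in
theorem cls_mapIFree_ofWord {R : Type*} [CommRing R] {d : ℕ} {n : ℕ} (k : Fin n → ℕ) (w : Word n) :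
    cls R d (mapIFree R d (ofWord R k w)) =
      if IsOrienting k w then mapIWord R d k w else 0 := by
  unfold ofWord
  split_ifs with h
  · simp only [mapIFree, Finsupp.lsum_single, LinearMap.smulRight_apply, LinearMap.id_apply, one_smul,
      mapIDiagram, mapIWord, cls_units_smul, bracket, map_sum, map_smul, bracketDiagram,
      Diagram.bottom, normalSign_bottomWord, filter_bottomWord]
  · simp

theorem mapIWord_swap {R : Type*} [CommRing R] {d : ℕ} {n : ℕ} (k : Fin n → ℕ) (u v : Word n)
    (x y : Letter (Fin n)) (hxy : x ≠ y) :
    mapIWord R d k (u ++ x :: y :: v) =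
      (x.deg d * y.deg d).negOnePow • mapIWord R d k (u ++ y :: x :: v) := by
  unfold mapIWord normalSign
  simp only [List.map_append, List.map_cons]
  by_cases hb : x.isBottom = true ∧ y.isBottom = true
  · rw [sortSign_swap_of_eq _ _ _ _ ((rank_isBottom hb.1).trans (rank_isBottom hb.2).symm),
      smul_comm]
    refine congrArg _ ?_
    rw [Finset.smul_sum]
    refine Finset.sum_congr rfl fun f _ => ?_
    simp only [List.filter_append, List.filter_cons, hb.1, hb.2, if_true]
    rw [cls_bracketWord_swap, smul_comm]
  · rw [sortSign_swap _ _ _ _ (fun h => (rank_eq_rank h).elim hxy hb), mul_smul]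
    have hf : (u ++ x :: y :: v).filter Letter.isBottom =
        (u ++ y :: x :: v).filter Letter.isBottom := by
      simp only [List.filter_append, List.filter_cons]
      by_cases h1 : x.isBottom = true <;> by_cases h2 : y.isBottom = true <;> simp_all
    rw [hf]

theorem mapIWord_reverse {R : Type*} [CommRing R] {d : ℕ} {n : ℕ} (k : Fin n → ℕ) (u v : Word n)
    (p q : Fin n) :
    mapIWord R d k (u ++ Letter.chord p q :: v) =
      (-1 : R) ^ d • mapIWord R d k (u ++ Letter.chord q p :: v) := by
  unfold mapIWord normalSign
  simp only [List.map_append, List.map_cons, Letter.rank, Letter.deg]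
  rw [smul_comm ((-1 : R) ^ d)]
  refine congrArg _ ?_
  rw [Finset.smul_sum]
  refine Finset.sum_congr rfl fun f _ => ?_
  simp only [List.filter_append, List.filter_cons, Letter.isBottom, if_true]
  rw [cls_bracketWord_reverse, smul_comm]

theorem mapIWord_arnold {R : Type*} [CommRing R] {d : ℕ} {n : ℕ} (k : Fin n → ℕ) (u v : Word n)
    {a b c : Fin n} (hab : a ≠ b) (hbc : b ≠ c) (hca : c ≠ a) :
    mapIWord R d k (u ++ Letter.chord a b :: Letter.chord b c :: v) +
      mapIWord R d k (u ++ Letter.chord b c :: Letter.chord c a :: v) +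
      mapIWord R d k (u ++ Letter.chord c a :: Letter.chord a b :: v) = 0 := by
  unfold mapIWord normalSign
  simp only [List.map_append, List.map_cons, Letter.rank, Letter.deg]
  rw [← smul_add, ← smul_add, ← Finset.sum_add_distrib, ← Finset.sum_add_distrib,
    Finset.sum_eq_zero, smul_zero]
  intro f _
  simp only [List.filter_append, List.filter_cons, Letter.isBottom, if_true]
  rw [← smul_add, ← smul_add, cls_bracketWord_arnold _ _ _ hab hbc hca, smul_zero]

theorem isOrienting_swap {n : ℕ} {k : Fin n → ℕ} {u v : Word n} {x y : Letter (Fin n)} :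
    IsOrienting k (u ++ x :: y :: v) ↔ IsOrienting k (u ++ y :: x :: v) :=
  ⟨fun h => h.perm ((List.Perm.swap _ _ _).append_left u),
    fun h => h.perm ((List.Perm.swap _ _ _).append_left u)⟩

theorem isOrienting_reverse {n : ℕ} {k : Fin n → ℕ} {u v : Word n} {p q : Fin n} :
    IsOrienting k (u ++ Letter.chord p q :: v) ↔ IsOrienting k (u ++ Letter.chord q p :: v) :=
  ⟨fun h => (h.perm List.perm_middle).reverse.perm List.perm_middle.symm,
    fun h => (h.perm List.perm_middle).reverse.perm List.perm_middle.symm⟩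

theorem isOrienting_arnold {n : ℕ} {k : Fin n → ℕ} {u v : Word n} {a b c : Fin n}
    (hab : a ≠ b) (hbc : b ≠ c) (hca : c ≠ a)
    (h : IsOrienting k (u ++ Letter.chord a b :: Letter.chord b c :: v)) :
    IsOrienting k (u ++ Letter.chord b c :: Letter.chord c a :: v) := by
  have hp : ∀ x y : Letter (Fin n), (u ++ x :: y :: v).Perm (x :: y :: (u ++ v)) := fun x y =>
    List.perm_middle.trans (List.perm_middle.cons x)
  exact ((h.perm (hp _ _)).arnold hab hbc hca).perm (hp _ _).symm

theorem relations_le_ker (R : Type*) [CommRing R] (d : ℕ) :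
    relations R d ≤ LinearMap.ker ((cls R d).comp (mapIFree R d)) := by
  classical
  refine Submodule.span_le.2 ?_
  rintro _ (⟨k, u, v, x, y⟩ | ⟨k, u, v, p, q⟩ | ⟨k, u, v, a, b, c, hab, hbc, hca⟩)
  · rw [SetLike.mem_coe, LinearMap.mem_ker, map_sub, sub_eq_zero]
    have hu : ∀ (e : ℤˣ) (z : FreeSpace R), ((cls R d).comp (mapIFree R d)) (e • z) =
        e • ((cls R d).comp (mapIFree R d)) z := by
      intro e z
      rcases Int.units_eq_one_or e with rfl | rfl <;> simp
    rw [hu, LinearMap.comp_apply, LinearMap.comp_apply, cls_mapIFree_ofWord, cls_mapIFree_ofWord,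
      isOrienting_swap (x := x)]
    split_ifs with h
    · refine mapIWord_swap k u v x y ?_
      rintro rfl
      have := (List.nodup_append.1 h.nodup).2.1
      simp at this
    · simp
  · rw [SetLike.mem_coe, LinearMap.mem_ker, map_sub, sub_eq_zero, map_smul, LinearMap.comp_apply,
      LinearMap.comp_apply, cls_mapIFree_ofWord, cls_mapIFree_ofWord, isOrienting_reverse (p := p)]
    split_ifs with h
    · exact mapIWord_reverse k u v p q
    · simp
  · rw [SetLike.mem_coe, LinearMap.mem_ker, map_add, map_add, LinearMap.comp_apply,
      LinearMap.comp_apply, LinearMap.comp_apply, cls_mapIFree_ofWord, cls_mapIFree_ofWord,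
      cls_mapIFree_ofWord]
    by_cases h : IsOrienting k (u ++ Letter.chord a b :: Letter.chord b c :: v)
    · have h2 := isOrienting_arnold hab hbc hca h
      have h3 := isOrienting_arnold hbc hca hab h2
      rw [if_pos h, if_pos h2, if_pos h3]
      exact mapIWord_arnold k u v hab hbc hca
    · have h2 : ¬ IsOrienting k (u ++ Letter.chord b c :: Letter.chord c a :: v) := fun h2 =>
        h (isOrienting_arnold hca hab hbc (isOrienting_arnold hbc hca hab h2))
      have h3 : ¬ IsOrienting k (u ++ Letter.chord c a :: Letter.chord a b :: v) := fun h3 =>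
        h (isOrienting_arnold hca hab hbc h3)
      rw [if_neg h, if_neg h2, if_neg h3]
      simp

/-- The map `I`, given on oriented diagrams by
`I(D) = I⟨Z_{k_1}, …, Z_{k_ℓ} | D_bottom⟩ = ⟨I Z_{k_1}, …, I Z_{k_ℓ} | D_bottom⟩`. -/
def mapI (R : Type*) [CommRing R] (d : ℕ) : GenSpace R d →ₗ[R] GenSpace R d :=
  (relations R d).liftQ ((cls R d).comp (mapIFree R d)) (relations_le_ker R d)

end TDiagram

end

noncomputable section

namespace TDiagram

/-! Call an expansion of a diagram the result of turning the lowest j p top asterisks over each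
active point p into chords from p to new points. The new points over p lie to the right of p in
increasing order, and are otherwise placed in all possible ways. Since Z_{k-i} ⊨ Ẑ_i is a single
diagram, namely the expansion of Z_k with j = i, multilinearity of the bracket shows that I is the
sum of all expansions (`mapI_eq_expansionMap`). The asserted inverse J is the same sum with the
coefficients `signWeight` (`expansionWord_eq_bracket`).

Expanding by j and then by i produces m = i + j new points over each p, in two batches: each batch
is in increasing order, and the two are shuffled. Hence I ∘ J is a sum over m and i ≤ m of shuffles
with coefficient ∏ `signWeight` (m p - i p). If m p₀ > 0, the terms with this m cancel in pairs
(`sum_shuffles_eq_zero`): the right-most new point over p₀ is the last of its batch, and it can be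
handed over to the other batch. This renumbers the new points by a cycle past s of them. A
transposition of two new points over p₀ exchanges two chords (degree d - 1) and two points (degree
-1), so it costs (-1)^d, and the cycle costs (-1)^(sd). The recursion `signWeight_succ` makes the
two terms opposite. Only m = 0 is left, so I ∘ J = id.

Moreover I - id lowers the number of top asterisks, so I is injective (`expansionMap_one_injective`)
and J is a two-sided inverse. Both maps preserve the span of T-diagrams, because a point that loses
its asterisks gains a chord.

Sums over placements are treated as sums over linear extensions of a relation on an abstract set of
points (`extensionSum`), so that a second expansion can be made before an order is chosen
(`expansionMap_extensionSum`). The comparison with brackets needs the sign of sorting a monomial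
(`apply_eq_sortSign_smul`). Independence of representatives holds because the bracket is multilinear
and vanishes when one argument is a relation (`finsuppMultilinear_congr`). -/

theorem Letter.map_map {P Q S : Type} (f : P → Q) (g : Q → S) (x : Letter P) :
    (x.map f).map g = x.map fun p => g (f p) := by
  cases x <;> rfl

theorem Letter.map_injective {P Q : Type} {f : P → Q} (hf : Function.Injective f) :
    Function.Injective (Letter.map f) := by
  intro x y h
  cases x <;> cases y <;> simp [Letter.map, Letter.relabel, hf.eq_iff] at h ⊢ <;> tauto

/-! ### Sums over linear extensions -/

open Classical in
/-- The linear orders on `P`, given as enumerations, that extend the relation `r`. -/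
def linearExtensions {P : Type} [Fintype P] (N : ℕ) (r : P → P → Prop) : Finset (P ≃ Fin N) :=
  Finset.univ.filter fun e => ∀ x y, r x y → e x < e y

theorem mem_linearExtensions {P : Type} [Fintype P] {N : ℕ} {r : P → P → Prop} {e : P ≃ Fin N} :
    e ∈ linearExtensions N r ↔ ∀ x y, r x y → e x < e y := by
  classical
  exact Finset.mem_filter.trans (and_iff_right (Finset.mem_univ _))

/-- The sum, over all linear orders on `P` extending `r`, of the classes of the diagrams with active
points `P`, top asterisks given by `k`, and orienting monomial `w`. -/
def extensionSum (R : Type*) [CommRing R] (d : ℕ) {P : Type} [Fintype P] (N : ℕ)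
    (r : P → P → Prop) (k : P → ℕ) (w : List (Letter P)) : GenSpace R d :=
  ∑ e ∈ linearExtensions N r,
    cls R d (ofWord R (fun x => k (e.symm x)) (w.map (Letter.map e)))

variable {R : Type*} [CommRing R] {d : ℕ}

/-- Names of points do not matter. Identifications of sums of diagrams below reduce to giving a
bijection of points that matches the order constraints, the asterisks and the monomials. -/
theorem extensionSum_congr {P Q : Type} [Fintype P] [Fintype Q] {N N' : ℕ} {r : P → P → Prop}
    {r' : Q → Q → Prop} {k : P → ℕ} {k' : Q → ℕ} {w : List (Letter P)} {w' : List (Letter Q)}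
    (φ : P ≃ Q) (hN : N = N') (hr : ∀ x y, r x y ↔ r' (φ x) (φ y)) (hk : ∀ x, k x = k' (φ x))
    (hw : w.map (Letter.map φ) = w') :
    extensionSum R d N r k w = extensionSum R d N' r' k' w' := by
  subst hN hw
  unfold extensionSum
  refine Finset.sum_equiv (φ.equivCongr (Equiv.refl _)) ?_ ?_
  · intro e
    rw [mem_linearExtensions, mem_linearExtensions]
    constructor
    · intro h x y hxy
      refine h _ _ ((hr _ _).2 ?_)
      simpa using hxy
    · intro h x y hxy
      simpa using h _ _ ((hr _ _).1 hxy)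
  · intro e _
    have h1 : (fun x => k (e.symm x)) =
        fun x => k' (((φ.equivCongr (Equiv.refl _)) e).symm x) := by
      funext x
      rw [hk]
      rfl
    rw [h1, List.map_map]
    congr 3
    funext x
    rw [Function.comp_apply, Letter.map_map]
    simp

/-- The three kinds of relations hold term by term. No condition on the word is needed, because
`ofWord` is zero on words that do not orient a diagram. -/
theorem extensionSum_swap {P : Type} [Fintype P] {N : ℕ} (r : P → P → Prop) (k : P → ℕ)
    (u v : List (Letter P)) (x y : Letter P) :
    extensionSum R d N r k (u ++ x :: y :: v) =
      (x.deg d * y.deg d).negOnePow • extensionSum R d N r k (u ++ y :: x :: v) := by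
  unfold extensionSum
  rw [Finset.smul_sum]
  refine Finset.sum_congr rfl fun e _ => ?_
  simp only [List.map_append, List.map_cons]
  rw [cls_swap, deg_map, deg_map]

theorem extensionSum_reverse {P : Type} [Fintype P] {N : ℕ} (r : P → P → Prop) (k : P → ℕ)
    (u v : List (Letter P)) (p q : P) :
    extensionSum R d N r k (u ++ Letter.chord p q :: v) =
      (-1 : R) ^ d • extensionSum R d N r k (u ++ Letter.chord q p :: v) := by
  unfold extensionSum
  rw [Finset.smul_sum]
  refine Finset.sum_congr rfl fun e _ => ?_
  simp only [List.map_append, List.map_cons]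
  exact cls_reverse _ _ _ _ _

theorem extensionSum_arnold {P : Type} [Fintype P] {N : ℕ} (r : P → P → Prop) (k : P → ℕ)
    (u v : List (Letter P)) {a b c : P} (hab : a ≠ b) (hbc : b ≠ c) (hca : c ≠ a) :
    extensionSum R d N r k (u ++ Letter.chord a b :: Letter.chord b c :: v) +
      extensionSum R d N r k (u ++ Letter.chord b c :: Letter.chord c a :: v) +
      extensionSum R d N r k (u ++ Letter.chord c a :: Letter.chord a b :: v) = 0 := by
  unfold extensionSum
  rw [← Finset.sum_add_distrib, ← Finset.sum_add_distrib]
  refine Finset.sum_eq_zero fun e _ => ?_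
  simp only [List.map_append, List.map_cons]
  exact cls_arnold _ _ _ (e.injective.ne hab) (e.injective.ne hbc) (e.injective.ne hca)

/-! ### Expanding top asterisks into chords -/

/-- The points `P` together with `j p` new points for each `p`. -/
abbrev Expanded {P : Type} (j : P → ℕ) : Type := P ⊕ Σ p, Fin (j p)

/-- The constraints on the order of the points `Expanded j`: the old points are ordered by `r`, and
the new points over `p` are to the right of `p`, in increasing order. -/
def expandRel {P : Type} (r : P → P → Prop) (j : P → ℕ) : Expanded j → Expanded j → Prop
  | .inl p, .inl q => r p q
  | .inl p, .inr x => p = x.1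
  | .inr _, .inl _ => False
  | .inr x, .inr y => x.1 = y.1 ∧ x.2.val < y.2.val

/-- The numbers of asterisks after expansion. -/
def expandStars {P : Type} (a j : P → ℕ) : Expanded j → ℕ :=
  Sum.elim a fun _ => 0

/-- The substitution that keeps the first `a p` top asterisks over `p`, and turns the next `j p` of
them into chords to new active points. -/
def expand {P : Type} (a j : P → ℕ) : Letter P → Letter (Expanded j)
  | .pt p => .pt (.inl p)
  | .place p m =>
    if h : a p ≤ m ∧ m - a p < j p then .pt (.inr ⟨p, ⟨m - a p, h.2⟩⟩) else .place (.inl p) m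
  | .chord p q => .chord (.inl p) (.inl q)
  | .bot p => .bot (.inl p)
  | .top p m =>
    if h : a p ≤ m ∧ m - a p < j p then .chord (.inl p) (.inr ⟨p, ⟨m - a p, h.2⟩⟩)
    else .top (.inl p) m

/-- An asterisk and the chord replacing it both have degree d - 1, and a place and the point
replacing it both have degree -1. So the letterwise substitution introduces no signs. -/
theorem deg_expand {P : Type} (a j : P → ℕ) (x : Letter P) : (expand a j x).deg d = x.deg d := by
  cases x <;> simp only [expand] <;> (try split_ifs) <;> rfl

theorem sigma_fin_ext {P : Type} {j : P → ℕ} {x y : Σ p, Fin (j p)} (h : x.1 = y.1)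
    (h' : x.2.val = y.2.val) : x = y := by
  obtain ⟨p, i⟩ := x
  obtain ⟨q, i'⟩ := y
  obtain rfl : p = q := h
  obtain rfl : i = i' := Fin.ext h'
  rfl

theorem sigma_fin_eq_iff {P : Type} {j : P → ℕ} {x y : Σ p, Fin (j p)} :
    x = y ↔ x.1 = y.1 ∧ x.2.val = y.2.val :=
  ⟨fun h => by subst h; exact ⟨rfl, rfl⟩, fun h => sigma_fin_ext h.1 h.2⟩

theorem expand_injective {P : Type} (a j : P → ℕ) : Function.Injective (expand a j) := by
  intro x y h
  cases x <;> cases y <;> simp only [expand] at h <;> (try split_ifs at h) <;>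
    simp at h ⊢ <;> grind

/-! ### Letters and chord graph of an expanded monomial -/

theorem mem_map_expand_pt {P : Type} {a j : P → ℕ} {w : List (Letter P)} {x : Expanded j} :
    Letter.pt x ∈ w.map (expand a j) ↔
      Sum.elim (fun p => Letter.pt p ∈ w) (fun y => Letter.place y.1 (a y.1 + y.2.val) ∈ w) x := by
  rw [List.mem_map]
  constructor
  · rintro ⟨y, hy, h⟩
    cases y <;> simp only [expand] at h <;> (try split_ifs at h) <;> simp at h
    · subst h; exact hy
    · rename_i p m hm
      subst h
      simpa [hm.1] using hy
  · intro h
    rcases x with p | ⟨p, i⟩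
    · exact ⟨_, h, rfl⟩
    · refine ⟨_, h, ?_⟩
      simp [expand]

theorem mem_map_expand_place {P : Type} {a j : P → ℕ} {w : List (Letter P)} {x : Expanded j}
    {m : ℕ} : Letter.place x m ∈ w.map (expand a j) ↔
      ∃ p, x = .inl p ∧ Letter.place p m ∈ w ∧ ¬ (a p ≤ m ∧ m - a p < j p) := by
  rw [List.mem_map]
  constructor
  · rintro ⟨y, hy, h⟩
    cases y <;> simp only [expand] at h <;> (try split_ifs at h) <;> simp at h
    rename_i p i hi
    obtain ⟨rfl, rfl⟩ := h
    exact ⟨p, rfl, hy, hi⟩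
  · rintro ⟨p, rfl, hw, h⟩
    exact ⟨_, hw, by simp only [expand, dif_neg h]⟩

theorem mem_map_expand_top {P : Type} {a j : P → ℕ} {w : List (Letter P)} {x : Expanded j}
    {m : ℕ} : Letter.top x m ∈ w.map (expand a j) ↔
      ∃ p, x = .inl p ∧ Letter.top p m ∈ w ∧ ¬ (a p ≤ m ∧ m - a p < j p) := by
  rw [List.mem_map]
  constructor
  · rintro ⟨y, hy, h⟩
    cases y <;> simp only [expand] at h <;> (try split_ifs at h) <;> simp at h
    rename_i p i hi
    obtain ⟨rfl, rfl⟩ := h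
    exact ⟨p, rfl, hy, hi⟩
  · rintro ⟨p, rfl, hw, h⟩
    exact ⟨_, hw, by simp only [expand, dif_neg h]⟩

theorem mem_map_expand_chord {P : Type} {a j : P → ℕ} {w : List (Letter P)} {x y : Expanded j} :
    Letter.chord x y ∈ w.map (expand a j) ↔
      (∃ p q, x = .inl p ∧ y = .inl q ∧ Letter.chord p q ∈ w) ∨
      ∃ z : Σ p, Fin (j p), x = .inl z.1 ∧ y = .inr z ∧ Letter.top z.1 (a z.1 + z.2.val) ∈ w := by
  rw [List.mem_map]
  constructor
  · rintro ⟨t, ht, h⟩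
    cases t <;> simp only [expand] at h <;> (try split_ifs at h) <;> simp at h
    · obtain ⟨rfl, rfl⟩ := h
      exact Or.inl ⟨_, _, rfl, rfl, ht⟩
    · rename_i p m hm
      obtain ⟨rfl, rfl⟩ := h
      exact Or.inr ⟨_, rfl, rfl, by simpa [hm.1] using ht⟩
  · rintro (⟨p, q, rfl, rfl, h⟩ | ⟨z, rfl, rfl, h⟩)
    · exact ⟨_, h, rfl⟩
    · refine ⟨_, h, ?_⟩
      simp [expand]

theorem map_map_mem {P Q : Type} {e : P ≃ Q} {w : List (Letter P)} {x : Letter Q} :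
    x ∈ w.map (Letter.map e) ↔ x.map e.symm ∈ w := by
  rw [List.mem_map]
  constructor
  · rintro ⟨y, hy, rfl⟩
    rw [Letter.map_map]
    convert hy
    cases y <;> simp [Letter.map, Letter.relabel]
  · intro h
    refine ⟨_, h, ?_⟩
    rw [Letter.map_map]
    cases x <;> simp [Letter.map, Letter.relabel]

/-- A vertex on a cycle has two distinct neighbours, so a cycle of `H` avoids the vertices outside
the image of `f` and lifts to a cycle of `G`. It is applied to the new points, which are leaves. -/
theorem isAcyclic_of_pendant {V W : Type*} {G : SimpleGraph V} {H : SimpleGraph W}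
    (hG : G.IsAcyclic) (f : V → W)
    (hf : ∀ p q, H.Adj (f p) (f q) → G.Adj p q)
    (hp : ∀ x, (∃ p, f p = x) ∨ ∀ y z, H.Adj x y → H.Adj x z → y = z) : H.IsAcyclic := by
  rw [SimpleGraph.isAcyclic_iff_free_cycleGraph] at hG ⊢
  rintro n hn ⟨φ⟩
  obtain ⟨n, rfl⟩ : ∃ m, n = m + 3 := ⟨n - 3, by omega⟩
  have h : ∀ i, ∃ p, f p = φ i := by
    intro i
    refine (hp (φ i)).resolve_right fun h => ?_
    have h1 : (SimpleGraph.cycleGraph (n + 3)).Adj i (i + 1) := by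
      rw [SimpleGraph.cycleGraph_adj]; simp
    have h2 : (SimpleGraph.cycleGraph (n + 3)).Adj i (i - 1) := by
      rw [SimpleGraph.cycleGraph_adj]; simp
    have h3 := φ.injective (h _ _ (φ.toHom.map_adj h1) (φ.toHom.map_adj h2))
    -- The neighbours i + 1 and i - 1 on the cycle coincide only if 2 = 0 modulo its length n + 3.
    have h4 : (1 : Fin (n + 3)) + 1 = 0 := by
      have := congrArg (fun x => x + 1 - i) h3
      simpa [add_sub_right_comm, add_assoc] using this
    have h5 := congrArg Fin.val h4
    simp only [Fin.val_add, Fin.val_one, Fin.val_zero] at h5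
    rw [Nat.mod_eq_of_lt (by omega)] at h5
    omega
  choose g hg using h
  refine hG (n + 3) hn ⟨⟨g, fun {a b} hab => hf _ _ ?_⟩, fun a b hab => φ.injective ?_⟩
  · rw [hg, hg]
    exact φ.toHom.map_adj hab
  · change φ a = φ b
    rw [← hg a, ← hg b]
    exact congrArg f hab

theorem isOrienting_expand {n N : ℕ} {k a j : Fin n → ℕ} (hk : ∀ p, k p = a p + j p)
    {w : Word n} (h : IsOrienting k w) (e : Expanded j ≃ Fin N) :
    IsOrienting (fun x => expandStars a j (e.symm x))
      ((w.map (expand a j)).map (Letter.map e)) := by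
  have hj : ∀ z : Σ p, Fin (j p), a z.1 + z.2.val < k z.1 := by
    intro z
    have := hk z.1
    have := z.2.2
    omega
  refine ⟨?_, ?_, ?_, ?_, ?_, ?_, ?_⟩
  · exact (h.nodup.map (expand_injective a j)).map (Letter.map_injective e.injective)
  · intro x
    rw [map_map_mem]
    refine mem_map_expand_pt.2 ?_
    rcases e.symm x with p | y
    · exact h.pt_mem p
    · exact (h.place_mem _ _).2 (hj y)
  · intro x m
    rw [map_map_mem]
    refine mem_map_expand_place.trans ?_
    rcases e.symm x with p | y
    · have := hk p
      simp only [Sum.inl.injEq, exists_eq_left', expandStars, Sum.elim_inl, h.place_mem]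
      omega
    · simp [expandStars]
  · intro x m
    rw [map_map_mem]
    refine mem_map_expand_top.trans ?_
    rcases e.symm x with p | y
    · have := hk p
      simp only [Sum.inl.injEq, exists_eq_left', expandStars, Sum.elim_inl, h.top_mem]
      omega
    · simp [expandStars]
  · intro x y hxy
    rw [map_map_mem] at hxy
    rintro rfl
    rcases mem_map_expand_chord.1 hxy with ⟨p, q, h1, h2, h3⟩ | ⟨z, h1, h2, h3⟩
    · exact h.chord_ne p q h3 (Sum.inl_injective (h1.symm.trans h2))
    · exact Sum.inl_ne_inr (h1.symm.trans h2)
  · intro x y hxy hyx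
    rw [map_map_mem] at hxy hyx
    rcases mem_map_expand_chord.1 hxy with ⟨p, q, h1, h2, h3⟩ | ⟨z, h1, h2, h3⟩ <;>
      rcases mem_map_expand_chord.1 hyx with ⟨p', q', h1', h2', h3'⟩ | ⟨z', h1', h2', h3'⟩
    · obtain rfl := Sum.inl_injective (h1.symm.trans h2')
      obtain rfl := Sum.inl_injective (h2.symm.trans h1')
      exact h.chord_single _ _ h3 h3'
    · exact Sum.inl_ne_inr (h1.symm.trans h2')
    · exact Sum.inl_ne_inr (h1'.symm.trans h2)
    · exact Sum.inl_ne_inr (h1.symm.trans h2')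
  · refine isAcyclic_of_pendant h.forest (fun p => e (.inl p)) ?_ ?_
    · intro p q hpq
      simp only [chordGraph, SimpleGraph.fromRel_adj, map_map_mem] at hpq ⊢
      simp only [Letter.map, Letter.relabel, Equiv.symm_apply_apply, mem_map_expand_chord] at hpq
      refine ⟨fun h => hpq.1 (by rw [h]), ?_⟩
      simpa using hpq.2
    · intro x
      obtain ⟨x, rfl⟩ := e.surjective x
      rcases x with p | z
      · exact Or.inl ⟨p, rfl⟩
      · refine Or.inr ?_
        have key : ∀ y, (chordGraph ((w.map (expand a j)).map (Letter.map e))).Adj (e (.inr z)) y →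
            y = e (.inl z.1) := by
          intro y hy
          simp only [chordGraph, SimpleGraph.fromRel_adj, map_map_mem] at hy
          simp only [Letter.map, Letter.relabel, Equiv.symm_apply_apply,
            mem_map_expand_chord] at hy
          rw [← Equiv.symm_apply_eq]
          rcases hy.2 with h | h <;> simp [-Sigma.exists] at h
          exact h.1
        intro y y' hy hy'
        rw [key y hy, key y' hy']

/-- The expansion of a diagram: the sum over all admissible positions of the new active points. -/
def expansion (R : Type*) [CommRing R] (d : ℕ) {P : Type} [Fintype P] (r : P → P → Prop)
    (a j : P → ℕ) (w : List (Letter P)) : GenSpace R d :=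
  extensionSum R d (Fintype.card (Expanded j)) (expandRel r j) (expandStars a j)
    (w.map (expand a j))

/-- The sum of the expansions of the diagram with orienting monomial `w`, weighted by `c`. -/
def expansionWord (R : Type*) [CommRing R] (d : ℕ) (c : ℕ → R) {P : Type} [Fintype P]
    [DecidableEq P] (r : P → P → Prop) (k : P → ℕ) (w : List (Letter P)) : GenSpace R d :=
  ∑ j ∈ Fintype.piFinset fun p => Finset.range (k p + 1),
    (∏ p, c (j p)) • expansion R d r (fun p => k p - j p) j w

/-- The weighted sum of expansions on the free space. -/
def expansionFree (R : Type*) [CommRing R] (d : ℕ) (c : ℕ → R) : FreeSpace R →ₗ[R] GenSpace R d :=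
  Finsupp.lsum R fun D => (LinearMap.id : R →ₗ[R] R).smulRight
    (expansionWord R d c (fun p q => p < q) D.2.stars D.2.word)

open Classical in
theorem expansionFree_ofWord (c : ℕ → R) {n : ℕ} (k : Fin n → ℕ) (w : Word n) :
    expansionFree R d c (ofWord R k w) =
      if IsOrienting k w then expansionWord R d c (fun p q => p < q) k w else 0 := by
  unfold ofWord
  split_ifs with h
  · simp [expansionFree]
  · simp

/-! ### Compatibility of expansions with the relations -/

theorem expansionWord_swap (c : ℕ → R) {P : Type} [Fintype P] [DecidableEq P] (r : P → P → Prop)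
    (k : P → ℕ) (u v : List (Letter P)) (x y : Letter P) :
    expansionWord R d c r k (u ++ x :: y :: v) =
      (x.deg d * y.deg d).negOnePow • expansionWord R d c r k (u ++ y :: x :: v) := by
  unfold expansionWord expansion
  rw [Finset.smul_sum]
  refine Finset.sum_congr rfl fun j _ => ?_
  simp only [List.map_append, List.map_cons]
  rw [extensionSum_swap, deg_expand, deg_expand, smul_comm]

theorem expansionWord_reverse (c : ℕ → R) {P : Type} [Fintype P] [DecidableEq P]
    (r : P → P → Prop) (k : P → ℕ) (u v : List (Letter P)) (p q : P) :
    expansionWord R d c r k (u ++ Letter.chord p q :: v) =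
      (-1 : R) ^ d • expansionWord R d c r k (u ++ Letter.chord q p :: v) := by
  unfold expansionWord expansion
  rw [Finset.smul_sum]
  refine Finset.sum_congr rfl fun j _ => ?_
  simp only [List.map_append, List.map_cons, expand]
  rw [extensionSum_reverse, smul_comm]

theorem expansionWord_arnold (c : ℕ → R) {P : Type} [Fintype P] [DecidableEq P]
    (r : P → P → Prop) (k : P → ℕ) (u v : List (Letter P)) {a b e : P}
    (hab : a ≠ b) (hbe : b ≠ e) (hea : e ≠ a) :
    expansionWord R d c r k (u ++ Letter.chord a b :: Letter.chord b e :: v) +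
      expansionWord R d c r k (u ++ Letter.chord b e :: Letter.chord e a :: v) +
      expansionWord R d c r k (u ++ Letter.chord e a :: Letter.chord a b :: v) = 0 := by
  unfold expansionWord expansion
  rw [← Finset.sum_add_distrib, ← Finset.sum_add_distrib]
  refine Finset.sum_eq_zero fun j _ => ?_
  simp only [List.map_append, List.map_cons, expand]
  rw [← smul_add, ← smul_add, extensionSum_arnold _ _ _ _ (Sum.inl_injective.ne hab)
    (Sum.inl_injective.ne hbe) (Sum.inl_injective.ne hea), smul_zero]

/-- A linear map kills all relations if on words it is given by a function that satisfies the
relations. -/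
theorem relations_le_ker_of_words {M : Type*} [AddCommGroup M] [Module R M]
    (F : FreeSpace R →ₗ[R] M) (G : ∀ n : ℕ, (Fin n → ℕ) → Word n → M)
    (hF : ∀ (n : ℕ) (k : Fin n → ℕ) (w : Word n), IsOrienting k w → F (ofWord R k w) = G n k w)
    (hs : ∀ (n : ℕ) (k : Fin n → ℕ) (u v : Word n) (x y : Letter (Fin n)),
      G n k (u ++ x :: y :: v) = (x.deg d * y.deg d).negOnePow • G n k (u ++ y :: x :: v))
    (hr : ∀ (n : ℕ) (k : Fin n → ℕ) (u v : Word n) (p q : Fin n),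
      G n k (u ++ Letter.chord p q :: v) = (-1 : R) ^ d • G n k (u ++ Letter.chord q p :: v))
    (ha : ∀ (n : ℕ) (k : Fin n → ℕ) (u v : Word n) (a b c : Fin n), a ≠ b → b ≠ c → c ≠ a →
      G n k (u ++ Letter.chord a b :: Letter.chord b c :: v) +
      G n k (u ++ Letter.chord b c :: Letter.chord c a :: v) +
      G n k (u ++ Letter.chord c a :: Letter.chord a b :: v) = 0) :
    relations R d ≤ LinearMap.ker F := by
  -- The words in one relation are all orienting or all not; in the second case every term is zero.
  have h0 : ∀ {n : ℕ} {k : Fin n → ℕ} {w : Word n}, ¬ IsOrienting k w → ofWord R k w = 0 :=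
    fun h => dif_neg h
  refine Submodule.span_le.2 ?_
  rintro _ (⟨k, u, v, x, y⟩ | ⟨k, u, v, p, q⟩ | ⟨k, u, v, a, b, c, hab, hbc, hca⟩)
  · rw [SetLike.mem_coe, LinearMap.mem_ker, map_sub, sub_eq_zero]
    have hu : ∀ (e : ℤˣ) (z : FreeSpace R), F (e • z) = e • F z := by
      intro e z
      rcases Int.units_eq_one_or e with rfl | rfl <;> simp
    rw [hu]
    by_cases h : IsOrienting k (u ++ x :: y :: v)
    · rw [hF _ _ _ h, hF _ _ _ (isOrienting_swap.1 h), hs]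
    · rw [h0 h, h0 (mt isOrienting_swap.1 h), map_zero, smul_zero]
  · rw [SetLike.mem_coe, LinearMap.mem_ker, map_sub, sub_eq_zero, map_smul]
    by_cases h : IsOrienting k (u ++ Letter.chord p q :: v)
    · rw [hF _ _ _ h, hF _ _ _ (isOrienting_reverse.1 h), hr]
    · rw [h0 h, h0 (mt isOrienting_reverse.1 h), map_zero, smul_zero]
  · rw [SetLike.mem_coe, LinearMap.mem_ker, map_add, map_add]
    by_cases h : IsOrienting k (u ++ Letter.chord a b :: Letter.chord b c :: v)
    · have h2 := isOrienting_arnold hab hbc hca h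
      have h3 := isOrienting_arnold hbc hca hab h2
      rw [hF _ _ _ h, hF _ _ _ h2, hF _ _ _ h3, ha _ _ _ _ _ _ _ hab hbc hca]
    · have h2 : ¬ IsOrienting k (u ++ Letter.chord b c :: Letter.chord c a :: v) := fun h2 =>
        h (isOrienting_arnold hca hab hbc (isOrienting_arnold hbc hca hab h2))
      have h3 : ¬ IsOrienting k (u ++ Letter.chord c a :: Letter.chord a b :: v) := fun h3 =>
        h (isOrienting_arnold hca hab hbc h3)
      rw [h0 h, h0 h2, h0 h3]
      simp

theorem expansionFree_relations (c : ℕ → R) :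
    relations R d ≤ LinearMap.ker (expansionFree R d c) := by
  refine relations_le_ker_of_words _ (fun n k w => expansionWord R d c (fun p q => p < q) k w)
    ?_ ?_ ?_ ?_
  · intro n k w h
    classical
    rw [expansionFree_ofWord, if_pos h]
  · intro n k u v x y
    exact expansionWord_swap _ _ _ _ _ _ _
  · intro n k u v p q
    exact expansionWord_reverse _ _ _ _ _ _ _
  · intro n k u v a b e hab hbe hea
    exact expansionWord_arnold _ _ _ _ _ hab hbe hea

/-- The endomorphism `D ↦ ∑_j (∏_p c (j p)) • expansion_j(D)`. -/
def expansionMap (R : Type*) [CommRing R] (d : ℕ) (c : ℕ → R) : GenSpace R d →ₗ[R] GenSpace R d :=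
  (relations R d).liftQ (expansionFree R d c) (expansionFree_relations c)

theorem expansionMap_cls_ofWord (c : ℕ → R) {n : ℕ} {k : Fin n → ℕ} {w : Word n}
    (h : IsOrienting k w) :
    expansionMap R d c (cls R d (ofWord R k w)) =
      expansionWord R d c (fun p q => p < q) k w := by
  classical
  rw [expansionMap, cls, Submodule.mkQ_apply, Submodule.liftQ_apply, expansionFree_ofWord,
    if_pos h]

theorem cls_ofWord {n : ℕ} (D : Diagram n) : cls R d (ofWord R D.stars D.word) = D.cls R d := by
  rw [ofWord, dif_pos D.isOrienting]
  rfl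

theorem expansionMap_cls (c : ℕ → R) {n : ℕ} (D : Diagram n) :
    expansionMap R d c (D.cls R d) =
      expansionWord R d c (fun p q => p < q) D.stars D.word := by
  rw [← cls_ofWord, expansionMap_cls_ofWord _ D.isOrienting]

/-! ### Expanding a sum over linear extensions -/

theorem lt_of_lt_imp_lt {P : Type} {N M : ℕ} {e : P → Fin N} {g : P → Fin M}
    (hi : Function.Injective e) (he : ∀ p q, e p < e q → g p < g q) {p q : P} (h : g p < g q) :
    e p < e q := by
  rcases lt_trichotomy (e p) (e q) with h1 | h1 | h1
  · exact h1
  · rw [hi h1] at h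
    exact (lt_irrefl _ h).elim
  · exact (lt_asymm h (he _ _ h1)).elim

theorem existsUnique_enumeration {P : Type} [Fintype P] {N M : ℕ} (hN : Fintype.card P = N)
    (g : P → Fin M) (hg : Function.Injective g) :
    ∃! e : P ≃ Fin N, e ∈ linearExtensions N fun p q => g p < g q := by
  let _ : LinearOrder P := LinearOrder.lift' g hg
  have hlt : ∀ p q : P, p < q ↔ g p < g q := fun p q => Iff.rfl
  let s := (Fintype.orderIsoFinOfCardEq P hN).symm
  refine ⟨s.toEquiv, mem_linearExtensions.2 fun p q h => s.lt_iff_lt.2 ((hlt p q).2 h),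
    fun e he => ?_⟩
  let t : Fin N ≃o P := StrictMono.orderIsoOfSurjective e.symm
    (fun x y hxy => (hlt _ _).2 (lt_of_lt_imp_lt hg (mem_linearExtensions.1 he) (by simpa using hxy)))
    e.symm.surjective
  have h : t = s.symm := Subsingleton.elim _ _
  ext p
  have h1 : e.symm (s p) = p := by
    change t (s p) = p
    rw [h]; simp
  rw [← h1, Equiv.apply_symm_apply, h1]
  rfl

/-- An order on all points induces exactly one order on the old ones, so the linear extensions of
`expandRel r j` are partitioned according to the linear extension `e` of `r` that they induce. -/
theorem sum_extensionSum_expandRel {P : Type} [Fintype P] {N M : ℕ} (hN : Fintype.card P = N)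
    (r : P → P → Prop) (j : P → ℕ) (k : Expanded j → ℕ) (w : List (Letter (Expanded j))) :
    ∑ e ∈ linearExtensions N r, extensionSum R d M (expandRel (fun p q => e p < e q) j) k w =
      extensionSum R d M (expandRel r j) k w := by
  unfold extensionSum
  rw [Finset.sum_comm' (s' := fun f => linearExtensions N fun p q => f (.inl p) < f (.inl q))
    (t' := linearExtensions M (expandRel r j))]
  · refine Finset.sum_congr rfl fun f _ => ?_
    obtain ⟨e, he, hu⟩ := existsUnique_enumeration hN (fun p => f (Sum.inl p))
      (f.injective.comp Sum.inl_injective)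
    rw [Finset.sum_eq_single_of_mem e]
    · exact he
    · intro e' he' hne
      exact (hne (hu _ he')).elim
  · intro e f
    simp only [mem_linearExtensions]
    constructor
    · rintro ⟨he, hf⟩
      refine ⟨fun p q h => lt_of_lt_imp_lt e.injective (fun p q h => hf (.inl p) (.inl q) h) h, ?_⟩
      rintro (p | x) (q | y) h
      · exact hf (.inl p) (.inl q) (he _ _ h)
      all_goals exact hf _ _ h
    · rintro ⟨he, hf⟩
      refine ⟨fun p q h => he _ _ (hf (.inl p) (.inl q) h), ?_⟩
      rintro (p | x) (q | y) h
      · exact lt_of_lt_imp_lt (f.injective.comp Sum.inl_injective) he h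
      all_goals exact hf _ _ h

/-- Expansion is natural in the set of points; this moves the multiplicities from the numbered
points `Fin N` back to `P`. -/
theorem expansion_congr {P Q : Type} [Fintype P] [Fintype Q] (φ : P ≃ Q) (r : Q → Q → Prop)
    (a j : Q → ℕ) (w : List (Letter P)) :
    expansion R d r a j (w.map (Letter.map φ)) =
      expansion R d (fun p q => r (φ p) (φ q)) (fun p => a (φ p)) (fun p => j (φ p)) w := by
  unfold expansion
  let ψ : Expanded (fun p => j (φ p)) ≃ Expanded j :=
    Equiv.sumCongr φ (Equiv.sigmaCongrLeft (β := fun q => Fin (j q)) φ)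
  symm
  refine extensionSum_congr ψ (Fintype.card_congr ψ) ?_ ?_ ?_
  · rintro (p | x) (q | y)
    · rfl
    · exact φ.injective.eq_iff.symm
    · rfl
    · exact and_congr_left fun _ => φ.injective.eq_iff.symm
  · rintro (p | x) <;> rfl
  · rw [List.map_map, List.map_map]
    congr 1
    funext x
    cases x <;> simp only [Function.comp_apply, Letter.map, Letter.relabel, expand] <;>
      (try split_ifs) <;> rfl

/-- Expanding every ordered diagram of the sum amounts to expanding the abstract data once, with the
constraints `r` kept. This makes a second expansion computable. -/
theorem expansionMap_extensionSum (c : ℕ → R) {P : Type} [Fintype P] [DecidableEq P] {N : ℕ}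
    (hN : Fintype.card P = N) (r : P → P → Prop) (k : P → ℕ) (w : List (Letter P))
    (h : ∀ e : P ≃ Fin N, IsOrienting (fun x => k (e.symm x)) (w.map (Letter.map e))) :
    expansionMap R d c (extensionSum R d N r k w) = expansionWord R d c r k w := by
  have key : ∀ e : P ≃ Fin N,
      expansionMap R d c (cls R d (ofWord R (fun x => k (e.symm x)) (w.map (Letter.map e)))) =
      ∑ j ∈ Fintype.piFinset fun p => Finset.range (k p + 1),
        (∏ p, c (j p)) • expansion R d (fun p q => e p < e q) (fun p => k p - j p) j w := by
    intro e
    rw [expansionMap_cls_ofWord _ (h e), expansionWord]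
    refine Finset.sum_equiv (e.symm.arrowCongr (Equiv.refl ℕ)) ?_ ?_
    · intro j
      simp only [Fintype.mem_piFinset, Finset.mem_range, Equiv.arrowCongr_apply, Function.comp_apply,
        Equiv.refl_apply, Equiv.symm_symm]
      refine ⟨fun h p => by simpa using h (e p), fun h x => by simpa using h (e.symm x)⟩
    · intro j _
      rw [expansion_congr]
      simp only [Equiv.arrowCongr_apply, Function.comp_def,
        Equiv.refl_apply, Equiv.symm_symm, Equiv.symm_apply_apply]
      rw [Equiv.prod_comp e fun x => c (j x)]
      rfl
  rw [extensionSum, map_sum, Finset.sum_congr rfl fun e _ => key e, Finset.sum_comm, expansionWord]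
  refine Finset.sum_congr rfl fun j _ => ?_
  rw [← Finset.smul_sum]
  exact congrArg _ (sum_extensionSum_expandRel hN r j _ _)

/-- The natural order of `Fin n` is already total, so the identity is its only linear extension. -/
theorem extensionSum_lt {n : ℕ} (k : Fin n → ℕ) (w : Word n) :
    extensionSum R d n (fun p q => p < q) k w = cls R d (ofWord R k w) := by
  unfold extensionSum
  obtain ⟨e', -, hu⟩ := existsUnique_enumeration (M := n) (Fintype.card_fin n) id
    Function.injective_id
  have h1 : Equiv.refl (Fin n) ∈ linearExtensions n fun p q : Fin n => p < q :=
    mem_linearExtensions.2 fun _ _ h => h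
  rw [Finset.sum_eq_single_of_mem _ h1]
  · simp only [Equiv.refl_symm, Equiv.refl_apply, Equiv.coe_refl]
    congr 2
    conv_rhs => rw [← List.map_id w]
    congr 1
    funext x
    cases x <;> rfl
  · intro e he hne
    exact (hne ((hu _ he).trans (hu _ h1).symm)).elim

theorem expansion_zero {n : ℕ} (k : Fin n → ℕ) (w : Word n) :
    expansion R d (fun p q => p < q) k (fun _ => 0) w = cls R d (ofWord R k w) := by
  rw [← extensionSum_lt, expansion]
  have : IsEmpty (Σ p : Fin n, Fin ((fun _ : Fin n => 0) p)) := ⟨fun x => x.2.elim0⟩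
  let ψ : Expanded (fun _ : Fin n => 0) ≃ Fin n := Equiv.sumEmpty _ _
  refine extensionSum_congr ψ ((Fintype.card_congr ψ).trans (Fintype.card_fin n)) ?_ ?_ ?_
  · rintro (p | x) (q | y)
    · rfl
    · exact y.2.elim0
    · exact x.2.elim0
    · exact x.2.elim0
  · rintro (p | x)
    · rfl
    · exact x.2.elim0
  · rw [List.map_map]
    conv_rhs => rw [← List.map_id w]
    congr 1
    funext x
    cases x <;> simp [expand, Letter.map, Letter.relabel, ψ]

/-! ### Permuting letters of an orienting monomial -/

theorem cls_move {n : ℕ} (k : Fin n → ℕ) (x : Letter (Fin n)) (v : Word n) :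
    ∀ u z : Word n, cls R d (ofWord R k (u ++ x :: (v ++ z))) =
      (v.map fun y => (x.deg d * y.deg d).negOnePow).prod •
        cls R d (ofWord R k (u ++ (v ++ x :: z))) := by
  induction v with
  | nil => intro u z; simp
  | cons y v ih =>
    intro u z
    have h1 := cls_swap (R := R) (d := d) k u (v ++ z) x y
    have h2 := ih (u ++ [y]) z
    simp only [List.append_assoc, List.cons_append, List.nil_append] at h1 h2 ⊢
    rw [h1, h2, List.map_cons, List.prod_cons, mul_smul]

/-- The signs of carrying `x` and `y` across the block `v` agree, since the degrees do, and cancel.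
What remains is the sign of one adjacent exchange. -/
theorem cls_exchange {n : ℕ} (k : Fin n → ℕ) {x y : Letter (Fin n)} (hxy : x.deg d = y.deg d)
    (u v z : Word n) :
    cls R d (ofWord R k (u ++ y :: (v ++ x :: z))) =
      (x.deg d * x.deg d).negOnePow • cls R d (ofWord R k (u ++ x :: (v ++ y :: z))) := by
  have h1 := cls_move (R := R) (d := d) k x v u (y :: z)
  have h2 := cls_move (R := R) (d := d) k y v u (x :: z)
  have h3 := cls_swap (R := R) (d := d) k (u ++ v) z x y
  simp only [List.append_assoc] at h1 h2 h3
  rw [h2, h1, h3, ← hxy, smul_comm, smul_smul, smul_smul, mul_assoc, ← Int.negOnePow_add,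
    ← two_mul, Int.negOnePow_two_mul, mul_one]

theorem map_swap_split {α : Type*} [DecidableEq α] {x y : α} {u v z : List α}
    (h : (u ++ x :: (v ++ y :: z)).Nodup) :
    (u ++ x :: (v ++ y :: z)).map (Equiv.swap x y) = u ++ y :: (v ++ x :: z) := by
  have h' : (x :: y :: (u ++ (v ++ z))).Nodup := by
    refine (List.Perm.nodup_iff ?_).1 h
    refine List.perm_middle.trans (List.Perm.cons x ?_)
    rw [← List.append_assoc]
    exact List.perm_middle.trans (by simp)
  simp only [List.nodup_cons, List.mem_cons, List.mem_append, not_or] at h'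
  have hid : ∀ l : List α, (x ∉ l) → (y ∉ l) → l.map (Equiv.swap x y) = l := by
    intro l hx hy
    conv_rhs => rw [← List.map_id l]
    refine List.map_congr_left fun a ha => ?_
    exact Equiv.swap_apply_of_ne_of_ne (fun h => hx (h ▸ ha)) (fun h => hy (h ▸ ha))
  simp only [List.map_append, List.map_cons, Equiv.swap_apply_left, Equiv.swap_apply_right]
  rw [hid u h'.1.2.1 h'.2.1.1, hid v h'.1.2.2.1 h'.2.1.2.1, hid z h'.1.2.2.2 h'.2.1.2.2]

open Classical in
theorem cls_map_swap {n : ℕ} (k : Fin n → ℕ) {x y : Letter (Fin n)} (hxy : x.deg d = y.deg d)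
    (hne : x ≠ y) {w : Word n} (hw : w.Nodup) (hx : x ∈ w) (hy : y ∈ w) :
    cls R d (ofWord R k (w.map (Equiv.swap x y))) =
      (x.deg d * x.deg d).negOnePow • cls R d (ofWord R k w) := by
  obtain ⟨u, v, rfl⟩ := List.append_of_mem hx
  rcases List.mem_append.1 hy with hy | hy
  · obtain ⟨u, v', rfl⟩ := List.append_of_mem hy
    simp only [List.append_assoc, List.cons_append] at hw ⊢
    rw [Equiv.swap_comm, map_swap_split hw, cls_exchange k hxy.symm, hxy]
  · obtain ⟨v, z, rfl⟩ := List.append_of_mem ((List.mem_cons.1 hy).resolve_left hne.symm)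
    rw [map_swap_split hw, cls_exchange k hxy]

/-- The permutation of the new points over `p₀`. -/
def permNew {P : Type} [DecidableEq P] (m : P → ℕ) (p₀ : P) :
    Equiv.Perm (Fin (m p₀)) →* Equiv.Perm (Expanded m) :=
  ((Equiv.Perm.sumCongrHom P (Σ p, Fin (m p))).comp (MonoidHom.inr _ _)).comp
    ((Equiv.Perm.sigmaCongrRightHom fun p => Fin (m p)).comp
      (MonoidHom.mulSingle (fun p => Equiv.Perm (Fin (m p))) p₀))

section
variable {P : Type} [DecidableEq P] (m : P → ℕ) (p₀ : P) (π : Equiv.Perm (Fin (m p₀)))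

@[simp] theorem permNew_inl (p : P) : permNew m p₀ π (.inl p) = .inl p := rfl

@[simp] theorem permNew_inr_self (t : Fin (m p₀)) :
    permNew m p₀ π (.inr ⟨p₀, t⟩) = .inr ⟨p₀, π t⟩ := by
  simp [permNew]

@[simp] theorem permNew_inr_of_ne {p : P} (hp : p ≠ p₀) (t : Fin (m p)) :
    permNew m p₀ π (.inr ⟨p, t⟩) = .inr ⟨p, t⟩ := by
  simp [permNew, hp]

theorem expandStars_permNew (a : P → ℕ) (x : Expanded m) :
    expandStars a m (permNew m p₀ π x) = expandStars a m x := by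
  rcases x with p | x <;> rfl

end

/-- The diagram obtained by expansion, with the active points ordered by `f`. -/
def expansionTerm (R : Type*) [CommRing R] (d : ℕ) {P : Type} {N : ℕ} (a m : P → ℕ)
    (w : List (Letter P)) (f : Expanded m ≃ Fin N) : GenSpace R d :=
  cls R d (ofWord R (fun x => expandStars a m (f.symm x))
    ((w.map (expand a m)).map (Letter.map f)))

theorem negOnePow_mul_self (x : ℤ) : (x * x).negOnePow = x.negOnePow := by
  rcases Int.even_or_odd x with h | h
  · rw [Int.negOnePow_even _ h, Int.negOnePow_even _ (h.mul_left _)]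
  · rw [Int.negOnePow_odd _ h, Int.negOnePow_odd _ (h.mul h)]

/-- The new points over `p₀` carry no asterisks and are attached to the same point, so exchanging
two of them changes the monomial only by a transposition of two points and one of two chords. -/
theorem expansionTerm_swap {n N : ℕ} {k a m : Fin n → ℕ} (hk : ∀ p, k p = a p + m p) {w : Word n}
    (h : IsOrienting k w) (p₀ : Fin n) {s t : Fin (m p₀)} (hst : s ≠ t) (f : Expanded m ≃ Fin N) :
    expansionTerm R d a m w ((permNew m p₀ (Equiv.swap s t)).trans f) =
      (-1 : ℤˣ) ^ d • expansionTerm R d a m w f := by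
  classical
  have ho := isOrienting_expand hk h f
  have hne : (⟨p₀, s⟩ : Σ p, Fin (m p)) ≠ ⟨p₀, t⟩ := fun h => hst (by simpa using h)
  have hfne : f (.inr ⟨p₀, s⟩) ≠ f (.inr ⟨p₀, t⟩) := by
    intro h; exact hne (Sum.inr_injective (f.injective h))
  have hstars : (fun x => expandStars a m (((permNew m p₀ (Equiv.swap s t)).trans f).symm x)) =
      fun x => expandStars a m (f.symm x) := by
    funext x
    rw [← expandStars_permNew m p₀ (Equiv.swap s t)]
    simp
  -- The permutation of points acts on the letters of this word as the two transpositions, which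
  -- allows `cls_map_swap` to be used twice.
  have hword : (w.map (expand a m)).map (Letter.map ((permNew m p₀ (Equiv.swap s t)).trans f)) =
      (((w.map (expand a m)).map (Letter.map f)).map
        (Equiv.swap (Letter.chord (f (.inl p₀)) (f (.inr ⟨p₀, s⟩)))
          (Letter.chord (f (.inl p₀)) (f (.inr ⟨p₀, t⟩))))).map
        (Equiv.swap (Letter.pt (f (.inr ⟨p₀, s⟩))) (Letter.pt (f (.inr ⟨p₀, t⟩)))) := by
    rw [List.map_map (l := w), List.map_map (l := w), List.map_map (l := w), List.map_map (l := w)]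
    congr 1
    funext x
    have hsw : ∀ (A : Σ p, Fin (m p)),
        permNew m p₀ (Equiv.swap s t) (.inr A) = .inr (Equiv.swap ⟨p₀, s⟩ ⟨p₀, t⟩ A) := by
      rintro ⟨p, A⟩
      by_cases hp : p = p₀
      · subst hp
        rw [permNew_inr_self]
        by_cases h1 : A = s
        · subst h1; simp
        by_cases h2 : A = t
        · subst h2; simp
        rw [Equiv.swap_apply_of_ne_of_ne h1 h2, Equiv.swap_apply_of_ne_of_ne] <;>
          simpa
      · rw [permNew_inr_of_ne _ _ _ hp, Equiv.swap_apply_of_ne_of_ne] <;>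
          · intro h; exact hp (congrArg Sigma.fst h)
    have hpt : ∀ A : Σ p, Fin (m p), Letter.pt (f (.inr (Equiv.swap ⟨p₀, s⟩ ⟨p₀, t⟩ A))) =
        Equiv.swap (Letter.pt (f (.inr ⟨p₀, s⟩))) (Letter.pt (f (.inr ⟨p₀, t⟩)))
          (Letter.pt (f (.inr A))) := by
      intro A
      refine Function.Injective.map_swap (f := fun A => Letter.pt (f (.inr A))) ?_ _ _ _
      intro A B hAB
      simpa using hAB
    have hch : ∀ A : Σ p, Fin (m p),
        Letter.chord (f (.inl A.1)) (f (.inr (Equiv.swap ⟨p₀, s⟩ ⟨p₀, t⟩ A))) =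
        Equiv.swap (Letter.chord (f (.inl p₀)) (f (.inr ⟨p₀, s⟩)))
          (Letter.chord (f (.inl p₀)) (f (.inr ⟨p₀, t⟩)))
          (Letter.chord (f (.inl A.1)) (f (.inr A))) := by
      intro A
      by_cases h1 : A = ⟨p₀, s⟩
      · subst h1; simp
      by_cases h2 : A = ⟨p₀, t⟩
      · subst h2; simp
      rw [Equiv.swap_apply_of_ne_of_ne h1 h2, Equiv.swap_apply_of_ne_of_ne] <;>
        · simp only [ne_eq, Letter.chord.injEq, EmbeddingLike.apply_eq_iff_eq, Sum.inr.injEq]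
          tauto
    cases x with
    | pt p =>
      simp [expand, Letter.map, Letter.relabel, Equiv.swap_apply_of_ne_of_ne]
    | bot p =>
      simp [expand, Letter.map, Letter.relabel, Equiv.swap_apply_of_ne_of_ne]
    | chord p q =>
      simp [expand, Letter.map, Letter.relabel, Equiv.swap_apply_of_ne_of_ne]
    | place p i =>
      by_cases hi : a p ≤ i ∧ i - a p < m p
      · simp only [Function.comp_apply, expand, dif_pos hi, Letter.map, Letter.relabel,
          Equiv.trans_apply, hsw, hpt]
        rw [Equiv.swap_apply_of_ne_of_ne (x := Letter.pt _) (a := Letter.chord _ _)] <;> simp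
      · simp [expand, hi, Letter.map, Letter.relabel, Equiv.swap_apply_of_ne_of_ne]
    | top p i =>
      by_cases hi : a p ≤ i ∧ i - a p < m p
      · simp only [Function.comp_apply, expand, dif_pos hi, Letter.map, Letter.relabel,
          Equiv.trans_apply, hsw, permNew_inl]
        rw [← hch ⟨p, ⟨i - a p, hi.2⟩⟩]
        exact (Equiv.swap_apply_of_ne_of_ne (by simp) (by simp)).symm
      · simp [expand, hi, Letter.map, Letter.relabel, Equiv.swap_apply_of_ne_of_ne]
  have hkp := hk p₀
  have hmem : ∀ s : Fin (m p₀),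
      Letter.chord (f (.inl p₀)) (f (.inr ⟨p₀, s⟩)) ∈ (w.map (expand a m)).map (Letter.map f) ∧
      Letter.pt (f (.inr ⟨p₀, s⟩)) ∈ (w.map (expand a m)).map (Letter.map f) := by
    intro s
    refine ⟨?_, ho.pt_mem _⟩
    rw [map_map_mem]
    simp only [Letter.map, Letter.relabel, Equiv.symm_apply_apply]
    refine mem_map_expand_chord.2 (Or.inr ⟨⟨p₀, s⟩, rfl, rfl, (h.top_mem _ _).2 ?_⟩)
    have := s.2
    dsimp only
    omega
  have hpm : ∀ s s₁ s₂ : Fin (m p₀), Letter.pt (f (.inr ⟨p₀, s⟩)) ∈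
      ((w.map (expand a m)).map (Letter.map f)).map
        (Equiv.swap (Letter.chord (f (.inl p₀)) (f (.inr ⟨p₀, s₁⟩)))
          (Letter.chord (f (.inl p₀)) (f (.inr ⟨p₀, s₂⟩)))) := by
    intro s s₁ s₂
    refine List.mem_map.2 ⟨_, (hmem s).2, ?_⟩
    rw [Equiv.swap_apply_of_ne_of_ne] <;> simp
  rw [expansionTerm, hstars, hword, cls_map_swap, cls_map_swap]
  · rw [smul_smul, expansionTerm]
    congr 1
    simp only [Letter.deg, negOnePow_mul_self]
    rw [← Int.negOnePow_add]
    -- The exponents are -1 for the points and d - 1 for the chords, each square having been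
    -- replaced by a number of the same parity.
    have : (-1 : ℤ) + ((d : ℤ) - 1) = d - 2 * 1 := by ring
    rw [this, Int.negOnePow_sub, Int.negOnePow_two_mul, mul_one, Int.negOnePow_def, zpow_natCast]
  · rfl
  · simpa using hfne
  · exact ho.nodup
  · exact (hmem s).1
  · exact (hmem t).1
  · rfl
  · simpa using hfne
  · exact ho.nodup.map (Equiv.injective _)
  · exact hpm _ _ _
  · exact hpm _ _ _

theorem expansionTerm_permNew {n N : ℕ} {k a m : Fin n → ℕ} (hk : ∀ p, k p = a p + m p)
    {w : Word n} (h : IsOrienting k w) (p₀ : Fin n) (π : Equiv.Perm (Fin (m p₀))) :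
    ∀ f : Expanded m ≃ Fin N, expansionTerm R d a m w ((permNew m p₀ π).trans f) =
      Equiv.Perm.sign π ^ d • expansionTerm R d a m w f := by
  induction π using Equiv.Perm.swap_induction_on with
  | one =>
    intro f
    rw [map_one, map_one, one_pow, one_smul]
    rfl
  | swap_mul π s t hst ih =>
    intro f
    have : (permNew m p₀ (Equiv.swap s t * π)).trans f =
        (permNew m p₀ π).trans ((permNew m p₀ (Equiv.swap s t)).trans f) := by
      rw [map_mul]; rfl
    rw [this, ih, expansionTerm_swap hk h p₀ hst, smul_smul, map_mul, Equiv.Perm.sign_swap hst,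
      mul_pow, mul_comm]

/-! ### Cancellation -/

/-- This cycle takes the last position to position `t` and pushes the positions in between up by
one. It renumbers the new points when the last point of the second batch is appended to a first
batch of length `t`. -/
theorem exists_cycle {M t : ℕ} (ht : t < M) : ∃ π : Equiv.Perm (Fin M),
    Equiv.Perm.sign π = (-1) ^ (M - 1 - t) ∧
    ∀ s, (π s).val = if s.val < t then s.val else if s.val = M - 1 then t else s.val + 1 := by
  have : NeZero M := ⟨by omega⟩
  have hM : M - 1 < M := by omega
  have hle : (⟨t, ht⟩ : Fin M) ≤ ⟨M - 1, hM⟩ := by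
    rw [Fin.le_def]; dsimp only; omega
  refine ⟨Fin.cycleIcc ⟨t, ht⟩ ⟨M - 1, hM⟩, Fin.sign_cycleIcc_of_le hle, fun s => ?_⟩
  split_ifs with h1 h2
  · rw [Fin.cycleIcc_of_lt (Fin.lt_def.2 h1)]
  · obtain rfl : s = ⟨M - 1, hM⟩ := Fin.ext h2
    rw [Fin.cycleIcc_of_last hle]
  · rw [Fin.cycleIcc_of_ge_of_lt (Fin.le_def.2 (by dsimp only; omega))
      (Fin.lt_def.2 (by dsimp only; omega)), Fin.val_add_one_of_lt']
    omega

/-- `g` is increasing on the numbers below `t`, and on the other ones. -/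
def IsShuffle {M N : ℕ} (t : ℕ) (g : Fin M → Fin N) : Prop :=
  ∀ x y, x.val < y.val → (y.val < t ∨ t ≤ x.val) → g x < g y

/-- The maximum of a shuffle is at the end of one of the two blocks. The condition `t < M` says that
the second block is not empty; for `t = M` the two candidate positions coincide. -/
theorem IsShuffle.not_max_iff {M N t : ℕ} (ht : t ≤ M) (hM : 0 < M) {g : Fin M → Fin N}
    (hg : Function.Injective g) (h : IsShuffle t g) :
    (¬ ∃ u : Fin M, u.val + 1 = t ∧ ∀ s, g s ≤ g u) ↔
      t < M ∧ ∃ u : Fin M, u.val + 1 = M ∧ ∀ s, g s ≤ g u := by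
  have : Nonempty (Fin M) := ⟨⟨0, hM⟩⟩
  obtain ⟨u, hu⟩ := Finite.exists_max g
  constructor
  · intro hn
    have h1 : u.val + 1 ≠ t := fun h => hn ⟨u, h, hu⟩
    have h2 : u.val + 1 = M := by
      by_contra h2
      have := u.2
      refine not_lt_of_ge (hu ⟨u.val + 1, by omega⟩) (h _ _ ?_ ?_)
      · dsimp only; omega
      · dsimp only; omega
    exact ⟨by omega, u, h2, hu⟩
  · rintro ⟨htM, u, hu, hmax⟩ ⟨v, hv, hmax'⟩
    have := hg (le_antisymm (hmax v) (hmax' u))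
    rw [this] at hv
    omega

/-- The last element of a block, when it has the largest value, may be appended to either block
without affecting the conditions on the other elements. The cycle `π` renumbers positions
accordingly. -/
theorem isShuffle_cycle_iff {M N t : ℕ} (ht : t < M) {g g' : Fin M → Fin N}
    (hg' : Function.Injective g') {π : Equiv.Perm (Fin M)}
    (hπ : ∀ s, (π s).val = if s.val < t then s.val else if s.val = M - 1 then t else s.val + 1)
    (hgg : ∀ s, g s = g' (π s)) :
    (IsShuffle t g ∧ ∃ u : Fin M, u.val + 1 = M ∧ ∀ s, g s ≤ g u) ↔
      IsShuffle (t + 1) g' ∧ ∃ u : Fin M, u.val + 1 = t + 1 ∧ ∀ s, g' s ≤ g' u := by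
  have hM : M - 1 < M := by omega
  have hlast : π ⟨M - 1, hM⟩ = ⟨t, ht⟩ := by
    apply Fin.ext
    rw [hπ]
    dsimp only
    split_ifs <;> omega
  have hmax : (∃ u : Fin M, u.val + 1 = M ∧ ∀ s, g s ≤ g u) ↔
      ∀ s, g' s ≤ g' ⟨t, ht⟩ := by
    constructor
    · rintro ⟨u, hu, h⟩ s
      obtain rfl : u = ⟨M - 1, hM⟩ := Fin.ext (by dsimp only; omega)
      have := h (π.symm s)
      rwa [hgg, hgg, hlast, Equiv.apply_symm_apply] at this
    · intro h
      refine ⟨⟨M - 1, hM⟩, by dsimp only; omega, fun s => ?_⟩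
      rw [hgg, hgg, hlast]
      exact h _
  have hmax' : (∃ u : Fin M, u.val + 1 = t + 1 ∧ ∀ s, g' s ≤ g' u) ↔
      ∀ s, g' s ≤ g' ⟨t, ht⟩ := by
    constructor
    · rintro ⟨u, hu, h⟩ s
      obtain rfl : u = ⟨t, ht⟩ := Fin.ext (by dsimp only; omega)
      exact h s
    · intro h
      exact ⟨⟨t, ht⟩, rfl, h⟩
  rw [hmax, hmax']
  refine and_congr_left fun hm => ?_
  have hm' : ∀ s : Fin M, s.val ≠ t → g' s < g' ⟨t, ht⟩ := fun s hs =>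
    lt_of_le_of_ne (hm s) (hg'.ne (fun h => hs (by rw [h])))
  constructor
  · intro h x y hxy hc
    by_cases hy : y.val = t
    · obtain rfl : y = ⟨t, ht⟩ := Fin.ext hy
      exact hm' _ (by simpa using hxy.ne)
    have hx := h (π.symm x) (π.symm y)
    rw [hgg, hgg, Equiv.apply_symm_apply, Equiv.apply_symm_apply] at hx
    have h1 := hπ (π.symm x)
    have h2 := hπ (π.symm y)
    rw [Equiv.apply_symm_apply] at h1 h2
    have h3 := (π.symm x).2
    have h4 := (π.symm y).2
    apply hx <;> split_ifs at h1 h2 <;> omega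
  · intro h x y hxy hc
    rw [hgg, hgg]
    have h1 := hπ x
    have h2 := hπ y
    by_cases hy : y.val = M - 1
    · have : π y = ⟨t, ht⟩ := by rw [← hlast]; congr 1; exact Fin.ext hy
      rw [this]
      refine hm' _ ?_
      have := x.2
      split_ifs at h1 <;> omega
    have h3 := y.2
    have hx := h (π x) (π y)
    clear h hm hm' hmax hmax' hlast
    generalize π x = x' at *
    generalize π y = y' at *
    apply hx <;> split_ifs at h1 h2 <;> omega

/-- The constraints on the order of the points `Expanded m` when the first `i p` new points over `p`
are shuffled with the other ones. -/
def shuffleRel {P : Type} (r : P → P → Prop) (i m : P → ℕ) : Expanded m → Expanded m → Prop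
  | .inl p, .inl q => r p q
  | .inl p, .inr x => p = x.1
  | .inr _, .inl _ => False
  | .inr x, .inr y => x.1 = y.1 ∧ x.2.val < y.2.val ∧ (y.2.val < i x.1 ∨ i x.1 ≤ x.2.val)

theorem mem_linearExtensions_shuffleRel {P : Type} [Fintype P] {N : ℕ} {r : P → P → Prop}
    {i m : P → ℕ} {f : Expanded m ≃ Fin N} :
    f ∈ linearExtensions N (shuffleRel r i m) ↔
      (∀ p q, r p q → f (.inl p) < f (.inl q)) ∧
      (∀ p (s : Fin (m p)), f (.inl p) < f (.inr ⟨p, s⟩)) ∧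
      ∀ p, IsShuffle (i p) fun s : Fin (m p) => f (.inr ⟨p, s⟩) := by
  rw [mem_linearExtensions]
  constructor
  · intro h
    exact ⟨fun p q hpq => h (.inl p) (.inl q) hpq, fun p s => h (.inl p) (.inr ⟨p, s⟩) rfl,
      fun p x y hxy hc => h (.inr ⟨p, x⟩) (.inr ⟨p, y⟩) ⟨rfl, hxy, hc⟩⟩
  · rintro ⟨h1, h2, h3⟩ (p | ⟨p, x⟩) (q | ⟨q, y⟩) h
    · exact h1 _ _ h
    · obtain rfl : p = q := h
      exact h2 _ _
    · exact h.elim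
    · obtain ⟨rfl, h4, h5⟩ := h
      exact h3 _ _ _ h4 h5

/-- The coefficients of the inverse. -/
def signWeight (R : Type*) [CommRing R] (d t : ℕ) : R := (-1) ^ (t + d * (t * (t - 1) / 2))

theorem signWeight_zero : signWeight R d 0 = 1 := by simp [signWeight]

/-- Triangular numbers grow from s to s + 1 by s. So the ratio of consecutive weights is, up to the
factor -1, the sign of a cycle past `s` new points. -/
theorem signWeight_succ (s : ℕ) :
    signWeight R d (s + 1) * (-1) ^ (s * d) = - signWeight R d s := by
  unfold signWeight
  rw [← pow_add, Nat.triangle_succ]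
  have : s + 1 + d * (s * (s - 1) / 2 + s) + s * d =
      2 * (s * d) + 1 + (s + d * (s * (s - 1) / 2)) := by ring
  rw [this, pow_add, pow_add, pow_mul]
  simp

theorem neg_one_units_pow_smul (n : ℕ) (x : GenSpace R d) :
    ((-1 : ℤˣ) ^ n) • x = ((-1 : R) ^ n) • x := by
  rcases Nat.even_or_odd n with h | h
  · rw [h.neg_one_pow, h.neg_one_pow, one_smul, one_smul]
  · rw [h.neg_one_pow, h.neg_one_pow, neg_one_smul]
    simp [Units.smul_def]

/-- A sign-reversing matching: the right-most new point over `p₀` is transferred between the two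
batches, everything over other points being fixed. -/
theorem sum_shuffles_eq_zero {n N : ℕ} {k a m : Fin n → ℕ} (hk : ∀ p, k p = a p + m p)
    {w : Word n} (h : IsOrienting k w) {p₀ : Fin n} (hm : 0 < m p₀) :
    ∑ i ∈ Fintype.piFinset fun p => Finset.range (m p + 1),
      (∏ p, signWeight R d (m p - i p)) •
        extensionSum R d N (shuffleRel (fun p q => p < q) i m) (expandStars a m)
          (w.map (expand a m)) = 0 := by
  classical
  choose! π hsign hval using fun (t : ℕ) (ht : t < m p₀) => exists_cycle ht
  have hinj : ∀ (f : Expanded m ≃ Fin N) p, Function.Injective fun s : Fin (m p) =>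
      f (.inr ⟨p, s⟩) := fun f p s t h => by simpa using h
  simp only [extensionSum, Finset.smul_sum]
  rw [Finset.sum_sigma']
  set S := (Fintype.piFinset fun p => Finset.range (m p + 1)).sigma fun i =>
    linearExtensions N (shuffleRel (fun p q => p < q) i m) with hS
  -- `B` singles out the terms in which the right-most new point over `p₀` closes the first batch.
  -- In the other terms it closes the second batch.
  let B : (Σ _ : Fin n → ℕ, Expanded m ≃ Fin N) → Prop := fun x =>
    ∃ u : Fin (m p₀), u.val + 1 = x.1 p₀ ∧ ∀ s, x.2 (.inr ⟨p₀, s⟩) ≤ x.2 (.inr ⟨p₀, u⟩)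
  have hlt : ∀ x ∈ S.filter fun x => ¬ B x, x.1 p₀ < m p₀ := by
    intro x hx
    rw [Finset.mem_filter, hS, Finset.mem_sigma, Fintype.mem_piFinset,
      mem_linearExtensions_shuffleRel] at hx
    have h1 := hx.1.1 p₀
    rw [Finset.mem_range] at h1
    exact ((IsShuffle.not_max_iff (by omega) hm (hinj x.2 p₀) (hx.1.2.2.2 p₀)).1 hx.2).1
  have hpos : ∀ x ∈ S.filter B, ∃ t, x.1 p₀ = t + 1 ∧ t < m p₀ := by
    intro x hx
    obtain ⟨u, hu, -⟩ := (Finset.mem_filter.1 hx).2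
    exact ⟨u, hu.symm, u.2⟩
  -- The matching itself: a term outside `B` with first batch of length t corresponds to a term in
  -- `B` with first batch of length t + 1, the numbering differing by the cycle `π t`.
  have key : ∀ (i : Fin n → ℕ) (f : Expanded m ≃ Fin N) (t : ℕ), i p₀ = t → t < m p₀ →
      ((⟨i, (permNew m p₀ (π t)).trans f⟩ : Σ _ : Fin n → ℕ, Expanded m ≃ Fin N) ∈
        S.filter (fun x => ¬ B x) ↔
      (⟨Function.update i p₀ (t + 1), f⟩ : Σ _ : Fin n → ℕ, Expanded m ≃ Fin N) ∈ S.filter B) := by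
    intro i f t hi ht
    simp only [Finset.mem_filter, hS, Finset.mem_sigma, Fintype.mem_piFinset,
      mem_linearExtensions_shuffleRel]
    have hc := isShuffle_cycle_iff (g := fun s => ((permNew m p₀ (π t)).trans f) (.inr ⟨p₀, s⟩))
      ht (hinj f p₀) (hval t ht) (fun s => by simp)
    have hpi : (∀ p, i p ∈ Finset.range (m p + 1)) ↔
        ∀ p, Function.update i p₀ (t + 1) p ∈ Finset.range (m p + 1) := by
      refine forall_congr' fun p => ?_
      by_cases hp : p = p₀
      · subst hp
        simp only [Function.update_self, Finset.mem_range]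
        omega
      · rw [Function.update_of_ne hp]
    have hroot : (∀ p (s : Fin (m p)), ((permNew m p₀ (π t)).trans f) (.inl p) <
        ((permNew m p₀ (π t)).trans f) (.inr ⟨p, s⟩)) ↔
        ∀ p (s : Fin (m p)), f (.inl p) < f (.inr ⟨p, s⟩) := by
      refine forall_congr' fun p => ?_
      by_cases hp : p = p₀
      · subst hp
        simp only [Equiv.trans_apply, permNew_inl, permNew_inr_self]
        exact (π t).forall_congr_right (q := fun s => f (.inl p) < f (.inr ⟨p, s⟩))
      · simp only [Equiv.trans_apply, permNew_inl, permNew_inr_of_ne _ _ _ hp]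
    have hsplit : ∀ (Q : Fin n → Prop), (∀ p, Q p) ↔ (∀ p, p ≠ p₀ → Q p) ∧ Q p₀ := fun Q =>
      ⟨fun h => ⟨fun p _ => h p, h p₀⟩, fun h p => by
        by_cases hp : p = p₀
        · exact hp ▸ h.2
        · exact h.1 p hp⟩
    have hoff : (∀ p, p ≠ p₀ → IsShuffle (i p) fun s : Fin (m p) =>
        ((permNew m p₀ (π t)).trans f) (.inr ⟨p, s⟩)) ↔
        ∀ p, p ≠ p₀ → IsShuffle (Function.update i p₀ (t + 1) p) fun s : Fin (m p) =>
          f (.inr ⟨p, s⟩) := by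
      refine forall_congr' fun p => forall_congr' fun hp => ?_
      simp only [Equiv.trans_apply, permNew_inr_of_ne _ _ _ hp, Function.update_of_ne hp]
    rw [hsplit fun p => IsShuffle (i p) fun s : Fin (m p) =>
        ((permNew m p₀ (π t)).trans f) (.inr ⟨p, s⟩),
      hsplit fun p => IsShuffle (Function.update i p₀ (t + 1) p) fun s : Fin (m p) =>
        f (.inr ⟨p, s⟩), hoff, hroot, hpi]
    have hB : IsShuffle (i p₀) (fun s => ((permNew m p₀ (π t)).trans f) (.inr ⟨p₀, s⟩)) →
        (¬ B ⟨i, (permNew m p₀ (π t)).trans f⟩ ↔ ∃ u : Fin (m p₀), u.val + 1 = m p₀ ∧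
          ∀ s, ((permNew m p₀ (π t)).trans f) (.inr ⟨p₀, s⟩) ≤
            ((permNew m p₀ (π t)).trans f) (.inr ⟨p₀, u⟩)) := by
      intro h
      refine (IsShuffle.not_max_iff (by omega) hm (hinj _ p₀) h).trans ?_
      exact and_iff_right (by omega)
    have hB' : B ⟨Function.update i p₀ (t + 1), f⟩ ↔ ∃ u : Fin (m p₀), u.val + 1 = t + 1 ∧
          ∀ s, f (.inr ⟨p₀, s⟩) ≤ f (.inr ⟨p₀, u⟩) := by
      simp only [B, Function.update_self]
    rw [hB']
    rw [hi] at hB ⊢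
    rw [Function.update_self]
    simp only [Equiv.trans_apply, permNew_inl] at hB hc ⊢
    constructor
    · rintro ⟨⟨h1, h2, h3, h4, h5⟩, h6⟩
      have := hc.1 ⟨h5, (hB h5).1 h6⟩
      exact ⟨⟨h1, h2, h3, h4, this.1⟩, this.2⟩
    · rintro ⟨⟨h1, h2, h3, h4, h5⟩, h6⟩
      have := hc.2 ⟨h5, h6⟩
      exact ⟨⟨h1, h2, h3, h4, this.1⟩, (hB this.1).2 this.2⟩
  -- Matched terms are opposite: the sign of the cycle to the power d is absorbed by
  -- `signWeight_succ` with s = m p₀ - 1 - t, and the factors at the other points agree.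
  have hterm : ∀ (i : Fin n → ℕ) (f : Expanded m ≃ Fin N) (t : ℕ), i p₀ = t → t < m p₀ →
      (∏ p, signWeight R d (m p - i p)) •
        expansionTerm R d a m w ((permNew m p₀ (π t)).trans f) =
      -((∏ p, signWeight R d (m p - Function.update i p₀ (t + 1) p)) •
        expansionTerm R d a m w f) := by
    intro i f t hi ht
    rw [expansionTerm_permNew hk h, hsign t ht, ← pow_mul, neg_one_units_pow_smul, smul_smul,
      ← neg_smul]
    congr 1
    rw [← Finset.mul_prod_erase _ _ (Finset.mem_univ p₀),
      ← Finset.mul_prod_erase (a := p₀) _ (fun p => signWeight R d (m p - _)) (Finset.mem_univ p₀),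
      mul_right_comm, ← neg_mul, Function.update_self, hi]
    congr 1
    · have h1 : m p₀ - t = m p₀ - 1 - t + 1 := by omega
      have h2 : m p₀ - (t + 1) = m p₀ - 1 - t := by omega
      rw [h1, signWeight_succ, h2]
    · refine Finset.prod_congr rfl fun p hp => ?_
      rw [Function.update_of_ne (Finset.ne_of_mem_erase hp)]
  rw [← Finset.sum_filter_add_sum_filter_not S B, add_comm, ← eq_neg_iff_add_eq_zero,
    ← Finset.sum_neg_distrib]
  refine Finset.sum_bij'
    (fun x _ => ⟨Function.update x.1 p₀ (x.1 p₀ + 1), (permNew m p₀ (π (x.1 p₀)))⁻¹.trans x.2⟩)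
    (fun x _ => ⟨Function.update x.1 p₀ (x.1 p₀ - 1), (permNew m p₀ (π (x.1 p₀ - 1))).trans x.2⟩)
    ?_ ?_ ?_ ?_ ?_
  · rintro ⟨i, f⟩ hx
    refine (key i _ (i p₀) rfl (hlt _ hx)).1 ?_
    convert hx using 2
    ext x
    simp [Equiv.Perm.inv_def]
  · rintro ⟨i, f⟩ hx
    obtain ⟨t, h1, h2⟩ := hpos _ hx
    dsimp only at h1 ⊢
    rw [h1, Nat.add_sub_cancel]
    refine (key _ _ t (by simp) h2).2 ?_
    convert hx using 2
    rw [Function.update_idem, ← h1, Function.update_eq_self]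
  · rintro ⟨i, f⟩ hx
    dsimp only
    rw [Function.update_self, Nat.add_sub_cancel, Function.update_idem, Function.update_eq_self]
    congr 1
    ext x
    simp [Equiv.Perm.inv_def]
  · rintro ⟨i, f⟩ hx
    obtain ⟨t, h1, h2⟩ := hpos _ hx
    dsimp only at h1 ⊢
    rw [Function.update_self, h1, Nat.add_sub_cancel, Function.update_idem, ← h1,
      Function.update_eq_self]
    congr 1
    ext x
    simp [Equiv.Perm.inv_def]
  · rintro ⟨i, f⟩ hx
    rw [← expansionTerm, ← expansionTerm, ← hterm i _ _ rfl (hlt _ hx)]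
    congr 2
    ext x
    simp [Equiv.Perm.inv_def]

/-! ### Composition of expansions -/

/-- The points obtained by two successive expansions. The points of the second expansion come
first. -/
def expandedTwice {P : Type} (i j : P → ℕ) :
    Expanded (expandStars i j) → Expanded fun p => i p + j p
  | .inl (.inl p) => .inl p
  | .inl (.inr x) => .inr ⟨x.1, ⟨i x.1 + x.2.val, Nat.add_lt_add_left x.2.isLt _⟩⟩
  | .inr ⟨.inl p, t⟩ => .inr ⟨p, ⟨t.val, Nat.lt_of_lt_of_le t.isLt (Nat.le_add_right _ _)⟩⟩
  | .inr ⟨.inr _, t⟩ => t.elim0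

theorem expandedTwice_bijective {P : Type} (i j : P → ℕ) :
    Function.Bijective (expandedTwice i j) := by
  constructor
  · rintro ((p | ⟨p, s⟩) | ⟨p | x, s⟩) ((q | ⟨q, t⟩) | ⟨q | y, t⟩) h <;>
      first
        | exact s.elim0
        | exact t.elim0
        | skip
    all_goals simp only [expandedTwice, Sum.inl.injEq, Sum.inr.injEq, reduceCtorEq,
      sigma_fin_eq_iff] at h ⊢
    · exact h
    · obtain ⟨rfl, h⟩ := h
      exact ⟨rfl, by omega⟩
    · obtain ⟨rfl, h⟩ := h
      have h2 : t.val < i p := t.2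
      omega
    · obtain ⟨rfl, h⟩ := h
      have h2 : s.val < i p := s.2
      omega
    · exact h
  · rintro (p | ⟨p, s⟩)
    · exact ⟨.inl (.inl p), rfl⟩
    · by_cases h : s.val < i p
      · exact ⟨.inr ⟨.inl p, ⟨s, h⟩⟩, rfl⟩
      · refine ⟨.inl (.inr ⟨p, ⟨s.val - i p, by have h2 : s.val < i p + j p := s.2; omega⟩⟩), ?_⟩
        simp only [expandedTwice, Sum.inr.injEq, sigma_fin_eq_iff, true_and]
        omega

section
variable {P : Type} {a j : P → ℕ} {p : P} {m : ℕ}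

theorem expand_place_new (h : a p ≤ m ∧ m - a p < j p) :
    expand a j (.place p m) = .pt (.inr ⟨p, ⟨m - a p, h.2⟩⟩) :=
  dif_pos h

theorem expand_place_old (h : ¬ (a p ≤ m ∧ m - a p < j p)) :
    expand a j (.place p m) = .place (.inl p) m :=
  dif_neg h

theorem expand_top_new (h : a p ≤ m ∧ m - a p < j p) :
    expand a j (.top p m) = .chord (.inl p) (.inr ⟨p, ⟨m - a p, h.2⟩⟩) :=
  dif_pos h

theorem expand_top_old (h : ¬ (a p ≤ m ∧ m - a p < j p)) :
    expand a j (.top p m) = .top (.inl p) m :=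
  dif_neg h

end

/-- The first expansion consumes the lowest `j p` asterisks and the second the `i p` asterisks just
above them. Counted from the top, those of the second expansion come first. Points created by the
first expansion have no asterisks to expand. -/
theorem expand_expand {P : Type} (a i j : P → ℕ) (x : Letter P) :
    (expand (expandStars a j) (expandStars i j) (expand (fun p => a p + i p) j x)).map
      (expandedTwice i j) = expand a (fun p => i p + j p) x := by
  cases x with
  | pt p => rfl
  | bot p => rfl
  | chord p q => rfl
  | place p m =>
    by_cases h : a p + i p ≤ m ∧ m - (a p + i p) < j p
    · have h' : a p ≤ m ∧ m - a p < i p + j p := by omega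
      rw [expand_place_new h, expand_place_new h']
      simp only [expand, Letter.map, Letter.relabel, expandedTwice]
      simp only [Letter.pt.injEq, Sum.inr.injEq, sigma_fin_eq_iff, true_and]
      omega
    · rw [expand_place_old h]
      by_cases h2 : a p ≤ m ∧ m - a p < i p
      · have h' : a p ≤ m ∧ m - a p < i p + j p := by omega
        rw [expand_place_new (a := expandStars a j) (p := Sum.inl p) h2, expand_place_new h']
        rfl
      · have h' : ¬ (a p ≤ m ∧ m - a p < i p + j p) := by omega
        rw [expand_place_old (a := expandStars a j) (p := Sum.inl p) h2, expand_place_old h']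
        rfl
  | top p m =>
    by_cases h : a p + i p ≤ m ∧ m - (a p + i p) < j p
    · have h' : a p ≤ m ∧ m - a p < i p + j p := by omega
      rw [expand_top_new h, expand_top_new h']
      simp only [expand, Letter.map, Letter.relabel, expandedTwice]
      simp only [Letter.chord.injEq, Sum.inr.injEq, sigma_fin_eq_iff, true_and]
      omega
    · rw [expand_top_old h]
      by_cases h2 : a p ≤ m ∧ m - a p < i p
      · have h' : a p ≤ m ∧ m - a p < i p + j p := by omega
        rw [expand_top_new (a := expandStars a j) (p := Sum.inl p) h2, expand_top_new h']
        rfl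
      · have h' : ¬ (a p ≤ m ∧ m - a p < i p + j p) := by omega
        rw [expand_top_old (a := expandStars a j) (p := Sum.inl p) h2, expand_top_old h']
        rfl

/-- Each expansion orders its own new points over `p` and imposes nothing between the two batches;
this is the constraint `shuffleRel`. -/
theorem expansion_expand {P : Type} [Fintype P] (r : P → P → Prop) (a i j : P → ℕ)
    (w : List (Letter P)) :
    expansion R d (expandRel r j) (expandStars a j) (expandStars i j)
      (w.map (expand (fun p => a p + i p) j)) =
    extensionSum R d (Fintype.card (Expanded fun p => i p + j p))
      (shuffleRel r i fun p => i p + j p) (expandStars a fun p => i p + j p)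
      (w.map (expand a fun p => i p + j p)) := by
  unfold expansion
  let φ := Equiv.ofBijective _ (expandedTwice_bijective i j)
  refine extensionSum_congr φ (Fintype.card_congr φ) ?_ ?_ ?_
  · rintro ((p | ⟨p, s⟩) | ⟨p | x, s⟩) ((q | ⟨q, t⟩) | ⟨q | y, t⟩) <;>
      first
        | exact s.elim0
        | exact t.elim0
        | skip
    all_goals simp only [φ, Equiv.ofBijective_apply, expandedTwice, expandRel, shuffleRel,
      Sum.inl.injEq, reduceCtorEq]
    · constructor
      · rintro ⟨h1, h2⟩; subst h1; exact ⟨rfl, by omega, by omega⟩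
      · rintro ⟨h1, h2, h3⟩; subst h1; exact ⟨rfl, by omega⟩
    · constructor
      · exact False.elim
      · rintro ⟨h1, h2, h3⟩
        subst h1
        have h2 : t.val < i p := t.2
        omega
    · constructor
      · exact False.elim
      · rintro ⟨h1, h2, h3⟩
        subst h1
        have h2 : s.val < i p := s.2
        omega
    · constructor
      · rintro ⟨h1, h2⟩
        subst h1
        have h3 : t.val < i p := t.2
        exact ⟨rfl, h2, Or.inl h3⟩
      · rintro ⟨h1, h2, h3⟩; exact ⟨h1, h2⟩
  · rintro ((p | x) | ⟨p | x, t⟩)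
    · rfl
    · rfl
    · rfl
    · exact t.elim0
  · rw [List.map_map, List.map_map]
    congr 1
    funext x
    exact expand_expand a i j x

theorem expansionMap_expansion (c : ℕ → R) (hc : c 0 = 1) {n : ℕ} {k j : Fin n → ℕ}
    (hj : ∀ p, j p ≤ k p) {w : Word n} (h : IsOrienting k w) :
    expansionMap R d c (expansion R d (fun p q => p < q) (fun p => k p - j p) j w) =
      ∑ i ∈ Fintype.piFinset fun p => Finset.range (k p - j p + 1), (∏ p, c (i p)) •
        extensionSum R d (Fintype.card (Expanded fun p => i p + j p))
          (shuffleRel (fun p q => p < q) i fun p => i p + j p)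
          (expandStars (fun p => k p - (i p + j p)) fun p => i p + j p)
          (w.map (expand (fun p => k p - (i p + j p)) fun p => i p + j p)) := by
  rw [expansion, expansionMap_extensionSum c rfl _ _ _
    (isOrienting_expand (fun p => (Nat.sub_add_cancel (hj p)).symm) h), expansionWord]
  symm
  -- Multiplicities of the second expansion vanish at the new points, so they are given by their
  -- values on old points. The new points contribute factors `c 0`, which is where `hc` enters.
  refine Finset.sum_bij (fun i _ => expandStars i j) ?_ ?_ ?_ ?_
  · intro i hi
    rw [Fintype.mem_piFinset] at hi ⊢
    rintro (p | x)
    · exact hi p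
    · simp [expandStars]
  · intro i _ i' _ hii
    funext p
    exact congrFun hii (.inl p)
  · intro J hJ
    rw [Fintype.mem_piFinset] at hJ
    refine ⟨fun p => J (.inl p), Fintype.mem_piFinset.2 fun p => hJ (.inl p), ?_⟩
    funext x
    rcases x with p | x
    · rfl
    · have := hJ (.inr x)
      simp only [expandStars, Sum.elim_inr, Finset.mem_range] at this ⊢
      omega
  · intro i hi
    rw [Fintype.mem_piFinset] at hi
    have hi' : ∀ p, i p ≤ k p - j p := fun p => by have := Finset.mem_range.1 (hi p); omega
    rw [← expansion_expand, Fintype.prod_sum_type]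
    simp only [expandStars, Sum.elim_inl, Sum.elim_inr, hc, Finset.prod_const_one, mul_one]
    congr 2
    · funext x
      rcases x with p | x
      · simp only [Sum.elim_inl]; omega
      · rfl
    · congr 2
      funext p
      have := hi' p
      omega

theorem expansionMap_one_expansionMap_signWeight {n : ℕ} {k : Fin n → ℕ} {w : Word n}
    (h : IsOrienting k w) :
    expansionMap R d (fun _ => 1) (expansionMap R d (signWeight R d) (cls R d (ofWord R k w))) =
      cls R d (ofWord R k w) := by
  let T : (Fin n → ℕ) → (Fin n → ℕ) → GenSpace R d := fun i m =>
    extensionSum R d (Fintype.card (Expanded m)) (shuffleRel (fun p q => p < q) i m)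
      (expandStars (fun p => k p - m p) m) (w.map (expand (fun p => k p - m p) m))
  have h1 : expansionMap R d (fun _ => 1)
        (expansionMap R d (signWeight R d) (cls R d (ofWord R k w))) =
      ∑ m ∈ Fintype.piFinset fun p => Finset.range (k p + 1),
        ∑ i ∈ Fintype.piFinset fun p => Finset.range (m p + 1),
          (∏ p, signWeight R d (m p - i p)) • T i m := by
    rw [expansionMap_cls_ofWord _ h, expansionWord, map_sum]
    have : ∀ j ∈ Fintype.piFinset fun p => Finset.range (k p + 1),
        expansionMap R d (fun _ => 1) ((∏ p, signWeight R d (j p)) •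
          expansion R d (fun p q => p < q) (fun p => k p - j p) j w) =
        ∑ i ∈ Fintype.piFinset fun p => Finset.range (k p - j p + 1),
          (∏ p, signWeight R d (j p)) • T i (fun p => i p + j p) := by
      intro j hj
      rw [Fintype.mem_piFinset] at hj
      rw [map_smul, expansionMap_expansion _ rfl (fun p => Nat.le_of_lt_succ (by simpa using hj p)) h,
        Finset.smul_sum]
      refine Finset.sum_congr rfl fun i _ => ?_
      simp [T]
    rw [Finset.sum_congr rfl this, Finset.sum_sigma', Finset.sum_sigma']
    -- Regrouping by the total number m = i + j of new points over each point. The signed weight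
    -- belongs to the first expansion, so it becomes that of m - i.
    refine Finset.sum_bij' (fun x _ => ⟨fun p => x.2 p + x.1 p, x.2⟩)
      (fun x _ => ⟨fun p => x.1 p - x.2 p, x.2⟩) ?_ ?_ ?_ ?_ ?_
    · rintro ⟨j, i⟩ hx
      simp only [Finset.mem_sigma, Fintype.mem_piFinset, Finset.mem_range] at hx ⊢
      exact ⟨fun p => by have := hx.1 p; have := hx.2 p; omega,
        fun p => by have := hx.1 p; have := hx.2 p; omega⟩
    · rintro ⟨j, i⟩ hx
      simp only [Finset.mem_sigma, Fintype.mem_piFinset, Finset.mem_range] at hx ⊢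
      exact ⟨fun p => by have := hx.1 p; have := hx.2 p; omega,
        fun p => by have := hx.1 p; have := hx.2 p; omega⟩
    · rintro ⟨j, i⟩ hx
      simp
    · rintro ⟨m, i⟩ hx
      simp only [Finset.mem_sigma, Fintype.mem_piFinset, Finset.mem_range] at hx
      have : (fun p => i p + (m p - i p)) = m := by
        funext p
        have := hx.2 p
        omega
      simp only [this]
    · rintro ⟨j, i⟩ hx
      simp
  -- Every m that is nonzero somewhere contributes zero by cancellation; m = 0 gives the diagram
  -- itself.
  rw [h1, Finset.sum_eq_single (fun _ => 0)]
  · rw [Finset.sum_eq_single (fun _ => 0)]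
    · simp only [signWeight_zero, Nat.sub_zero, Finset.prod_const_one, one_smul, T]
      rw [← expansion_zero (R := R) (d := d), expansion]
      congr 1
      funext x y
      rcases x with p | x
      · rcases y with q | y
        · rfl
        · exact y.2.elim0
      · exact x.2.elim0
    · intro i hi hne
      refine (hne ?_).elim
      funext p
      simpa using Fintype.mem_piFinset.1 hi p
    · intro hn
      simp at hn
  · intro m hm hne
    obtain ⟨p₀, hp⟩ := Function.ne_iff.1 hne
    refine sum_shuffles_eq_zero (k := k) ?_ h (p₀ := p₀) (Nat.pos_of_ne_zero hp)
    intro p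
    have := Fintype.mem_piFinset.1 hm p
    rw [Finset.mem_range] at this
    omega
  · intro hn
    simp at hn

/-! ### Bijectivity -/

theorem genSpace_induction {p : GenSpace R d → Prop} (x : GenSpace R d) (h0 : p 0)
    (hadd : ∀ x y, p x → p y → p (x + y))
    (hsmul : ∀ (c : R) (n : ℕ) (D : Diagram n), p (c • D.cls R d)) : p x := by
  obtain ⟨y, rfl⟩ := Submodule.Quotient.mk_surjective _ x
  induction y using Finsupp.induction_linear with
  | zero => exact h0
  | add y z hy hz => exact hadd _ _ hy hz
  | single D c =>
    have := hsmul c D.1 D.2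
    rw [Diagram.cls, ← map_smul, Finsupp.smul_single_one] at this
    exact this

theorem genSpace_hom_ext {M : Type*} [AddCommGroup M] [Module R M] {f g : GenSpace R d →ₗ[R] M}
    (h : ∀ (n : ℕ) (D : Diagram n), f (D.cls R d) = g (D.cls R d)) : f = g := by
  refine LinearMap.ext fun x => ?_
  induction x using genSpace_induction with
  | h0 => simp
  | hadd x y hx hy => rw [map_add, map_add, hx, hy]
  | hsmul c n D => rw [map_smul, map_smul, h]

theorem expansionMap_one_comp_signWeight :
    (expansionMap R d (fun _ => 1)) ∘ₗ (expansionMap R d (signWeight R d)) = LinearMap.id := by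
  refine genSpace_hom_ext fun n D => ?_
  rw [← cls_ofWord]
  exact expansionMap_one_expansionMap_signWeight D.isOrienting

/-- The span of the diagrams with fewer than `s` top asterisks. -/
def starFiltration (R : Type*) [CommRing R] (d s : ℕ) : Submodule R (GenSpace R d) :=
  Submodule.span R {x | ∃ (n : ℕ) (k : Fin n → ℕ) (w : Word n), IsOrienting k w ∧
    ∑ p, k p < s ∧ x = cls R d (ofWord R k w)}

theorem expansion_mem_starFiltration {n : ℕ} {k j : Fin n → ℕ} (hj : ∀ p, j p ≤ k p) {w : Word n}
    (h : IsOrienting k w) {s : ℕ} (hs : ∑ p, (k p - j p) < s) :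
    expansion R d (fun p q => p < q) (fun p => k p - j p) j w ∈ starFiltration R d s := by
  refine Submodule.sum_mem _ fun e _ => Submodule.subset_span ⟨_, _, _,
    isOrienting_expand (fun p => (Nat.sub_add_cancel (hj p)).symm) h e, ?_, rfl⟩
  rw [Equiv.sum_comp e.symm, Fintype.sum_sum_type]
  simpa [expandStars] using hs

/-- The expansion with j = 0 is the diagram itself, and any other one loses at least one asterisk:
the map is unipotent for the filtration. -/
theorem expansionMap_sub_mem_starFiltration {s : ℕ} {x : GenSpace R d}
    (hx : x ∈ starFiltration R d (s + 1)) :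
    expansionMap R d (fun _ => 1) x - x ∈ starFiltration R d s := by
  induction hx using Submodule.span_induction with
  | zero => simp
  | add x y _ _ hx hy =>
    rw [map_add, add_sub_add_comm]
    exact add_mem hx hy
  | smul c x _ hx =>
    rw [map_smul, ← smul_sub]
    exact Submodule.smul_mem _ _ hx
  | mem x hx =>
    obtain ⟨n, k, w, h, hs, rfl⟩ := hx
    have h0 : (fun _ => 0 : Fin n → ℕ) ∈ Fintype.piFinset fun p => Finset.range (k p + 1) := by
      simp
    rw [expansionMap_cls_ofWord _ h, expansionWord, ← Finset.add_sum_erase _ _ h0]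
    simp only [Finset.prod_const_one, one_smul, Nat.sub_zero]
    rw [expansion_zero, add_sub_cancel_left]
    refine Submodule.sum_mem _ fun j hj => ?_
    obtain ⟨hne, hj⟩ := Finset.mem_erase.1 hj
    obtain ⟨p₀, hp⟩ := Function.ne_iff.1 hne
    have hj' : ∀ p, j p ≤ k p := fun p => by
      have := Finset.mem_range.1 (Fintype.mem_piFinset.1 hj p)
      omega
    refine expansion_mem_starFiltration hj' h ?_
    refine lt_of_lt_of_le (Finset.sum_lt_sum (fun p _ => Nat.sub_le _ _)
      ⟨p₀, Finset.mem_univ _, ?_⟩) (Nat.le_of_lt_succ hs)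
    have := hj' p₀
    omega

theorem starFiltration_mono {s t : ℕ} (h : s ≤ t) : starFiltration R d s ≤ starFiltration R d t := by
  refine Submodule.span_mono ?_
  rintro x ⟨n, k, w, h1, h2, h3⟩
  exact ⟨n, k, w, h1, lt_of_lt_of_le h2 h, h3⟩

theorem exists_mem_starFiltration (x : GenSpace R d) : ∃ s, x ∈ starFiltration R d s := by
  induction x using genSpace_induction with
  | h0 => exact ⟨0, zero_mem _⟩
  | hadd x y hx hy =>
    obtain ⟨s, hs⟩ := hx
    obtain ⟨t, ht⟩ := hy
    exact ⟨max s t, add_mem (starFiltration_mono (le_max_left _ _) hs)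
      (starFiltration_mono (le_max_right _ _) ht)⟩
  | hsmul c n D =>
    refine ⟨∑ p, D.stars p + 1, Submodule.smul_mem _ _ (Submodule.subset_span ?_)⟩
    exact ⟨n, D.stars, D.word, D.isOrienting, Nat.lt_succ_self _, (cls_ofWord D).symm⟩

/-- If x is in the kernel, then -x is its image minus x, which lies one step lower in the
filtration. Descending, x lies in step 0, which is zero. -/
theorem expansionMap_one_injective : Function.Injective (expansionMap R d fun _ => 1) := by
  rw [← LinearMap.ker_eq_bot, LinearMap.ker_eq_bot']
  have key : ∀ (s : ℕ) (x : GenSpace R d), x ∈ starFiltration R d s →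
      expansionMap R d (fun _ => 1) x = 0 → x = 0 := by
    intro s
    induction s with
    | zero =>
      intro x hx _
      simpa [starFiltration] using hx
    | succ s ih =>
      intro x hx h0
      refine ih x ?_ h0
      have := expansionMap_sub_mem_starFiltration hx
      rwa [h0, zero_sub, neg_mem_iff] at this
  intro x hx
  obtain ⟨s, hs⟩ := exists_mem_starFiltration x
  exact key s x hs hx

/-- An injective map with a right inverse is inverted by it on both sides. -/
theorem expansionMap_signWeight_comp_one :
    (expansionMap R d (signWeight R d)) ∘ₗ (expansionMap R d (fun _ => 1)) = LinearMap.id := by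
  refine LinearMap.ext fun x => expansionMap_one_injective ?_
  exact LinearMap.congr_fun expansionMap_one_comp_signWeight (expansionMap R d (fun _ => 1) x)

/-! ### The space of diagrams -/

theorem expansionMap_mem_space (c : ℕ → R) {x : GenSpace R d} (hx : x ∈ Space R d) :
    expansionMap R d c x ∈ Space R d := by
  induction hx using Submodule.span_induction with
  | zero => simp
  | add x y _ _ hx hy =>
    rw [map_add]
    exact add_mem hx hy
  | smul c x _ hx =>
    rw [map_smul]
    exact Submodule.smul_mem _ _ hx
  | mem x hx =>
    obtain ⟨n, D, hD, rfl⟩ := hx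
    rw [expansionMap_cls]
    refine Submodule.sum_mem _ fun j hj => Submodule.smul_mem _ _ <| Submodule.sum_mem _ fun e _ => ?_
    have hj' : ∀ p, j p ≤ D.stars p := fun p => by
      have := Finset.mem_range.1 (Fintype.mem_piFinset.1 hj p)
      omega
    have ho := isOrienting_expand (fun p => (Nat.sub_add_cancel (hj' p)).symm) D.isOrienting e
    refine Submodule.subset_span ⟨_, ⟨_, _, ho⟩, ?_, cls_ofWord ⟨_, _, ho⟩⟩
    have hchord : ∀ z : Σ p, Fin (j p), Letter.chord (e (.inl z.1)) (e (.inr z)) ∈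
        (D.word.map (expand (fun p => D.stars p - j p) j)).map (Letter.map e) := by
      intro z
      rw [map_map_mem]
      simp only [Letter.map, Letter.relabel, Equiv.symm_apply_apply]
      refine mem_map_expand_chord.2 (Or.inr ⟨z, rfl, rfl, (D.isOrienting.top_mem _ _).2 ?_⟩)
      have := z.2.2
      have := hj' z.1
      omega
    intro y
    obtain ⟨x, rfl⟩ := e.surjective y
    dsimp only
    rw [Equiv.symm_apply_apply]
    rcases x with p | z
    · rcases hD p with h | h | ⟨q, h⟩
      -- Either an asterisk over p survives, or all of them, at least one, have become chords at p.
      · by_cases hp : j p < D.stars p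
        · left
          simp only [expandStars, Sum.elim_inl]
          omega
        · exact Or.inr (Or.inr ⟨_, Or.inl (hchord ⟨p, ⟨0, by omega⟩⟩)⟩)
      · exact Or.inr (Or.inl (List.mem_map_of_mem (f := Letter.map e)
          (List.mem_map_of_mem (f := expand _ j) h)))
      · refine Or.inr (Or.inr ⟨e (.inl q), h.imp (fun h => ?_) fun h => ?_⟩) <;>
        exact (List.mem_map_of_mem (f := Letter.map e) (List.mem_map_of_mem (f := expand _ j) h))
    · exact Or.inr (Or.inr ⟨_, Or.inr (hchord z)⟩)

/-- The linear automorphism `∑_j expansion_j`. -/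
def expansionEquiv (R : Type*) [CommRing R] (d : ℕ) : GenSpace R d ≃ₗ[R] GenSpace R d :=
  LinearEquiv.ofLinearMap (expansionMap R d fun _ => 1) (expansionMap R d (signWeight R d))
    expansionMap_one_comp_signWeight expansionMap_signWeight_comp_one

theorem map_expansionMap_one_space :
    (Space R d).map (expansionMap R d fun _ => 1) = Space R d := by
  refine le_antisymm (Submodule.map_le_iff_le_comap.2 fun x hx => expansionMap_mem_space _ hx) ?_
  intro x hx
  exact ⟨_, expansionMap_mem_space (signWeight R d) hx,
    LinearMap.congr_fun expansionMap_one_comp_signWeight x⟩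

/-! ### Sorting orienting monomials -/

section Sorting
variable {α : Type*} [LinearOrder α] {X : Type*} (rk : X → α)

/-- A sorted list is the concatenation of its sublists of constant rank. -/
theorem eq_of_sorted_of_filter_eq :
    ∀ l l' : List X, (l.Pairwise fun x y => rk x ≤ rk y) → (l'.Pairwise fun x y => rk x ≤ rk y) →
      (∀ v, l.filter (fun x => rk x = v) = l'.filter fun x => rk x = v) → l = l'
  | [], [], _, _, _ => rfl
  | [], y :: l', _, _, h => by simpa using h (rk y)
  | x :: l, [], _, _, h => by simpa using h (rk x)
  | x :: l, y :: l', hl, hl', h => by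
    rw [List.pairwise_cons] at hl hl'
    have hmem : ∀ z, z ∈ x :: l ↔ z ∈ y :: l' := by
      intro z
      have h1 : z ∈ (x :: l).filter (fun t => rk t = rk z) ↔
          z ∈ (y :: l').filter fun t => rk t = rk z := by rw [h]
      simpa using h1
    -- Both lists have the same elements, and each head has the least rank among them.
    have hxy : rk x = rk y := by
      apply le_antisymm
      · rcases List.mem_cons.1 ((hmem y).2 (by simp)) with h1 | h1
        · rw [h1]
        · exact hl.1 _ h1
      · rcases List.mem_cons.1 ((hmem x).1 (by simp)) with h1 | h1
        · rw [h1]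
        · exact hl'.1 _ h1
    have h0 := h (rk x)
    simp only [List.filter_cons, hxy, decide_true, if_true, List.cons.injEq] at h0
    obtain ⟨rfl, -⟩ := h0
    congr 1
    refine eq_of_sorted_of_filter_eq l l' hl.2 hl'.2 fun v => ?_
    have := h v
    simp only [List.filter_cons] at this
    split_ifs at this
    · exact (List.cons.inj this).2
    · exact this

theorem filter_orderedInsert (x : X) (v : α) (l : List X) :
    (l.orderedInsert (fun a b => rk a ≤ rk b) x).filter (fun a => rk a = v) =
      (x :: l).filter fun a => rk a = v := by
  induction l with
  | nil => rfl
  | cons y l ih =>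
    rw [List.orderedInsert_cons]
    split_ifs with h
    · rfl
    · rw [List.filter_cons, ih, List.filter_cons, List.filter_cons (x := x), List.filter_cons]
      have : ¬ (rk y = v ∧ rk x = v) := fun h' => h (by rw [h'.1, h'.2])
      by_cases h1 : rk y = v <;> by_cases h2 : rk x = v <;> simp_all

/-- Stability of the sort: letters of equal rank keep their order. It matters because chords and
bottom asterisks share one rank. -/
theorem filter_insertionSort (v : α) (l : List X) :
    (l.insertionSort fun a b => rk a ≤ rk b).filter (fun a => rk a = v) =
      l.filter fun a => rk a = v := by
  induction l with
  | nil => rfl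
  | cons x l ih =>
    rw [List.insertionSort_cons, filter_orderedInsert, List.filter_cons, ih, List.filter_cons]

theorem pairwise_insertionSort_rank (l : List X) :
    (l.insertionSort fun a b => rk a ≤ rk b).Pairwise fun a b => rk a ≤ rk b := by
  have : Std.Total (fun a b : X => rk a ≤ rk b) := ⟨fun a b => le_total _ _⟩
  have : IsTrans X (fun a b : X => rk a ≤ rk b) := ⟨fun a b c => le_trans⟩
  exact List.pairwise_insertionSort _ l

variable (dg : X → ℤ) {M : Type*} [AddCommGroup M] (Φ : List X → M)

theorem apply_cons_eq_orderedInsert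
    (hΦ : ∀ u v x y, Φ (u ++ x :: y :: v) = (dg x * dg y).negOnePow • Φ (u ++ y :: x :: v))
    (x : X) (l : List X) (hl : l.Pairwise fun a b => rk a ≤ rk b) : ∀ u : List X,
      Φ (u ++ x :: l) =
        ((l.filter fun y => rk y < rk x).map fun y => (dg x * dg y).negOnePow).prod •
          Φ (u ++ l.orderedInsert (fun a b => rk a ≤ rk b) x) := by
  induction l with
  | nil => intro u; simp
  | cons y l ih =>
    intro u
    rw [List.pairwise_cons] at hl
    rw [List.orderedInsert_cons]
    split_ifs with h
    · rw [List.filter_eq_nil_iff.2]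
      · simp
      · intro z hz
        rw [decide_eq_true_eq, not_lt]
        rcases List.mem_cons.1 hz with rfl | hz
        · exact h
        · exact h.trans (hl.1 _ hz)
    · have h1 := ih hl.2 (u ++ [y])
      simp only [List.append_assoc, List.cons_append, List.nil_append] at h1
      rw [hΦ, h1, List.filter_cons, if_pos (by simpa using h), List.map_cons, List.prod_cons,
        mul_smul]

/-- Insertion sort uses adjacent exchanges only, and inserting `x` moves it past exactly the letters
of smaller rank. These are the factors collected by `sortSign`. -/
theorem apply_eq_sortSign_smul
    (hΦ : ∀ u v x y, Φ (u ++ x :: y :: v) = (dg x * dg y).negOnePow • Φ (u ++ y :: x :: v))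
    (l : List X) : ∀ u : List X, Φ (u ++ l) = sortSign (l.map fun x => (rk x, dg x)) •
      Φ (u ++ l.insertionSort fun a b => rk a ≤ rk b) := by
  induction l with
  | nil => intro u; simp [sortSign]
  | cons x l ih =>
    intro u
    have h1 := ih (u ++ [x])
    simp only [List.append_assoc, List.cons_append, List.nil_append] at h1
    rw [h1, apply_cons_eq_orderedInsert rk dg Φ hΦ x _ (pairwise_insertionSort_rank rk l),
      List.insertionSort_cons, smul_smul, List.map_cons, sortSign, mul_comm]
    congr 2
    rw [List.filter_map, List.map_map]
    exact (((List.perm_insertionSort _ l).filter _).map _).prod_eq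

end Sorting

/-- The normal form `t_1 (α^*_1^1 a_1^1) … t_2 (α^*_2^1 a_2^1) … (chords and bottom asterisks)`. -/
def normalForm {n : ℕ} (k : Fin n → ℕ) (w : Word n) : Word n :=
  (List.ofFn fun p => (zWord (k p)).map (Letter.map fun _ => p)).flatten ++
    w.filter Letter.isBottom

theorem map_zWord {n : ℕ} (k : ℕ) (p : Fin n) : (zWord k).map (Letter.map fun _ => p) =
    Letter.pt p :: (List.range k).flatMap fun j => [Letter.top p j, Letter.place p j] := by
  simp [zWord, List.map_flatMap, Letter.map, Letter.relabel]

theorem pairwise_flatten_zWord {n : ℕ} (k : Fin n → ℕ) :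
    (List.ofFn fun p => (zWord (k p)).map (Letter.map fun _ => p)).flatten.Pairwise
      fun x y : Letter (Fin n) => x.rank < y.rank := by
  simp only [map_zWord]
  rw [List.pairwise_flatten]
  constructor
  · intro l hl
    obtain ⟨p, rfl⟩ := (List.mem_ofFn' _ _).1 hl
    rw [List.pairwise_cons, List.pairwise_flatMap]
    refine ⟨?_, ?_, ?_⟩
    · intro x hx
      simp only [List.mem_flatMap, List.mem_range, List.mem_cons, List.not_mem_nil, or_false] at hx
      obtain ⟨j, -, rfl | rfl⟩ := hx <;> simp [Letter.rank, Prod.Lex.toLex_lt_toLex]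
    · intro j _
      simp [Letter.rank, Prod.Lex.toLex_lt_toLex]
    · refine List.pairwise_lt_range.imp fun {i j} hij x hx y hy => ?_
      simp only [List.mem_cons, List.not_mem_nil, or_false] at hx hy
      rcases hx with rfl | rfl <;> rcases hy with rfl | rfl <;>
        simp only [Letter.rank, Prod.Lex.toLex_lt_toLex, lt_self_iff_false, true_and, false_or] <;>
        omega
  · rw [List.pairwise_ofFn]
    intro p q hpq x hx y hy
    have key : ∀ (p : Fin n) (x : Letter (Fin n)), x ∈ (Letter.pt p ::
        (List.range (k p)).flatMap fun j => [Letter.top p j, Letter.place p j]) →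
        ∃ i, x.rank = toLex (p.val, i) := by
      intro p x hx
      simp only [List.mem_cons, List.mem_flatMap, List.mem_range, List.not_mem_nil, or_false] at hx
      obtain rfl | ⟨j, -, rfl | rfl⟩ := hx <;> exact ⟨_, rfl⟩
    obtain ⟨i, hi⟩ := key p x hx
    obtain ⟨i', hi'⟩ := key q y hy
    rw [hi, hi', Prod.Lex.toLex_lt_toLex]
    exact Or.inl hpq

theorem mem_flatten_zWord {n : ℕ} {k : Fin n → ℕ} {w : Word n} (h : IsOrienting k w)
    {x : Letter (Fin n)} :
    x ∈ (List.ofFn fun p => (zWord (k p)).map (Letter.map fun _ => p)).flatten ↔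
      x ∈ w ∧ x.isBottom = false := by
  simp only [map_zWord, List.mem_flatten, List.mem_ofFn', Set.mem_range,
    exists_exists_eq_and, List.mem_cons, List.mem_flatMap, List.mem_range,
    List.not_mem_nil, or_false]
  cases x <;> simp [Letter.isBottom, h.pt_mem, h.place_mem, h.top_mem]

/-- Both lists are sorted, so it suffices to compare them rank by rank. -/
theorem insertionSort_eq_normalForm {n : ℕ} {k : Fin n → ℕ} {w : Word n} (h : IsOrienting k w) :
    (w.insertionSort fun a b => a.rank ≤ b.rank) = normalForm k w := by
  have hpw := pairwise_flatten_zWord k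
  have hlt : ∀ x ∈ (List.ofFn fun p => (zWord (k p)).map (Letter.map fun _ => p)).flatten,
      ∀ y : Letter (Fin n), y.isBottom = true → x.rank < y.rank := by
    intro x hx y hy
    rw [rank_isBottom hy]
    have := ((mem_flatten_zWord h).1 hx).2
    cases x <;> simp [Letter.isBottom, Letter.rank, Prod.Lex.toLex_lt_toLex] at this ⊢
  have hperm : (normalForm k w).Perm w := by
    rw [List.perm_ext_iff_of_nodup _ h.nodup]
    · intro x
      rw [normalForm, List.mem_append, mem_flatten_zWord h, List.mem_filter]
      cases x.isBottom <;> simp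
    · rw [normalForm, List.nodup_append]
      refine ⟨hpw.imp fun hxy he => hxy.ne (by rw [he]), h.nodup.filter _, ?_⟩
      intro x hx y hy he
      exact (hlt x hx y (List.mem_filter.1 hy).2).ne (by rw [he])
  refine eq_of_sorted_of_filter_eq Letter.rank _ _ (pairwise_insertionSort_rank _ _) ?_ fun v => ?_
  · rw [normalForm, List.pairwise_append]
    refine ⟨hpw.imp le_of_lt, ?_, fun x hx y hy => (hlt x hx y (List.mem_filter.1 hy).2).le⟩
    refine List.pairwise_of_forall_mem_list fun x hx y hy => ?_
    rw [rank_isBottom (List.mem_filter.1 hx).2, rank_isBottom (List.mem_filter.1 hy).2]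
  · rw [filter_insertionSort]
    have hp := (hperm.filter fun a => a.rank = v).symm
    -- Only the rank of chords and bottom asterisks is shared by different letters, and there
    -- stability gives the order of `w`. For any other rank all letters are equal, so a permutation
    -- is an equality.
    by_cases hb : ∃ y ∈ w, y.isBottom = true ∧ y.rank = v
    · obtain ⟨y, -, hy, rfl⟩ := hb
      have hiff : ∀ x ∈ w, (decide (x.rank = y.rank)) = x.isBottom := by
        intro x hx
        by_cases hxb : x.isBottom = true
        · rw [hxb, rank_isBottom hxb, rank_isBottom hy]
          simp
        · rw [Bool.not_eq_true] at hxb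
          rw [hxb, decide_eq_false_iff_not]
          exact (hlt x ((mem_flatten_zWord h).2 ⟨hx, hxb⟩) y hy).ne
      have hnil : (List.ofFn fun p => (zWord (k p)).map (Letter.map fun _ => p)).flatten.filter
          (fun x => x.rank = y.rank) = [] := by
        rw [List.filter_eq_nil_iff]
        intro x hx
        rw [decide_eq_true_eq]
        exact (hlt x hx y hy).ne
      rw [List.filter_congr hiff, normalForm, List.filter_append, hnil, List.nil_append,
        List.filter_filter]
      refine List.filter_congr fun x hx => ?_
      rw [hiff x hx, Bool.and_self]
    · push Not at hb
      have hall : ∀ x ∈ w.filter (fun a => a.rank = v), ∀ y ∈ w.filter (fun a => a.rank = v),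
          x = y := by
        intro x hx y hy
        simp only [List.mem_filter, decide_eq_true_eq] at hx hy
        exact (rank_eq_rank (hx.2.trans hy.2.symm)).resolve_right fun hbb => hb x hx.1 hbb.1 hx.2
      revert hp hall
      generalize w.filter (fun a => a.rank = v) = l
      intro hp hall
      cases l with
      | nil => exact (List.nil_perm.1 hp).symm
      | cons x l =>
        have h1 : x :: l = List.replicate (l.length + 1) x :=
          List.eq_replicate_iff.2 ⟨rfl, fun y hy => hall y hy x (by simp)⟩
        rw [h1] at hp ⊢
        exact List.replicate_perm.1 hp

theorem expansion_eq_normalForm {n : ℕ} {k : Fin n → ℕ} {w : Word n} (h : IsOrienting k w)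
    (r : Fin n → Fin n → Prop) (a j : Fin n → ℕ) :
    expansion R d r a j w = normalSign d w • expansion R d r a j (normalForm k w) := by
  have := apply_eq_sortSign_smul (M := GenSpace R d) Letter.rank (Letter.deg d)
    (fun l => expansion R d r a j l) ?_ w []
  · rw [insertionSort_eq_normalForm h] at this
    exact this
  · intro u v x y
    simp only [expansion, List.map_append, List.map_cons]
    rw [extensionSum_swap, deg_expand, deg_expand]

/-! ### The diagrams `Z_a ⊨ Ẑ_i` -/

/-- The active points of `Z_a ⊨ Ẑ_i`. -/
def starPoints (i : ℕ) : Expanded (fun _ : Fin 1 => i) ≃ Fin (i + 1) where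
  toFun := Sum.elim (fun _ => 0) fun x => x.2.succ
  invFun := Fin.cases (.inl 0) fun s => .inr ⟨0, s⟩
  left_inv := by
    rintro (p | ⟨p, s⟩)
    · simp [Subsingleton.elim p 0]
    · obtain rfl : p = 0 := Subsingleton.elim _ _
      simp
  right_inv := by
    intro x
    refine Fin.cases ?_ (fun s => ?_) x <;> simp

/-- The diagram `Z_a ⊨ Ẑ_i`: a point with `a` top asterisks, and chords from it to `i` points to the
right of it. -/
def starDiagram (a i : ℕ) : Diagram (i + 1) :=
  ⟨_, _, isOrienting_expand (k := fun _ => a + i) (a := fun _ => a) (j := fun _ => i)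
    (fun _ => rfl) (isOrienting_zWord (a + i)) (starPoints i)⟩

theorem starDiagram_word (a i : ℕ) : (starDiagram a i).word =
    Letter.pt 0 :: (((List.range a).flatMap fun j => [Letter.top 0 j, Letter.place 0 j]) ++
      (List.finRange i).flatMap fun j => [Letter.chord 0 j.succ, Letter.pt j.succ]) := by
  change ((zWord (a + i)).map _).map _ = _
  rw [zWord, List.map_cons, List.map_cons, List.range_add, List.flatMap_append, List.map_append,
    List.map_append]
  congr 2
  · rw [List.map_flatMap, List.map_flatMap]
    refine List.flatMap_congr fun m hm => ?_
    have hm : ¬ (a ≤ m ∧ m - a < i) := by have := List.mem_range.1 hm; omega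
    simp [expand, hm, Letter.map, Letter.relabel, starPoints]
  · rw [List.flatMap_map, List.map_flatMap, List.map_flatMap, ← List.map_coe_finRange_eq_range,
      List.flatMap_map]
    refine List.flatMap_congr fun m hm => ?_
    simp [expand, Letter.map, Letter.relabel, starPoints]

/-- Needed because gluing `Z a` to `Zhat i` yields 0 + i + 1 points rather than i + 1. -/
theorem ofWord_cast {n m : ℕ} (h : n = m) (k : Fin n → ℕ) (w : Word n) :
    ofWord R k w = ofWord R (fun x => k (Fin.cast h.symm x)) (w.map (Letter.map (Fin.cast h))) := by
  subst h
  congr 1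
  conv_lhs => rw [← List.map_id w]
  congr 1
  funext x
  cases x <;> rfl

theorem eq_cast_of_strictMono {n m : ℕ} (h : n = m) {f : Fin n → Fin m} (hf : StrictMono f) :
    f = Fin.cast h := by
  subst h
  have h : hf.orderIsoOfSurjective f (Finite.surjective_of_injective hf.injective) =
      OrderIso.refl _ := Subsingleton.elim _ _
  funext x
  exact congrArg (fun e : Fin n ≃o Fin n => e x) h

/-- The first diagram consists of its left-most point alone, so there is nothing to shuffle. -/
theorem mem_gluings_zero {i : ℕ} {s : (Fin (0 + 1) → Fin (0 + i + 1)) × (Fin (i + 1) → Fin (0 + i + 1))} :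
    s ∈ gluings 0 i ↔ s = (fun _ => 0, Fin.cast (by omega)) := by
  have hi : i + 1 = 0 + i + 1 := by omega
  constructor
  · rintro ⟨h1, h2, h3, h4⟩
    have h5 := eq_cast_of_strictMono hi h2
    refine Prod.ext (funext fun x => ?_) h5
    have hx : x = 0 := Fin.ext (by omega)
    rw [hx, h3, h5]
    rfl
  · rintro rfl
    refine ⟨fun x y h => absurd (Fin.lt_def.1 h) (by omega), Fin.cast_strictMono hi, rfl, ?_⟩
    rw [Set.eq_univ_iff_forall]
    exact fun x => Or.inr ⟨Fin.cast hi.symm x, rfl⟩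

theorem mem_shuffles_zero {k l : ℕ} (hl : l = 0)
    {s : (Fin k → Fin (k + l)) × (Fin l → Fin (k + l))} :
    s ∈ shuffles k l ↔ s = (Fin.castAdd l, Fin.natAdd k) := by
  subst hl
  constructor
  · rintro ⟨h1, h2, h3⟩
    exact Prod.ext (eq_cast_of_strictMono rfl h1) (Subsingleton.elim _ _)
  · rintro rfl
    refine ⟨strictMono_id, Subsingleton.strictMono _, ?_⟩
    rw [Set.eq_univ_iff_forall]
    exact fun x => Or.inl ⟨x, rfl⟩

theorem rootSign_eq_one {n : ℕ} {w : Word n} {x : Letter (Fin n)} (hx : x.rootRank = 0)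
    (hw : ∀ y ∈ w, y.rootRank = 1) : rootSign d (x :: w) = 1 := by
  apply sortSign_eq_one
  rw [List.pairwise_map, List.pairwise_cons]
  refine ⟨fun y _ => by simp [hx], List.pairwise_of_forall_mem_list fun y hy z hz => ?_⟩
  simp [hw y hy, hw z hz]

theorem filter_rootRank {n : ℕ} {w : Word n} {x : Letter (Fin n)} (hx : x.rootRank = 0)
    (hw : ∀ y ∈ w, y.rootRank = 1) : ((x :: w).filter fun y => y.rootRank ≠ 0) = w := by
  rw [List.filter_cons, if_neg (by simp [hx]), List.filter_eq_self]
  intro y hy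
  simp [hw y hy]

/-- Z_a has no further points and Ẑ_i has no asterisks, so both shuffles are trivial. The monomials
already begin with the left-most point, so the signs are 1. -/
theorem glue_Z_Zhat (a i : ℕ) :
    glue R d (Z a) (Zhat i) = Finsupp.single ⟨i + 1, starDiagram a i⟩ 1 := by
  classical
  have h1 : (gluings 0 i).toFinset = {(fun _ => 0, Fin.cast (by omega))} := by
    ext s
    rw [Set.mem_toFinset, mem_gluings_zero, Finset.mem_singleton]
  have hz : ∀ y ∈ (List.range a).flatMap fun j =>
      [(Letter.top 0 j : Letter (Fin (0 + 1))), Letter.place 0 j], y.rootRank = 1 := by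
    intro y hy
    simp only [List.mem_flatMap, List.mem_cons, List.not_mem_nil, or_false] at hy
    obtain ⟨j, -, rfl | rfl⟩ := hy <;> rfl
  have hzh : ∀ y ∈ (List.finRange i).flatMap fun j =>
      [(Letter.chord 0 j.succ : Letter (Fin (i + 1))), Letter.pt j.succ], y.rootRank = 1 := by
    intro y hy
    simp only [List.mem_flatMap, List.mem_cons, List.not_mem_nil, or_false] at hy
    obtain ⟨j, -, rfl | rfl⟩ := hy <;> rfl
  have hs : Finsupp.single (⟨i + 1, starDiagram a i⟩ : Σ n, Diagram n) (1 : R) =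
      ofWord R (starDiagram a i).stars (starDiagram a i).word := by
    rw [ofWord, dif_pos (starDiagram a i).isOrienting]
  have h2 : (shuffles ((Z a).stars 0) ((Zhat i).stars 0)).toFinset =
      {(Fin.castAdd _, Fin.natAdd _)} := by
    ext s
    rw [Set.mem_toFinset, Finset.mem_singleton]
    exact mem_shuffles_zero rfl
  have hi : i + 1 = 0 + i + 1 := by omega
  rw [glue, h1, Finset.sum_singleton, h2, Finset.sum_singleton]
  have hw : (Z a).word = Letter.pt 0 :: (List.range a).flatMap fun j =>
      [(Letter.top 0 j : Letter (Fin (0 + 1))), Letter.place 0 j] := rfl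
  have hwh : (Zhat i).word = Letter.pt 0 :: (List.finRange i).flatMap fun j =>
      [(Letter.chord 0 j.succ : Letter (Fin (i + 1))), Letter.pt j.succ] := rfl
  rw [hw, hwh, rootSign_eq_one rfl hz, rootSign_eq_one rfl hzh, filter_rootRank rfl hz,
    filter_rootRank rfl hzh, one_mul, one_smul, hs, ofWord_cast hi, starDiagram_word]
  congr 1
  · funext x
    obtain ⟨x, rfl⟩ : ∃ y, Fin.cast hi y = x := ⟨Fin.cast hi.symm x, rfl⟩
    have hst : ∀ y, (starDiagram a i).stars y = if y = 0 then a else 0 := by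
      intro y
      refine Fin.cases ?_ (fun s => ?_) y
      · rfl
      · rw [if_neg (Fin.succ_ne_zero s)]; rfl
    have hz1 : ∀ p, (Z a).stars p = a := fun _ => rfl
    have hz2 : ∀ p, (Zhat i).stars p = 0 := fun _ => rfl
    have hx : (0 : Fin (0 + i + 1)) = Fin.cast hi x ↔ Fin.cast hi.symm (Fin.cast hi x) = 0 := by
      rw [Fin.ext_iff, Fin.ext_iff]
      exact eq_comm
    simp only [hst, hz1, hz2, ite_self, Finset.sum_const_zero, add_zero, ← hx]
    exact Fin.sum_univ_one _
  · simp only [List.map_cons, List.map_append, List.map_flatMap, List.map_nil]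
    have h0 : ∀ h, (Fin.cast h (0 : Fin (i + 1)) : Fin (0 + i + 1)) = 0 := fun _ => rfl
    have hr : ∀ j ∈ List.range a, rootStars (m := 0)
        (Fin.castAdd ((Zhat i).stars 0) : Fin ((Z a).stars 0) → _) 0 j = j := by
      intro j hj
      have hj : j < (Z a).stars 0 := List.mem_range.1 hj
      rw [rootStars, dif_pos ⟨rfl, hj⟩]
      rfl
    simp only [Letter.map, Letter.relabel, h0]
    congr 2
    refine List.flatMap_congr fun j hj => ?_
    rw [hr j hj]

/-! ### The bracket as a sum over linear extensions -/

/-- The constraints on the order of the points in `⟨A_1, …, A_ℓ | D⟩`. -/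
def rootedRel {l : ℕ} (N : Fin l → ℕ) (x y : Σ i, Fin (N i)) : Prop :=
  (x.1 = y.1 ∧ x.2.val < y.2.val) ∨ (x.1 < y.1 ∧ x.2.val = 0 ∧ y.2.val = 0)

/-- Numbers of top asterisks and a word in the letters over `n` active points. -/
abbrev PreDiagram (n : ℕ) : Type := (Fin n → ℕ) × Word n

/-- The data underlying a diagram. -/
def preDiagram (D : Σ n, Diagram n) : Σ n, PreDiagram n := ⟨D.1, D.2.stars, D.2.word⟩

/-- The concatenation of the monomials of several diagrams. -/
def joinWords {l : ℕ} {N : Fin l → ℕ} (W : ∀ i, Word (N i)) : List (Letter (Σ i, Fin (N i))) :=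
  (List.ofFn fun i => (W i).map (Letter.map (Sigma.mk i))).flatten

open Classical in
/-- The class of `⟨A_1, …, A_ℓ | D⟩`, where `D` is oriented by `t_1 … t_ℓ u`, for data `A i` that
need not be diagrams. -/
def preBracket (R : Type*) [CommRing R] (d : ℕ) {l : ℕ} (A : Fin l → Σ n, PreDiagram n)
    (u : Word l) : GenSpace R d :=
  if h : ∀ i, 0 < (A i).1 then
    extensionSum R d (∑ i, (A i).1) (rootedRel fun i => (A i).1) (fun x => (A x.1).2.1 x.2)
      (joinWords (fun i => (A i).2.2) ++ u.map (Letter.map fun i => ⟨i, ⟨0, h i⟩⟩))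
  else 0

/-- Rooted shuffles are the linear extensions of `rootedRel`. Passing to bare words allows an
argument to be varied inside a relation without carrying proofs that its words orient a diagram. -/
theorem cls_bracketWord {l : ℕ} (A : Fin l → Σ n, Diagram n) (u : Word l) :
    cls R d (bracketWord R A u) = preBracket R d (fun i => preDiagram (A i)) u := by
  classical
  unfold bracketWord preBracket
  by_cases h : ∀ i, 0 < (A i).1
  · rw [dif_pos h, dif_pos (show ∀ i, 0 < (preDiagram (A i)).1 from h), map_sum, extensionSum]
    refine Finset.sum_congr ?_ fun s _ => ?_
    · ext s
      refine (Set.mem_toFinset).trans (Iff.trans ?_ mem_linearExtensions.symm)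
      constructor
      · rintro ⟨h1, h2⟩ ⟨i, p⟩ ⟨j, q⟩ (⟨rfl, h3⟩ | ⟨h3, h4, h5⟩)
        · exact h1 i h3
        · exact h2 i j h3 p q h4 h5
      · intro hs
        exact ⟨fun i p q hpq => hs ⟨i, p⟩ ⟨i, q⟩ (Or.inl ⟨rfl, hpq⟩),
          fun i j hij p q hp hq => hs ⟨i, p⟩ ⟨j, q⟩ (Or.inr ⟨hij, hp, hq⟩)⟩
    · congr 2
      rw [List.map_append, joinWords, List.map_flatten, List.map_ofFn, List.map_map]
      congr 1
      · congr 2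
        funext i
        simp only [Function.comp_apply, List.map_map]
        congr 1
        funext x
        exact (Letter.map_map _ _ x).symm
      · congr 1
        funext x
        exact (Letter.map_map _ _ x).symm
  · rw [dif_neg h, dif_neg (show ¬ ∀ i, 0 < (preDiagram (A i)).1 from h), map_zero]

/-- The word of one factor occurs as a contiguous block, so a relation in that factor is a relation
inside the joined word. -/
theorem joinWords_update {l : ℕ} {N : Fin l → ℕ} (W : ∀ i, Word (N i)) (i : Fin l) :
    ∃ u v : List (Letter (Σ i, Fin (N i))), ∀ w : Word (N i),
      joinWords (Function.update W i w) = u ++ w.map (Letter.map (Sigma.mk i)) ++ v := by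
  obtain ⟨a, b, hab⟩ := List.append_of_mem (List.mem_finRange i)
  have hnd := List.nodup_finRange l
  rw [hab, List.nodup_middle, List.nodup_cons, List.mem_append, not_or] at hnd
  refine ⟨(a.map fun j => (W j).map (Letter.map (Sigma.mk j))).flatten,
    (b.map fun j => (W j).map (Letter.map (Sigma.mk j))).flatten, fun w => ?_⟩
  have hne : ∀ c : List (Fin l), i ∉ c →
      c.map (fun j => (Function.update W i w j).map (Letter.map (Sigma.mk j))) =
        c.map fun j => (W j).map (Letter.map (Sigma.mk j)) := by
    intro c hc
    refine List.map_congr_left fun j hj => ?_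
    rw [Function.update_of_ne (fun h => hc (by rw [← h]; exact hj))]
  rw [joinWords, List.ofFn_eq_map, hab, List.map_append, List.map_cons, hne a hnd.1.1,
    hne b hnd.1.2, List.flatten_append, List.flatten_cons, Function.update_self, List.append_assoc]

theorem sigma_eq_cast {β : ℕ → Type} {m n : ℕ} (h : m = n) (b : β n) :
    (⟨n, b⟩ : Σ n, β n) = ⟨m, h ▸ b⟩ := by
  subst h
  rfl

/-- Separates the numbers of points from the remaining data, so that the type of points stays fixed
while the `i`-th entry varies over `β n`. -/
theorem exists_family {β : ℕ → Type} {l : ℕ} (A : Fin l → Σ n, β n) (i : Fin l) (n : ℕ) (b₀ : β n) :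
    ∃ (N : Fin l → ℕ) (h : N i = n) (E : ∀ j, β (N j)), ∀ b : β n,
      Function.update A i ⟨n, b⟩ = fun j => ⟨N j, Function.update E i (h ▸ b) j⟩ := by
  refine ⟨fun j => (Function.update A i ⟨n, b₀⟩ j).1, by simp,
    fun j => (Function.update A i ⟨n, b₀⟩ j).2, fun b => ?_⟩
  funext j
  by_cases hj : j = i
  · subst hj
    rw [Function.update_self, Function.update_self]
    exact sigma_eq_cast (by simp) b
  · rw [Function.update_of_ne hj, Function.update_of_ne hj]
    change A j = Function.update A i ⟨n, b₀⟩ j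
    rw [Function.update_of_ne hj]

/-- As a function of the word of one of the diagrams, `⟨A_1, …, A_ℓ | D⟩` is a sum over linear
extensions. -/
theorem exists_preBracket_update {l : ℕ} (A : Fin l → Σ n, PreDiagram n) (D : Word l) (i : Fin l)
    (n : ℕ) (k : Fin n → ℕ) :
    (∀ w, preBracket R d (Function.update A i ⟨n, k, w⟩) D = 0) ∨
    ∃ (N : Fin l → ℕ) (f : Fin n → Σ j, Fin (N j)) (M : ℕ)
      (r : (Σ j, Fin (N j)) → (Σ j, Fin (N j)) → Prop) (K : (Σ j, Fin (N j)) → ℕ)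
      (u v : List (Letter (Σ j, Fin (N j)))), Function.Injective f ∧
      ∀ w, preBracket R d (Function.update A i ⟨n, k, w⟩) D =
        extensionSum R d M r K (u ++ w.map (Letter.map f) ++ v) := by
  obtain ⟨N, h, E, hE⟩ := exists_family A i n (k, [])
  subst h
  by_cases h0 : ∀ j, 0 < N j
  · right
    obtain ⟨u, v, huv⟩ := joinWords_update (fun j => (E j).2) i
    refine ⟨N, fun p => ⟨i, p⟩, ∑ j, N j, rootedRel N,
      fun x => Function.update (fun j => (E j).1) i k x.1 x.2, u,
      v ++ D.map (Letter.map fun i => ⟨i, ⟨0, h0 i⟩⟩), fun p q h => by simpa using h, fun w => ?_⟩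
    have h1 : ∀ j, (Function.update E i (k, w) j).1 = Function.update (fun j => (E j).1) i k j :=
      fun j => Function.apply_update (fun j => Prod.fst) E i (k, w) j
    have h2 : (fun j => (Function.update E i (k, w) j).2) =
        Function.update (fun j => (E j).2) i w :=
      funext fun j => Function.apply_update (fun j => Prod.snd) E i (k, w) j
    rw [hE, preBracket, dif_pos h0]
    simp only [h1]
    rw [h2, huv, List.append_assoc _ v]
  · left
    intro w
    rw [hE, preBracket, dif_neg h0]

theorem preBracket_swap {l : ℕ} (A : Fin l → Σ n, PreDiagram n) (D : Word l) (i : Fin l)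
    {n : ℕ} (k : Fin n → ℕ) (u v : Word n) (x y : Letter (Fin n)) :
    preBracket R d (Function.update A i ⟨n, k, u ++ x :: y :: v⟩) D =
      (x.deg d * y.deg d).negOnePow •
        preBracket R d (Function.update A i ⟨n, k, u ++ y :: x :: v⟩) D := by
  obtain h | ⟨N, f, M, r, K, u', v', -, h⟩ := exists_preBracket_update (R := R) (d := d) A D i n k
  · rw [h, h, smul_zero]
  · rw [h, h]
    simp only [List.map_append, List.map_cons, List.append_assoc, List.cons_append]
    rw [← List.append_assoc, extensionSum_swap, deg_map, deg_map, List.append_assoc]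

theorem preBracket_reverse {l : ℕ} (A : Fin l → Σ n, PreDiagram n) (D : Word l) (i : Fin l)
    {n : ℕ} (k : Fin n → ℕ) (u v : Word n) (p q : Fin n) :
    preBracket R d (Function.update A i ⟨n, k, u ++ Letter.chord p q :: v⟩) D =
      (-1 : R) ^ d • preBracket R d (Function.update A i ⟨n, k, u ++ Letter.chord q p :: v⟩) D := by
  obtain h | ⟨N, f, M, r, K, u', v', -, h⟩ := exists_preBracket_update (R := R) (d := d) A D i n k
  · rw [h, h, smul_zero]
  · rw [h, h]
    simp only [List.map_append, List.map_cons, List.append_assoc, List.cons_append, Letter.map,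
      Letter.relabel]
    rw [← List.append_assoc, extensionSum_reverse, List.append_assoc]

theorem preBracket_arnold {l : ℕ} (A : Fin l → Σ n, PreDiagram n) (D : Word l) (i : Fin l)
    {n : ℕ} (k : Fin n → ℕ) (u v : Word n) {a b c : Fin n} (hab : a ≠ b) (hbc : b ≠ c)
    (hca : c ≠ a) :
    preBracket R d (Function.update A i
        ⟨n, k, u ++ Letter.chord a b :: Letter.chord b c :: v⟩) D +
      preBracket R d (Function.update A i
        ⟨n, k, u ++ Letter.chord b c :: Letter.chord c a :: v⟩) D +
      preBracket R d (Function.update A i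
        ⟨n, k, u ++ Letter.chord c a :: Letter.chord a b :: v⟩) D = 0 := by
  obtain h | ⟨N, f, M, r, K, u', v', hf, h⟩ :=
    exists_preBracket_update (R := R) (d := d) A D i n k
  · rw [h, h, h, add_zero, add_zero]
  · rw [h, h, h]
    simp only [List.map_append, List.map_cons, List.append_assoc, List.cons_append, Letter.map,
      Letter.relabel]
    have := extensionSum_arnold (R := R) (d := d) (N := M) r K
      (u' ++ u.map (Letter.map f)) (v.map (Letter.map f) ++ v') (hf.ne hab) (hf.ne hbc) (hf.ne hca)
    simpa only [List.append_assoc, Letter.map] using this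

/-! ### Multilinearity of the bracket -/

section Multilinear
variable {ι κ M : Type*} [Fintype ι] [inst : DecidableEq ι] [AddCommGroup M] [Module R M]

/-- Added terms have a zero coefficient. Sums indexed by different supports can thus be compared
over one common index set. -/
theorem sum_piFinset_support_subset (G : (ι → κ) → M) (a : ι → κ →₀ R) (s : ι → Finset κ)
    (hs : ∀ i, (a i).support ⊆ s i) :
    ∑ f ∈ Fintype.piFinset fun i => (a i).support, (∏ i, a i (f i)) • G f =
      ∑ f ∈ Fintype.piFinset s, (∏ i, a i (f i)) • G f := by
  refine Finset.sum_subset (Fintype.piFinset_subset _ _ hs) fun f _ hf => ?_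
  rw [Fintype.mem_piFinset, not_forall] at hf
  obtain ⟨i, hi⟩ := hf
  have h0 : ∏ i, a i (f i) = 0 :=
    Finset.prod_eq_zero (Finset.mem_univ i) (Finsupp.notMem_support_iff.1 hi)
  rw [h0, zero_smul]

theorem prod_update_apply (a : ι → κ →₀ R) (i : ι) (x : κ →₀ R) (f : ι → κ) :
    ∏ j, Function.update a i x j (f j) = x (f i) * ∏ j ∈ Finset.univ.erase i, a j (f j) := by
  rw [← Finset.mul_prod_erase _ _ (Finset.mem_univ i), Function.update_self]
  congr 1
  refine Finset.prod_congr rfl fun j hj => ?_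
  rw [Function.update_of_ne (Finset.ne_of_mem_erase hj)]

/-- The multilinear map with the given values on families of basis vectors. -/
def finsuppMultilinear (R : Type*) [CommRing R] {M : Type*} [AddCommGroup M] [Module R M]
    (G : (ι → κ) → M) : MultilinearMap R (fun _ : ι => κ →₀ R) M where
  toFun a := ∑ f ∈ Fintype.piFinset fun i => (a i).support, (∏ i, a i (f i)) • G f
  map_update_add' := by
    intro dec a i x y
    obtain rfl : inst = dec := Subsingleton.elim _ _
    classical
    let s : ι → Finset κ := fun j => (a j).support ∪ (x.support ∪ y.support)
    have hs : ∀ z : κ →₀ R, z.support ⊆ x.support ∪ y.support →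
        ∀ j, (Function.update a i z j).support ⊆ s j := by
      intro z hz j
      by_cases hj : j = i
      · subst hj
        rw [Function.update_self]
        exact hz.trans Finset.subset_union_right
      · rw [Function.update_of_ne hj]
        exact Finset.subset_union_left
    rw [sum_piFinset_support_subset G _ s (hs _ Finsupp.support_add),
      sum_piFinset_support_subset G _ s (hs _ Finset.subset_union_left),
      sum_piFinset_support_subset G _ s (hs _ Finset.subset_union_right), ← Finset.sum_add_distrib]
    refine Finset.sum_congr rfl fun f _ => ?_
    rw [prod_update_apply, prod_update_apply, prod_update_apply, ← add_smul, Finsupp.add_apply,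
      add_mul]
  map_update_smul' := by
    intro dec a i c x
    obtain rfl : inst = dec := Subsingleton.elim _ _
    classical
    let s : ι → Finset κ := fun j => (a j).support ∪ x.support
    have hs : ∀ z : κ →₀ R, z.support ⊆ x.support →
        ∀ j, (Function.update a i z j).support ⊆ s j := by
      intro z hz j
      by_cases hj : j = i
      · subst hj
        rw [Function.update_self]
        exact hz.trans Finset.subset_union_right
      · rw [Function.update_of_ne hj]
        exact Finset.subset_union_left
    rw [sum_piFinset_support_subset G _ s (hs _ Finsupp.support_smul),
      sum_piFinset_support_subset G _ s (hs _ subset_rfl), Finset.smul_sum]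
    refine Finset.sum_congr rfl fun f _ => ?_
    rw [prod_update_apply, prod_update_apply, smul_smul, Finsupp.smul_apply, smul_eq_mul, mul_assoc]

theorem finsuppMultilinear_single (G : (ι → κ) → M) (f : ι → κ) :
    finsuppMultilinear R G (fun i => Finsupp.single (f i) 1) = G f := by
  have h := sum_piFinset_support_subset G (fun i => Finsupp.single (f i) (1 : R))
    (fun i => {f i}) fun i => Finsupp.support_single_subset
  refine h.trans ?_
  rw [Fintype.piFinset_singleton, Finset.sum_singleton]
  simp

theorem finsuppMultilinear_smul_single (G : (ι → κ) → M) (c : ι → R) (f : ι → κ) :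
    finsuppMultilinear R G (fun i => c i • Finsupp.single (f i) 1) = (∏ i, c i) • G f := by
  rw [MultilinearMap.map_smul_univ, finsuppMultilinear_single]

/-- If `finsuppMultilinear R G` vanishes as soon as one argument is in the submodule `S` and the
others are multiples of basis vectors, then it only depends on the arguments modulo `S`. -/
theorem finsuppMultilinear_congr (G : (ι → κ) → M) (S : Submodule R (κ →₀ R))
    (hS : ∀ (i : ι) (c : ι → R) (f : ι → κ), ∀ x ∈ S,
      finsuppMultilinear R G
        (Function.update (fun j => c j • Finsupp.single (f j) 1) i x) = 0)
    {a b : ι → κ →₀ R} (hab : ∀ i, a i - b i ∈ S) :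
    finsuppMultilinear R G a = finsuppMultilinear R G b := by
  -- The other arguments are expanded in basis vectors, which reduces the vanishing to `hS`.
  have key : ∀ (a : ι → κ →₀ R) (i : ι), ∀ x ∈ S,
      finsuppMultilinear R G (Function.update a i x) = 0 := by
    intro a i x hx
    -- A nonzero `x` supplies an index `v₀`; the unexpanded place `i` is then written as a one-term
    -- sum over `{v₀}`.
    by_cases hx0 : x = 0
    · rw [hx0]
      exact MultilinearMap.map_coord_zero _ i (Function.update_self i 0 a)
    obtain ⟨v₀, -⟩ := Finsupp.support_nonempty_iff.2 hx0
    let s : ι → Finset κ := Function.update (fun j => (a j).support) i {v₀}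
    let g : ∀ _ : ι, κ → κ →₀ R := fun j v => if j = i then x else a j v • Finsupp.single v 1
    have hg : Function.update a i x = fun j => ∑ v ∈ s j, g j v := by
      funext j
      by_cases hj : j = i
      · subst hj
        simp [s, g]
      · simp only [s, g, Function.update_of_ne hj, if_neg hj, Finsupp.smul_single_one]
        exact (Finsupp.sum_single (a j)).symm
    rw [hg, MultilinearMap.map_sum_finset]
    refine Finset.sum_eq_zero fun r _ => ?_
    have hr : (fun j => g j (r j)) =
        Function.update (fun j => a j (r j) • Finsupp.single (r j) 1) i x := by
      funext j
      by_cases hj : j = i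
      · subst hj
        simp [g]
      · simp [g, hj]
    rw [hr]
    exact hS i _ r x hx
  -- The arguments `b i` are replaced by `a i` one at a time, each replacement changing one argument
  -- by an element of `S`.
  have h : ∀ s : Finset ι, finsuppMultilinear R G (s.piecewise a b) =
      finsuppMultilinear R G b := by
    intro s
    induction s using Finset.induction_on with
    | empty => rw [Finset.piecewise_empty]
    | insert i s hi ih =>
      rw [Finset.piecewise_insert, ← ih, ← sub_eq_zero]
      conv_lhs =>
        rw [← Function.update_eq_self i (s.piecewise a b), Function.update_idem]
      rw [← MultilinearMap.map_update_sub, Finset.piecewise_eq_of_notMem _ _ _ hi]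
      exact key _ _ _ (hab i)
  rw [← h Finset.univ, Finset.piecewise_univ]

end Multilinear

/-! ### Brackets of the diagrams `Z_a ⊨ Ẑ_i` -/

/-- Each star diagram is itself an expansion of a one-point diagram, and gluing the roots in order
reproduces the expansion of the whole diagram. -/
theorem preBracket_starDiagram {l : ℕ} (a j : Fin l → ℕ) (w : Word l) :
    preBracket R d (fun i => preDiagram ⟨j i + 1, starDiagram (a i) (j i)⟩)
        (w.filter Letter.isBottom) =
      expansion R d (fun p q => p < q) a j (normalForm (fun p => a p + j p) w) := by
  -- The root of the i-th star is the old point i, and its other points are the new points over i.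
  let ψ : (Σ i, Fin (j i + 1)) ≃ Expanded j :=
    { toFun := fun x => Fin.cases (motive := fun _ => Expanded j) (.inl x.1)
        (fun s => .inr ⟨x.1, s⟩) x.2
      invFun := Sum.elim (fun i => ⟨i, 0⟩) fun x => ⟨x.1, x.2.succ⟩
      left_inv := by
        rintro ⟨i, x⟩
        refine Fin.cases ?_ (fun s => ?_) x <;> rfl
      right_inv := by
        rintro (i | x) <;> rfl }
  have hpos : ∀ i, 0 < (preDiagram ⟨j i + 1, starDiagram (a i) (j i)⟩).1 := fun i => Nat.succ_pos _
  rw [preBracket, dif_pos hpos, expansion]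
  refine extensionSum_congr ψ ?_ ?_ ?_ ?_
  · rw [← Fintype.card_congr ψ, Fintype.card_sigma]
    refine Finset.sum_congr rfl fun i _ => (Fintype.card_fin _).symm
  · rintro ⟨i, x⟩ ⟨i', y⟩
    change Fin (j i + 1) at x
    change Fin (j i' + 1) at y
    refine Fin.cases ?_ (fun s => ?_) x <;> refine Fin.cases ?_ (fun s' => ?_) y
    · change _ ↔ i < i'
      simp [rootedRel]
    · change _ ↔ i = i'
      simp [rootedRel]
    · change _ ↔ False
      simp [rootedRel]
    · change _ ↔ i = i' ∧ s.val < s'.val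
      simp [rootedRel]
  · rintro ⟨i, x⟩
    change Fin (j i + 1) at x
    refine Fin.cases ?_ (fun s => ?_) x <;> rfl
  · rw [normalForm, joinWords, List.map_append, List.map_append, List.map_flatten, List.map_flatten,
      List.map_ofFn, List.map_ofFn]
    congr 1
    · congr 2
      funext i
      change ((((zWord (a i + j i)).map (expand (fun _ => a i) fun _ => j i)).map
        (Letter.map (starPoints (j i)))).map
          (Letter.map fun p => (⟨i, p⟩ : Σ i, Fin (j i + 1)))).map (Letter.map ψ) =
        ((zWord (a i + j i)).map (Letter.map fun _ => i)).map (expand a j)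
      simp only [List.map_map]
      congr 1
      funext x
      cases x <;> simp only [Function.comp_apply, Letter.map, Letter.relabel, expand] <;>
        (try split_ifs) <;> rfl
    · rw [List.map_map]
      refine List.map_congr_left fun x hx => ?_
      have hb := (List.mem_filter.1 hx).2
      cases x <;> first | rfl | (simp [Letter.isBottom] at hb)

theorem starDiagram_zero (k : ℕ) : starDiagram k 0 = Z k := by
  have h1 : (starDiagram k 0).stars = (Z k).stars := by
    funext p
    obtain rfl : p = 0 := Fin.ext (by omega)
    rfl
  have h2 : (starDiagram k 0).word = (Z k).word := by
    rw [starDiagram_word]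
    simp [Z, zWord]
  revert h1 h2
  generalize starDiagram k 0 = A
  generalize Z k = B
  obtain ⟨s, w, h⟩ := A
  obtain ⟨s', w', h'⟩ := B
  rintro rfl rfl
  rfl

/-- The monomial of `D.bottom` is already in normal form, so no sign arises and the bracket is the
multilinear extension of its values on diagrams. -/
theorem cls_bracket_bottom {l : ℕ} (a : Fin l → FreeSpace R) (D : Diagram l) :
    cls R d (bracket R d a D.bottom) = finsuppMultilinear R
      (fun f => cls R d (bracketWord R f (D.word.filter Letter.isBottom))) a := by
  rw [bracket, map_sum]
  refine Finset.sum_congr rfl fun f _ => ?_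
  rw [map_smul, bracketDiagram]
  change _ • cls R d (normalSign d (bottomWord D.word) •
    bracketWord R f ((bottomWord D.word).filter Letter.isBottom)) = _
  rw [normalSign_bottomWord, filter_bottomWord, one_smul]

theorem cls_bracket_starDiagram {l : ℕ} (a j : Fin l → ℕ) (D : Diagram l) :
    cls R d (bracketWord R (fun i => ⟨j i + 1, starDiagram (a i) (j i)⟩)
        (D.word.filter Letter.isBottom)) =
      expansion R d (fun p q => p < q) a j (normalForm (fun p => a p + j p) D.word) := by
  rw [cls_bracketWord, preBracket_starDiagram]

/-- The weighted sums of the expansions of a diagram are brackets. -/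
theorem expansionWord_eq_bracket {l : ℕ} (c : ℕ → R) (D : Diagram l) :
    expansionWord R d c (fun p q => p < q) D.stars D.word = normalSign d D.word •
      cls R d (bracket R d (fun i => ∑ t ∈ Finset.range (D.stars i + 1),
        c t • glue R d (Z (D.stars i - t)) (Zhat t)) D.bottom) := by
  rw [cls_bracket_bottom, MultilinearMap.map_sum_finset, expansionWord, Finset.smul_sum]
  refine Finset.sum_congr rfl fun j hj => ?_
  simp only [glue_Z_Zhat]
  rw [finsuppMultilinear_smul_single _ (fun i => c (j i)), cls_bracket_starDiagram,
    expansion_eq_normalForm D.isOrienting, smul_comm]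
  congr 4
  funext p
  have := Finset.mem_range.1 (Fintype.mem_piFinset.1 hj p)
  omega

/-- This is the expansion with j = 0, because Z_k is the star with no chords. -/
theorem cls_eq_bracket {l : ℕ} (D : Diagram l) :
    D.cls R d = normalSign d D.word •
      cls R d (bracket R d (fun i => zElt R (D.stars i)) D.bottom) := by
  have h : (fun i => zElt R (D.stars i)) =
      fun i => Finsupp.single ⟨0 + 1, starDiagram (D.stars i) 0⟩ (1 : R) := by
    funext i
    rw [starDiagram_zero]
    rfl
  rw [cls_bracket_bottom, h, finsuppMultilinear_single,
    cls_bracket_starDiagram D.stars (fun _ => 0), ← cls_ofWord, ← expansion_zero,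
    expansion_eq_normalForm D.isOrienting]
  rfl

theorem mapI_eq_expansionMap : mapI R d = expansionMap R d fun _ => 1 := by
  refine genSpace_hom_ext fun n D => ?_
  rw [expansionMap_cls, expansionWord_eq_bracket, ← cls_units_smul]
  simp only [one_smul]
  change cls R d (mapIFree R d (Finsupp.single ⟨n, D⟩ 1)) = _
  rw [mapIFree, Finsupp.lsum_single]
  simp only [LinearMap.smulRight_apply, LinearMap.id_apply, one_smul]
  rfl

/-- Over a single point the constraints already order all points, so only one diagram occurs. -/
theorem expansion_zWord (a i : ℕ) :
    expansion R d (fun p q => p < q) (fun _ => a) (fun _ => i) (zWord (a + i)) =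
      (starDiagram a i).cls R d := by
  rw [← cls_ofWord, ← extensionSum_lt, expansion]
  refine extensionSum_congr (starPoints i)
    ((Fintype.card_congr (starPoints i)).trans (Fintype.card_fin _)) ?_ ?_ rfl
  · rintro (p | ⟨p, s⟩) (q | ⟨q, t⟩)
    · simp [expandRel, starPoints, Subsingleton.elim p q]
    · simp [expandRel, starPoints, Subsingleton.elim p q]
    · simp [expandRel, starPoints]
    · simp [expandRel, starPoints, Subsingleton.elim p q]
  · intro x
    change _ = expandStars _ _ ((starPoints i).symm (starPoints i x))
    rw [Equiv.symm_apply_apply]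

theorem expansionMap_cls_Z (c : ℕ → R) (k : ℕ) : expansionMap R d c ((Z k).cls R d) =
    ∑ i ∈ Finset.range (k + 1), c i • cls R d (glue R d (Z (k - i)) (Zhat i)) := by
  rw [expansionMap_cls, expansionWord]
  refine Finset.sum_equiv (Equiv.funUnique (Fin 1) ℕ) ?_ ?_
  · intro j
    simp [Fintype.mem_piFinset, Z]
  · intro j hj
    obtain ⟨i, rfl⟩ : ∃ i, j = fun _ => i :=
      ⟨j 0, funext fun p => by rw [Subsingleton.elim p 0]⟩
    have hi : i < k + 1 := Finset.mem_range.1 (Fintype.mem_piFinset.1 hj 0)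
    have hk : k = k - i + i := by omega
    have hw : (Z k).word = zWord (k - i + i) := by rw [← hk]; rfl
    rw [hw, glue_Z_Zhat]
    change _ = c i • (starDiagram (k - i) i).cls R d
    rw [← expansion_zWord]
    simp [Z]

/-! ### Independence of representatives -/

/-- With the other arguments fixed, the bracket is linear in the `i`-th one and given on words by
`preBracket`, which satisfies all the relations. -/
theorem finsuppMultilinear_bracketWord_relations {l : ℕ} (u : Word l) (i : Fin l) (c : Fin l → R)
    (f : Fin l → Σ n, Diagram n) {x : FreeSpace R} (hx : x ∈ relations R d) :
    finsuppMultilinear R (fun f => cls R d (bracketWord R f u))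
      (Function.update (fun j => c j • Finsupp.single (f j) 1) i x) = 0 := by
  have h := relations_le_ker_of_words (d := d)
    ((finsuppMultilinear R (fun f => cls R d (bracketWord R f u))).toLinearMap
      (fun j => c j • Finsupp.single (f j) 1) i)
    (fun n k w => (∏ j, Function.update c i 1 j) •
      preBracket R d (Function.update (fun j => preDiagram (f j)) i ⟨n, k, w⟩) u)
    ?_ ?_ ?_ ?_
  · exact LinearMap.mem_ker.1 (h hx)
  · intro n k w hw
    -- The diagram inserted at place `i` has coefficient 1, so the scalar `c i` is replaced by 1.
    have h1 : Function.update (fun j => c j • Finsupp.single (f j) (1 : R)) i (ofWord R k w) =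
        fun j => Function.update c i 1 j •
          Finsupp.single (Function.update f i ⟨n, k, w, hw⟩ j) (1 : R) := by
      funext j
      by_cases hj : j = i
      · subst hj
        simp [ofWord, hw]
      · simp [hj]
    have h2 : (fun j => preDiagram (Function.update f i ⟨n, k, w, hw⟩ j)) =
        Function.update (fun j => preDiagram (f j)) i ⟨n, k, w⟩ :=
      funext fun j => Function.apply_update (fun _ => preDiagram) f i ⟨n, k, w, hw⟩ j
    rw [MultilinearMap.toLinearMap_apply, h1, finsuppMultilinear_smul_single, cls_bracketWord, h2]
  · intro n k v v' x y
    rw [preBracket_swap, smul_comm]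
  · intro n k v v' p q
    rw [preBracket_reverse, smul_comm]
  · intro n k v v' a b e hab hbe hea
    rw [← smul_add, ← smul_add, preBracket_arnold _ _ _ _ _ _ hab hbe hea, smul_zero]

theorem cls_bracket_bottom_congr {l : ℕ} {a b : Fin l → FreeSpace R}
    (hab : ∀ i, cls R d (a i) = cls R d (b i)) (D : Diagram l) :
    cls R d (bracket R d a D.bottom) = cls R d (bracket R d b D.bottom) := by
  rw [cls_bracket_bottom, cls_bracket_bottom]
  exact finsuppMultilinear_congr _ (relations R d)
    (fun i c f _ hx => finsuppMultilinear_bracketWord_relations _ i c f hx)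
    fun i => (Submodule.Quotient.eq _).1 (hab i)

end TDiagram

end

/-! ### Assembly of the proposition -/

theorem proposition8p1 (R : Type*) [CommRing R] (d : ℕ) :
    ∃ e : TDiagram.GenSpace R d ≃ₗ[R] TDiagram.GenSpace R d,
      -- `I` is the linear isomorphism `e`, and it restricts to one of the space of diagrams
      (e : TDiagram.GenSpace R d →ₗ[R] TDiagram.GenSpace R d) = TDiagram.mapI R d ∧
      (TDiagram.Space R d).map (TDiagram.mapI R d) = TDiagram.Space R d ∧
      -- the value of the inverse on `Z_k`
      (∀ k : ℕ, e.symm ((TDiagram.Z k).cls R d) =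
        ∑ i ∈ Finset.range (k + 1), (-1 : R) ^ (i + d * (i * (i - 1) / 2)) •
          TDiagram.cls R d (TDiagram.glue R d (TDiagram.Z (k - i)) (TDiagram.Zhat i))) ∧
      -- every oriented diagram `D` is `⟨Z_{k_1}, …, Z_{k_ℓ} | D_bottom⟩` up to the sign of reordering,
      -- and the inverse sends it to `⟨I⁻¹ Z_{k_1}, …, I⁻¹ Z_{k_ℓ} | D_bottom⟩`, for any
      -- representatives `a i` of the elements `I⁻¹ Z_{k_i}`
      ∀ (n : ℕ) (D : TDiagram.Diagram n),
        D.cls R d = TDiagram.normalSign d D.word • TDiagram.cls R d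
          (TDiagram.bracket R d (fun i => TDiagram.zElt R (D.stars i)) D.bottom) ∧
        ∀ a : Fin n → TDiagram.FreeSpace R,
          (∀ i, TDiagram.cls R d (a i) = e.symm ((TDiagram.Z (D.stars i)).cls R d)) →
          e.symm (D.cls R d) = TDiagram.normalSign d D.word •
            TDiagram.cls R d (TDiagram.bracket R d a D.bottom) := by
  have hsymm : ∀ x, (TDiagram.expansionEquiv R d).symm x =
      TDiagram.expansionMap R d (TDiagram.signWeight R d) x := fun _ => rfl
  refine ⟨TDiagram.expansionEquiv R d, TDiagram.mapI_eq_expansionMap.symm, ?_, fun k => ?_,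
    fun n D => ⟨TDiagram.cls_eq_bracket D, fun a ha => ?_⟩⟩
  · rw [TDiagram.mapI_eq_expansionMap, TDiagram.map_expansionMap_one_space]
  · rw [hsymm, TDiagram.expansionMap_cls_Z]
    rfl
  · rw [hsymm, TDiagram.expansionMap_cls, TDiagram.expansionWord_eq_bracket]
    congr 1
    -- The inverse has been written as a bracket of explicit representatives; only their classes
    -- matter, so `a` may take their place.
    refine TDiagram.cls_bracket_bottom_congr (fun i => ?_) D
    rw [ha, hsymm, TDiagram.expansionMap_cls_Z, map_sum]
    exact Finset.sum_congr rfl fun t _ => map_smul _ _ _
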